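/- Theorem (Extension problem for positive powers). Let $n\ge 1$, $0<s<1$, $a=1-2s$, and let $u:\mathbb{R}^n\to\mathbb{R}$ be a Schwartz function. Write $e^{t\Delta}f(x)=\int_{\mathbb{R}^n}(4\pi t)^{-n/2}e^{-|x-z|^2/(4t)}f(z)\,dz$ for $t>0$, and let $(-\Delta)^su$ be the inverse Fourier transform of $|\xi|^{2s}\widehat u(\xi)$, where the Fourier transform is normalized so that $\widehat{-\Delta u}(\xi)=|\xi|^2\widehat u(\xi)$. Say that $U:\mathbb{R}^n\times[0,\infty)\to\mathbb{R}$ weakly vanishes as $y\to\infty$ if its slices $U(\cdot,y)$ are tempered locally uniformly in $y$, i.e. for every $Y>0$ there are $N\in\mathbb N$, $C$ with $\int_{\mathbb{R}^n}|U(x,y)|(1+|x|)^{-N}\,dx\le C$ for all $0\le y\le Y$, and $\int_{\mathbb{R}^n}U(x,y)\varphi(x)\,dx\to0$ as $y\to\infty$ for every Schwartz function $\varphi$. The problem $$\begin{cases}\Delta_xU+\frac ayU_y+U_{yy}=0&\text{in }\mathbb{R}^n\times(0,\infty)\\ U(x,0)=u(x)&\text{on }\mathbb{R}^n\end{cases}$$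 has exactly one solution $U\in C^2(\mathbb{R}^n\times(0,\infty))\cap C(\mathbb{R}^n\times[0,\infty))$ that weakly vanishes as $y\to\infty$. For all $x\in\mathbb{R}^n$ and $y>0$ it is given by $$\begin{aligned}U(x,y)&=\frac{y^{2s}}{4^s\Gamma(s)}\int_0^\infty e^{-y^2/(4t)}e^{t\Delta}u(x)\,\frac{dt}{t^{1+s}}\\&=\frac1{\Gamma(s)}\int_0^\infty e^{-t}e^{\frac{y^2}{4t}\Delta}u(x)\,\frac{dt}{t^{1-s}}\\&=\frac1{\Gamma(s)}\int_0^\infty e^{-y^2/(4t)}e^{t\Delta}\big((-\Delta)^su\big)(x)\,\frac{dt}{t^{1-s}}\\&=\frac{\Gamma(n/2+s)}{\Gamma(s)\pi^{n/2}}\int_{\mathbb{R}^n}\frac{y^{2s}}{(y^2+|x-z|^2)^{(n+2s)/2}}\,u(z)\,dz,\end{aligned}$$ all four integrals being absolutely convergent. Moreover $U\in C^\infty(\mathbb{R}^n\times(0,\infty))\cap C(\mathbb{R}^n\times[0,\infty))$ and, for every $x\in\mathbb{R}^n$, $$-\lim_{y\to0^+}y^aU_y(x,y)=\frac{\Gamma(1-s)}{4^{s-1/2}\Gamma(s)}(-\Delta)^su(x),\qquad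 -\lim_{y\to0^+}\frac{U(x,y)-U(x,0)}{y^{2s}}=\frac{\Gamma(1-s)}{4^s\Gamma(1+s)}(-\Delta)^su(x).$$ -/

import Mathlib

open MeasureTheory Set Filter Topology
open scoped FourierTransform SchwartzMap ContDiff InnerProductSpace

namespace FractionalExtension

/-- The Gauss--Weierstrass heat kernel `G_t(x) = (4πt)^{-n/2} e^{-|x|²/(4t)}` on `ℝⁿ`, `t > 0`. -/
noncomputable def heatKernel {n : ℕ} (t : ℝ) (x : EuclideanSpace ℝ (Fin n)) : ℝ :=
  1 / (4 * Real.pi * t) ^ ((n : ℝ) / 2) * Real.exp (-(‖x‖ ^ 2 / (4 * t)))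

/-- The heat semigroup `e^{tΔ} f (x) = ∫ G_t(x - z) f(z) dz`, `t > 0`. -/
noncomputable def heatSemigroup {n : ℕ} (t : ℝ) (f : EuclideanSpace ℝ (Fin n) → ℝ)
    (x : EuclideanSpace ℝ (Fin n)) : ℝ :=
  ∫ z, heatKernel t (x - z) * f z

/-- The Fourier side of `(-Δ)^s u`. Mathlib's Fourier transform uses the character
`e^{-2πi x·ξ}`, so that `-Δ` has the symbol `(2π|ξ|)²` and `(-Δ)^s` the symbol `(2π|ξ|)^{2s}`. -/
noncomputable def fracLaplacianSymbol {n : ℕ} (s : ℝ) (u : EuclideanSpace ℝ (Fin n) → ℝ)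
    (ξ : EuclideanSpace ℝ (Fin n)) : ℂ :=
  (((2 * Real.pi * ‖ξ‖) ^ (2 * s) : ℝ) : ℂ) *
    𝓕 (fun z : EuclideanSpace ℝ (Fin n) => (u z : ℂ)) ξ

/-- The fractional Laplacian `(-Δ)^s u` of a real function, given by multiplication with `|ξ|^{2s}`
on the Fourier side. The inverse transform is real, see `ofReal_fracLaplacian`. -/
noncomputable def fracLaplacian {n : ℕ} (s : ℝ) (u : EuclideanSpace ℝ (Fin n) → ℝ)
    (x : EuclideanSpace ℝ (Fin n)) : ℝ :=
  (𝓕⁻ (fracLaplacianSymbol s u) x).re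

/-- The inverse Fourier transform defining the fractional Laplacian of a real function is real,
so that nothing is lost in taking the real part. -/
theorem ofReal_fracLaplacian {n : ℕ} (s : ℝ) (u : EuclideanSpace ℝ (Fin n) → ℝ)
    (x : EuclideanSpace ℝ (Fin n)) :
    ((fracLaplacian s u x : ℝ) : ℂ) = 𝓕⁻ (fracLaplacianSymbol s u) x := by
  have h1 : ∀ ξ, (starRingEnd ℂ) (fracLaplacianSymbol s u ξ) = fracLaplacianSymbol s u (-ξ) := by
    intro ξ
    simp only [fracLaplacianSymbol, map_mul, Complex.conj_ofReal, norm_neg]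
    congr 1
    rw [Real.fourier_eq', Real.fourier_eq', ← integral_conj]
    congr 1
    ext v
    simp [← Complex.exp_conj, Complex.conj_ofNat]
  apply Complex.conj_eq_iff_re.mp
  rw [Real.fourierInv_eq', ← integral_conj, ← integral_neg_eq_self]
  congr 1
  ext v
  simp only [smul_eq_mul, map_mul, h1, neg_neg]
  simp [← Complex.exp_conj, Complex.conj_ofNat]

/-- `U` is a classical solution, continuous up to the boundary, of the extension problem
`Δ_x U + (a / y) U_y + U_yy = 0` in `ℝⁿ × (0, ∞)`, `U(x, 0) = u(x)`, with `a = 1 - 2s`.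
Only the values `U x y` with `0 ≤ y` matter. -/
structure IsExtensionSolution {n : ℕ} (s : ℝ) (u : EuclideanSpace ℝ (Fin n) → ℝ)
    (U : EuclideanSpace ℝ (Fin n) → ℝ → ℝ) : Prop where
  contDiffOn : ContDiffOn ℝ 2 (Function.uncurry U) (univ ×ˢ Ioi 0)
  continuousOn : ContinuousOn (Function.uncurry U) (univ ×ˢ Ici 0)
  equation : ∀ (x : EuclideanSpace ℝ (Fin n)) (y : ℝ), 0 < y →
    Laplacian.laplacian (fun x' => U x' y) x + (1 - 2 * s) / y * deriv (U x) y
      + deriv (deriv (U x)) y = 0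
  boundary : ∀ x, U x 0 = u x

/-- The slices `U(·, y)` are tempered, locally uniformly in `y ∈ [0, ∞)`: on every `[0, Y]` there
are `N` and `C` with `∫ |U(x, y)| (1 + |x|)^{-N} dx ≤ C`. -/
def IsLocallyTempered {n : ℕ} (U : EuclideanSpace ℝ (Fin n) → ℝ → ℝ) : Prop :=
  ∀ Y : ℝ, ∃ (N : ℕ) (C : ℝ), ∀ y ∈ Icc 0 Y,
    Integrable (fun x => |U x y| / (1 + ‖x‖) ^ N) ∧ ∫ x, |U x y| / (1 + ‖x‖) ^ N ≤ C

/-- `U` weakly vanishes as `y → ∞`: the slices `U(·, y)` are tempered distributions, locally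
uniformly in `y`, and `∫ U(x, y) φ(x) dx → 0` as `y → ∞` for every Schwartz function `φ`. -/
structure WeaklyVanishes {n : ℕ} (U : EuclideanSpace ℝ (Fin n) → ℝ → ℝ) : Prop where
  tempered : IsLocallyTempered U
  tendsto : ∀ φ : 𝓢(EuclideanSpace ℝ (Fin n), ℝ),
    Tendsto (fun y => ∫ x, U x y * φ x) atTop (𝓝 0)

end FractionalExtension

/-! Existence. On the Fourier side the heat semigroup is multiplication by `exp (-t (2π|ξ|)²)`
(`ofReal_heatSemigroup`), so the second formula can be taken as the definition of `extension`: its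
weight is a fixed integrable function of `t`, hence boundedness and continuity up to `y = 0` are
dominated convergence. The substitution `t ↦ y²/(4t)` gives the first formula. Fubini and the
inverse Gamma integral give the Poisson formula. Scaling `t` by `(2π|ξ|)²` for each frequency moves
the factor `(2π|ξ|)^{2s}` onto the datum and gives the third. The Poisson form yields smoothness and
the equation, because potentials with kernel `(y² + |x - z|²)^{-β}` are closed under
differentiation, and it yields decay like `y^{-n}`. The third formula yields the boundary limits:
differentiate in `y`, rescale `t` by `y²`, and let the heat flow of `(-Δ)^s u` tend to its initial
value.

Uniqueness is the harder half, since weak vanishing gives no pointwise control. Let `W` be the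
difference of two solutions, and pair `W(·, y)` with a self-similar solution `F_t(z) = t^{-α}
h(z/√t)` of the heat equation. Moving the Laplacian from `W` to `F_t`, the pairing `V(t, y)`
formally solves `V_t + V_yy + (a/y) V_y = 0` with `V(t, 0) = 0`. Read backwards in `t`, it is an
ancient solution of a heat equation, and a barrier argument shows that a bounded one vanishes
(`heatScale_pairing_eq_zero_of_bounded`). As derivatives of `W` may grow, the argument runs on
pairings with a wide cutoff, which solve the equation up to a small error (`exists_cutoff_pairing`).

Boundedness comes from Banach–Steinhaus on the Schwartz space: the functionals `W(·, y)`, `y ≥ 0`,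
are bounded together by finitely many seminorms. For `h = Δ^k` of the Gaussian, `α = n/2 + k`, and
for large `k` the powers of `t` in these seminorms stay bounded as `t → ∞`
(`exists_laplacianProfile_pairing_bounded`). So these pairings vanish. Descending in `k`, the
pairing with `Δ^j` of the Gaussian has zero `t`-derivative, hence is constant in `t`, hence bounded,
hence zero (`heatScale_pairing_eq_zero_of_laplacian`). At `k = 0` all Gaussian averages of `W(·, y)`
about the origin vanish; an approximate identity and translation then give `W = 0`. -/

open MeasureTheory Set Filter Topology
open scoped FourierTransform SchwartzMap ContDiff InnerProductSpace

/-! ### Completeness of the Schwartz space and uniform boundedness -/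

namespace SchwartzMap

variable {E F : Type*} [NormedAddCommGroup E] [NormedSpace ℝ E]
  [NormedAddCommGroup F] [NormedSpace ℝ F]

/-- The weighted derivative `x ↦ ‖x‖ ^ k • D ^ n f x` as a bounded continuous function. -/
noncomputable def weightedDerivBCF (k n : ℕ) (f : 𝓢(E, F)) :
    BoundedContinuousFunction E (ContinuousMultilinearMap ℝ (fun _ : Fin n => E) F) :=
  BoundedContinuousFunction.ofNormedAddCommGroup (fun x => ‖x‖ ^ k • iteratedFDeriv ℝ n f x)
    ((continuous_norm.pow k).smul ((f.smooth n).continuous_iteratedFDeriv le_rfl))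
    (SchwartzMap.seminorm ℝ k n f) (fun x => by
      rw [norm_smul, norm_pow, norm_norm]
      exact le_seminorm ℝ k n f x)

theorem weightedDerivBCF_apply (k n : ℕ) (f : 𝓢(E, F)) (x : E) :
    weightedDerivBCF k n f x = ‖x‖ ^ k • iteratedFDeriv ℝ n f x := rfl

theorem norm_weightedDerivBCF_le (k n : ℕ) (f : 𝓢(E, F)) :
    ‖weightedDerivBCF k n f‖ ≤ SchwartzMap.seminorm ℝ k n f :=
  (BoundedContinuousFunction.norm_le (apply_nonneg _ _)).2 fun x => by
    rw [weightedDerivBCF_apply, norm_smul, norm_pow, norm_norm]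
    exact le_seminorm ℝ k n f x

theorem weightedDerivBCF_add (k n : ℕ) (f g : 𝓢(E, F)) :
    weightedDerivBCF k n (f + g) = weightedDerivBCF k n f + weightedDerivBCF k n g := by
  ext1 x
  simp only [weightedDerivBCF_apply, BoundedContinuousFunction.coe_add, Pi.add_apply]
  rw [← smul_add, ← iteratedFDeriv_add_apply ((f.smooth n).contDiffAt) (g.smooth n).contDiffAt]
  rfl

theorem weightedDerivBCF_smul (k n : ℕ) (a : ℝ) (f : 𝓢(E, F)) :
    weightedDerivBCF k n (a • f) = a • weightedDerivBCF k n f := by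
  ext1 x
  simp only [weightedDerivBCF_apply, BoundedContinuousFunction.coe_smul]
  rw [smul_comm, ← iteratedFDeriv_const_smul_apply (f.smooth n).contDiffAt]
  rfl

/-- `weightedDerivBCF` as a continuous linear map. -/
noncomputable def weightedDerivCLM (k n : ℕ) : 𝓢(E, F) →L[ℝ]
    BoundedContinuousFunction E (ContinuousMultilinearMap ℝ (fun _ : Fin n => E) F) :=
  mkCLMtoNormedSpace (𝕜 := ℝ) (σ := RingHom.id ℝ) (D := E) (E := F) (weightedDerivBCF k n)
    (weightedDerivBCF_add k n) (weightedDerivBCF_smul k n)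
    ⟨{(k, n)}, 1, zero_le_one, fun f => by
      rw [one_mul, Finset.sup_singleton]
      exact norm_weightedDerivBCF_le k n f⟩

theorem weightedDerivCLM_apply (k n : ℕ) (f : 𝓢(E, F)) (x : E) :
    weightedDerivCLM k n f x = ‖x‖ ^ k • iteratedFDeriv ℝ n f x := rfl

/-- Each weighted derivative is Cauchy in the sup norm and so has a uniform limit `g k n`. Uniform
convergence of derivatives makes `g 0 (n + 1)` the derivative of `g 0 n`, and the boundedness of `g
k n` is the decay of the limit function. -/
theorem exists_tendsto_of_cauchySeq [CompleteSpace F] {u : ℕ → 𝓢(E, F)} (hu : CauchySeq u) :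
    ∃ f, Tendsto u atTop (𝓝 f) := by
  have h1 : ∀ k n : ℕ,
      ∃ g : BoundedContinuousFunction E (ContinuousMultilinearMap ℝ (fun _ : Fin n => E) F),
        Tendsto (fun i => weightedDerivCLM k n (u i)) atTop (𝓝 g) := by
    intro k n
    have h2 : Tendsto (fun p : ℕ × ℕ => u p.2 - u p.1) atTop (𝓝 0) := by
      have := cauchySeq_iff_tendsto.1 hu
      rw [uniformity_eq_comap_nhds_zero, tendsto_comap_iff] at this
      exact this
    have h3 := (((schwartz_withSeminorms ℝ E F).continuous_seminorm (k, n)).tendsto 0).comp h2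
    rw [map_zero] at h3
    refine cauchySeq_tendsto_of_complete (Metric.cauchySeq_iff'.2 fun ε hε => ?_)
    obtain ⟨⟨N, N'⟩, hN⟩ := eventually_atTop.1 (h3.eventually (gt_mem_nhds (half_pos hε)))
    refine ⟨max N N', fun i hi => ?_⟩
    refine lt_of_le_of_lt ?_ (half_lt_self hε)
    refine (BoundedContinuousFunction.dist_le (half_pos hε).le).2 fun x => ?_
    rw [weightedDerivCLM_apply, weightedDerivCLM_apply, dist_eq_norm, ← smul_sub,
      ← iteratedFDeriv_sub_apply ((u i).smooth n).contDiffAt ((u (max N N')).smooth n).contDiffAt,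
      norm_smul, norm_pow, norm_norm]
    exact (le_seminorm ℝ k n (u i - u (max N N')) x).trans
      (hN (max N N', i) ⟨le_max_left _ _, (le_max_right _ _).trans hi⟩).le
  choose g hg using h1
  have hpt : ∀ k n x, Tendsto (fun i => ‖x‖ ^ k • iteratedFDeriv ℝ n (u i) x) atTop
      (𝓝 (g k n x)) := fun k n x =>
    ((BoundedContinuousFunction.tendsto_iff_tendstoUniformly.1 (hg k n)).tendsto_at x)
  -- The weight passes through pointwise limits, so the unweighted limits determine all the others.
  have hg0 : ∀ k n x, g k n x = ‖x‖ ^ k • g 0 n x := fun k n x => by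
    refine tendsto_nhds_unique (hpt k n x) ?_
    have := (hpt 0 n x).const_smul (‖x‖ ^ k)
    simpa using this
  let f : E → F := fun x => g 0 0 x 0
  have htaylor : HasFTaylorSeriesUpTo ∞ f (fun x n => g 0 n x) := by
    refine ⟨fun x => rfl, fun m hm x => ?_, fun m hm => (g 0 m).continuous⟩
    refine hasFDerivAt_of_tendstoUniformly (l := atTop)
      (f := fun i x => iteratedFDeriv ℝ m (u i) x)
      (f' := fun i x => (iteratedFDeriv ℝ (m + 1) (u i) x).curryLeft)
      (g' := fun x => (g 0 (m + 1) x).curryLeft) ?_ ?_ ?_ x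
    · have h2 : TendstoUniformly (fun i x => iteratedFDeriv ℝ (m + 1) (u i) x)
          (g 0 (m + 1)) atTop := by
        have : TendstoUniformly (fun i x => weightedDerivCLM 0 (m + 1) (u i) x)
          (g 0 (m + 1)) atTop := BoundedContinuousFunction.tendsto_iff_tendstoUniformly.1 (hg 0 (m + 1))
        simpa only [weightedDerivCLM_apply, pow_zero, one_smul] using this
      exact (continuousMultilinearCurryLeftEquiv ℝ (fun _ : Fin (m + 1) => E)
        F).lipschitz.uniformContinuous.comp_tendstoUniformly h2
    · intro i y
      have h3 := ((u i).smooth ⊤).differentiable_iteratedFDeriv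
        (m := m) (mod_cast ENat.natCast_lt_top m) y
      have h4 := h3.hasFDerivAt
      rwa [fderiv_iteratedFDeriv] at h4
    · intro y
      simpa using hpt 0 m y
  have hD : ∀ n x, iteratedFDeriv ℝ n f x = g 0 n x := fun n x =>
    (htaylor.eq_iteratedFDeriv (mod_cast le_top) x).symm
  let f' : 𝓢(E, F) := ⟨f, htaylor.contDiff, fun k n => ⟨‖g k n‖, fun x => by
    rw [hD, ← norm_norm x, ← norm_pow, ← norm_smul, ← hg0]
    exact (g k n).norm_coe_le_norm x⟩⟩
  refine ⟨f', ((schwartz_withSeminorms ℝ E F).tendsto_nhds u f').2 fun ⟨k, n⟩ ε hε => ?_⟩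
  have h5 := (Metric.tendsto_nhds.1 (hg k n)) (ε / 2) (half_pos hε)
  filter_upwards [h5] with i hi
  refine lt_of_le_of_lt (b := ε / 2) ?_ (half_lt_self hε)
  refine seminorm_le_bound ℝ k n _ (half_pos hε).le fun x => ?_
  have h6 : iteratedFDeriv ℝ n (⇑(u i - f')) x = iteratedFDeriv ℝ n (u i) x - g 0 n x := by
    rw [← hD]
    exact iteratedFDeriv_sub_apply ((u i).smooth n).contDiffAt (f'.smooth n).contDiffAt
  rw [h6, ← norm_norm x, ← norm_pow, ← norm_smul, smul_sub, ← hg0,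
    ← weightedDerivCLM_apply, ← dist_eq_norm]
  exact (BoundedContinuousFunction.dist_coe_le_dist x).trans hi.le

instance instIsCountablyGeneratedUniformity :
    (uniformity 𝓢(E, F)).IsCountablyGenerated :=
  IsUniformAddGroup.uniformity_countably_generated

instance instCompleteSpace [CompleteSpace F] : CompleteSpace 𝓢(E, F) :=
  UniformSpace.complete_of_cauchySeq_tendsto fun _ hu => exists_tendsto_of_cauchySeq hu

/-- A countably generated uniformity comes from a pseudometric, so completeness puts the space
within reach of the Baire category theorem. This is the input to Banach–Steinhaus. -/
instance instBaireSpace [CompleteSpace F] : BaireSpace 𝓢(E, F) := by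
  let := UniformSpace.pseudoMetricSpace 𝓢(E, F)
  infer_instance

/-- **Uniform boundedness** on the Schwartz space: a pointwise bounded family of continuous linear
functionals is bounded by a single multiple of finitely many Schwartz seminorms. -/
theorem exists_seminorm_bound_of_pointwise_bounded {ι : Type*} (T : ι → 𝓢(E, ℝ) →L[ℝ] ℝ)
    (hT : ∀ φ, ∃ C, ∀ i, |T i φ| ≤ C) :
    ∃ (s : Finset (ℕ × ℕ)) (C : ℝ), 0 ≤ C ∧
      ∀ i φ, |T i φ| ≤ C * ∑ p ∈ s, SchwartzMap.seminorm ℝ p.1 p.2 φ := by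
  have hq := norm_withSeminorms ℝ ℝ
  have hbs : ∀ (k : Fin 1) (x : 𝓢(E, ℝ)),
      BddAbove (range fun i => (fun _ : Fin 1 => normSeminorm ℝ ℝ) k (T i x)) := by
    intro k x
    obtain ⟨C, hC⟩ := hT x
    exact ⟨C, by rintro _ ⟨i, rfl⟩; exact hC i⟩
  -- Equicontinuity amounts to domination by one continuous seminorm, which in turn is dominated by
  -- a finite supremum of Schwartz seminorms.
  have h1 := (hq.uniformEquicontinuous_iff_exists_continuous_seminorm
    (fun i => (T i).toLinearMap)).1 (hq.banach_steinhaus hbs) 0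
  obtain ⟨p, hp, hpT⟩ := h1
  obtain ⟨s, C, -, hC⟩ := Seminorm.bound_of_continuous (schwartz_withSeminorms ℝ E ℝ) p hp
  refine ⟨s, C, C.2, fun i φ => ((hpT i φ).trans (hC φ)).trans ?_⟩
  simp only [smul_apply, NNReal.smul_def, smul_eq_mul]
  refine mul_le_mul_of_nonneg_left ?_ C.2
  have h2 := Seminorm.finset_sup_le_sum (schwartzSeminormFamily ℝ E ℝ) s
  refine (h2 φ).trans (le_of_eq ?_)
  simp [schwartzSeminormFamily]

end SchwartzMap

/-! ### Profiles of self-similar solutions of the heat equation -/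

namespace FractionalExtension

section HeatProfile

open scoped LineDeriv Laplacian

variable {E : Type*} [NormedAddCommGroup E] [InnerProductSpace ℝ E] [FiniteDimensional ℝ E]

/-- Profiles `h` of the self-similar solutions `t ^ (-α) * h (z / √t)` of the heat equation. -/
def IsHeatProfile (α : ℝ) (h : 𝓢(E, ℝ)) : Prop :=
  ∀ z, (Δ h) z = -α * h z - 1 / 2 * fderiv ℝ h z z

omit [FiniteDimensional ℝ E] in
theorem lineDerivOp_lineDerivOp_apply (h : 𝓢(E, ℝ)) (v w z : E) :
    (∂_{v} (∂_{w} h)) z = fderiv ℝ (fderiv ℝ h) z v w := by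
  rw [SchwartzMap.lineDerivOp_apply_eq_fderiv]
  have h1 : (⇑(∂_{w} h : 𝓢(E, ℝ)) : E → ℝ) = fun x => fderiv ℝ h x w := rfl
  rw [h1, fderiv_clm_apply (((h.smooth 2).fderiv_right (m := 1) (by norm_num)).differentiable
    (by norm_num) z) (by fun_prop)]
  simp

omit [FiniteDimensional ℝ E] in
theorem fderiv_fderiv_comm (h : 𝓢(E, ℝ)) (v w z : E) :
    fderiv ℝ (fderiv ℝ h) z v w = fderiv ℝ (fderiv ℝ h) z w v :=
  ((h.contDiffAt 2).isSymmSndFDerivAt (by simp)) v w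

omit [FiniteDimensional ℝ E] in
theorem lineDerivOp_comm (h : 𝓢(E, ℝ)) (v w : E) : ∂_{v} (∂_{w} h) = ∂_{w} (∂_{v} h) := by
  ext z
  rw [lineDerivOp_lineDerivOp_apply, lineDerivOp_lineDerivOp_apply, fderiv_fderiv_comm]

theorem laplacian_lineDerivOp (h : 𝓢(E, ℝ)) (v : E) : Δ (∂_{v} h) = ∂_{v} (Δ h) := by
  rw [SchwartzMap.laplacian_eq_sum (stdOrthonormalBasis ℝ E),
    SchwartzMap.laplacian_eq_sum (stdOrthonormalBasis ℝ E), LineDeriv.lineDerivOp_sum]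
  refine Finset.sum_congr rfl fun i _ => ?_
  rw [lineDerivOp_comm h _ v, lineDerivOp_comm _ _ v]

/-- Differentiating the Euler term `fderiv ℝ h z z` along `v` leaves an extra `fderiv ℝ h z v`; its
factor `1/2` is the shift of the exponent. -/
theorem IsHeatProfile.lineDerivOp {α : ℝ} {h : 𝓢(E, ℝ)} (hh : IsHeatProfile α h) (v : E) :
    IsHeatProfile (α + 1 / 2) (∂_{v} h) := by
  intro z
  have hd : DifferentiableAt ℝ (fderiv ℝ h) z :=
    ((h.smooth 2).fderiv_right (m := 1) (by norm_num)).differentiable (by norm_num) z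
  have h1 : (⇑(Δ h : 𝓢(E, ℝ)) : E → ℝ) = fun x => -α * h x - 1 / 2 * fderiv ℝ h x x := funext hh
  have h2 : (⇑(∂_{v} h : 𝓢(E, ℝ)) : E → ℝ) = fun x => fderiv ℝ h x v := rfl
  have h3 : HasFDerivAt (fun x => fderiv ℝ h x x) _ z := hd.hasFDerivAt.clm_apply (hasFDerivAt_id z)
  have h4 := (h.hasFDerivAt z).const_mul (-α) |>.fun_sub (h3.const_mul (1 / 2))
  rw [laplacian_lineDerivOp, SchwartzMap.lineDerivOp_apply_eq_fderiv, h1, h4.fderiv,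
    ← SchwartzMap.lineDerivOp_apply_eq_fderiv z, lineDerivOp_lineDerivOp_apply,
    fderiv_fderiv_comm h z v, h2]
  simp
  ring

theorem IsHeatProfile.sum {ι : Type*} {α : ℝ} {h : ι → 𝓢(E, ℝ)} (s : Finset ι)
    (hh : ∀ i, IsHeatProfile α (h i)) : IsHeatProfile α (∑ i ∈ s, h i) := by
  classical
  have hadd : ∀ f g : 𝓢(E, ℝ), IsHeatProfile α f → IsHeatProfile α g →
      IsHeatProfile α (f + g) := by
    intro f g hf hg z
    have h1 : Δ (f + g) = Δ f + Δ g := by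
      rw [← SchwartzMap.laplacianCLM_eq', map_add]; rfl
    have h2 : fderiv ℝ (⇑(f + g)) z = fderiv ℝ f z + fderiv ℝ g z :=
      fderiv_add f.differentiableAt g.differentiableAt
    rw [h1, h2, add_apply, add_apply, hf z, hg z, add_apply]
    ring
  induction s using Finset.induction_on with
  | empty =>
    intro z
    have h1 : Δ (0 : 𝓢(E, ℝ)) = 0 := by
      rw [← SchwartzMap.laplacianCLM_eq', map_zero]
    have h2 : (⇑(0 : 𝓢(E, ℝ)) : E → ℝ) = fun _ => 0 := rfl
    rw [Finset.sum_empty, h1, h2]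
    simp
  | insert i s hi ih => rw [Finset.sum_insert hi]; exact hadd _ _ (hh i) ih

/-- Two directional derivatives add `1/2` each. The larger exponent is the source of the additional
decay in `t` on which the uniqueness proof relies. -/
theorem IsHeatProfile.laplacian {α : ℝ} {h : 𝓢(E, ℝ)} (hh : IsHeatProfile α h) :
    IsHeatProfile (α + 1) (Δ h) := by
  rw [SchwartzMap.laplacian_eq_sum (stdOrthonormalBasis ℝ E)]
  refine IsHeatProfile.sum _ fun i => ?_
  have := (hh.lineDerivOp (stdOrthonormalBasis ℝ E i)).lineDerivOp (stdOrthonormalBasis ℝ E i)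
  rwa [add_assoc, add_halves] at this

/-- The power is at most `m! e^{1+r}`, and `1 + r - r²/4 ≤ 2` because `(r - 2)² ≥ 0`. -/
theorem one_add_pow_mul_exp_neg_sq_le (m : ℕ) {r : ℝ} (hr : 0 ≤ r) :
    (1 + r) ^ m * Real.exp (-(r ^ 2 / 4)) ≤ m.factorial * Real.exp 2 := by
  have h1 := Real.pow_div_factorial_le_exp (1 + r) (by positivity) m
  rw [div_le_iff₀ (by positivity)] at h1
  calc (1 + r) ^ m * Real.exp (-(r ^ 2 / 4))
      ≤ (Real.exp (1 + r) * m.factorial) * Real.exp (-(r ^ 2 / 4)) := by gcongr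
    _ = m.factorial * Real.exp (1 + r - r ^ 2 / 4) := by
        rw [sub_eq_add_neg, Real.exp_add (1 + r)]; ring
    _ ≤ m.factorial * Real.exp 2 := by
        gcongr
        nlinarith [sq_nonneg (r - 2)]

omit [FiniteDimensional ℝ E] in
theorem contDiff_gaussian {k : ℕ∞ω} : ContDiff ℝ k fun z : E => Real.exp (-(‖z‖ ^ 2 / 4)) :=
  Real.contDiff_exp.comp (((contDiff_norm_sq ℝ).div_const 4).neg)

/-- The Gaussian `e^{-|z|²/4}` as a Schwartz function. -/
noncomputable def gaussianProfile : 𝓢(E, ℝ) where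
  toFun z := Real.exp (-(‖z‖ ^ 2 / 4))
  smooth' := contDiff_gaussian
  decay' k m := by
    have hf : Function.HasTemperateGrowth (fun z : E => -(‖z‖ ^ 2 / 4)) := by
      have := (Function.hasTemperateGrowth_norm_sq E).mul
        (Function.HasTemperateGrowth.const (-1 / 4 : ℝ))
      have h1 : (fun z : E => -(‖z‖ ^ 2 / 4)) = fun z => ‖z‖ ^ 2 * (-1 / 4 : ℝ) := by
        ext z; ring
      rw [h1]
      exact this
    obtain ⟨l, C, hC, hb⟩ := hf.norm_iteratedFDeriv_le_uniform m
    refine ⟨m.factorial * (1 + C) ^ m * ((k + l * m).factorial * Real.exp 2), fun x => ?_⟩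
    -- The bound for derivatives of a composition wants the `i`-th derivative of the exponent below
    -- `D ^ i`. One bound serves for all `1 ≤ i ≤ m` once `D ≥ 1`; the resulting polynomial of
    -- degree `k + l * m` is absorbed by the Gaussian.
    have hD : 1 ≤ (1 + C) * (1 + ‖x‖) ^ l :=
      one_le_mul_of_one_le_of_one_le (by linarith) (one_le_pow₀ (by linarith [norm_nonneg x]))
    have h1 := norm_iteratedFDeriv_comp_le (𝕜 := ℝ) (g := Real.exp) (n := m)
      (C := Real.exp (-(‖x‖ ^ 2 / 4))) (D := (1 + C) * (1 + ‖x‖) ^ l)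
      (Real.contDiff_exp (n := ∞)) hf.1 (mod_cast le_top) x (fun i _ => by
        rw [norm_iteratedFDeriv_eq_norm_iteratedDeriv, iteratedDeriv_eq_iterate,
          Real.iter_deriv_exp, Real.norm_eq_abs, Real.abs_exp])
      (fun i hi him => ((hb i him x).trans (by gcongr; linarith)).trans
        (le_self_pow₀ hD (by omega)))
    have h2 := one_add_pow_mul_exp_neg_sq_le (k + l * m) (norm_nonneg x)
    calc ‖x‖ ^ k * ‖iteratedFDeriv ℝ m (fun z : E => Real.exp (-(‖z‖ ^ 2 / 4))) x‖
        ≤ (1 + ‖x‖) ^ k * (m.factorial * Real.exp (-(‖x‖ ^ 2 / 4)) *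
            ((1 + C) * (1 + ‖x‖) ^ l) ^ m) := by
          gcongr
          · linarith
          · exact h1
      _ = m.factorial * (1 + C) ^ m * ((1 + ‖x‖) ^ (k + l * m) *
            Real.exp (-(‖x‖ ^ 2 / 4))) := by
          rw [mul_pow, ← pow_mul, pow_add]; ring
      _ ≤ _ := by gcongr

omit [FiniteDimensional ℝ E] in
theorem gaussianProfile_apply (z : E) : gaussianProfile z = Real.exp (-(‖z‖ ^ 2 / 4)) := rfl

omit [FiniteDimensional ℝ E] in
theorem hasFDerivAt_gaussianProfile (z : E) :
    HasFDerivAt (gaussianProfile : 𝓢(E, ℝ)) ((-(1 / 2) * gaussianProfile z) • innerSL ℝ z) z := by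
  have h1 : HasFDerivAt (fun x : E => Real.exp (-(1 / 4 * ‖x‖ ^ 2))) _ z :=
    ((hasStrictFDerivAt_norm_sq z).hasFDerivAt.const_mul (1 / 4)).fun_neg.exp
  have h2 : (⇑(gaussianProfile : 𝓢(E, ℝ)) : E → ℝ) =
      fun x => Real.exp (-(1 / 4 * ‖x‖ ^ 2)) := by
    ext x; rw [gaussianProfile_apply]; congr 2; ring
  have h3 : gaussianProfile z = Real.exp (-(1 / 4 * ‖z‖ ^ 2)) := congrFun h2 z
  rw [h3, h2]
  refine h1.congr_fderiv ?_
  ext v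
  simp
  ring

/-- With `d` the dimension, the Laplacian of the Gaussian `G` is `(|z|²/4 - d/2) G`, while `∇G · z =
-(|z|²/2) G`; this forces the heat kernel exponent `d/2`. -/
theorem isHeatProfile_gaussianProfile :
    IsHeatProfile ((Module.finrank ℝ E : ℝ) / 2) (gaussianProfile : 𝓢(E, ℝ)) := by
  intro z
  have h1 : ∀ v : E, (⇑(∂_{v} (gaussianProfile : 𝓢(E, ℝ)) : 𝓢(E, ℝ)) : E → ℝ) =
      fun x => (-(1 / 2) * gaussianProfile x) * ⟪x, v⟫_ℝ := by
    intro v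
    ext x
    rw [SchwartzMap.lineDerivOp_apply_eq_fderiv, (hasFDerivAt_gaussianProfile x).fderiv]
    simp
  have h2 : ∀ v : E, (∂_{v} (∂_{v} (gaussianProfile : 𝓢(E, ℝ)))) z =
      gaussianProfile z * (1 / 4 * ⟪z, v⟫_ℝ ^ 2 - 1 / 2 * ‖v‖ ^ 2) := by
    intro v
    rw [SchwartzMap.lineDerivOp_apply_eq_fderiv, h1]
    have h3 := ((hasFDerivAt_gaussianProfile z).const_mul (-(1 / 2))).mul
      ((hasFDerivAt_id z).inner ℝ (hasFDerivAt_const v z))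
    rw [show (fun x : E => -(1 / 2) * gaussianProfile x * ⟪x, v⟫_ℝ) =
      (fun x : E => -(1 / 2) * gaussianProfile x) * (fun x : E => ⟪id x, v⟫_ℝ) from rfl, h3.fderiv]
    simp
    ring
  rw [SchwartzMap.laplacian_eq_sum (stdOrthonormalBasis ℝ E), sum_apply,
    (hasFDerivAt_gaussianProfile z).fderiv]
  simp only [h2, OrthonormalBasis.norm_eq_one]
  rw [← Finset.mul_sum, Finset.sum_sub_distrib, ← Finset.mul_sum]
  have h4 := (stdOrthonormalBasis ℝ E).sum_sq_inner_left z
  rw [h4]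
  simp
  ring

end HeatProfile

end FractionalExtension

/-! ### Pairing a solution with compactly supported functions of `x` -/

namespace FractionalExtension

section CompactPairing

variable {E : Type*} [NormedAddCommGroup E] [InnerProductSpace ℝ E] [FiniteDimensional ℝ E]

theorem laplacian_eq_sum_fderiv {ι : Type*} [Fintype ι] (b : OrthonormalBasis ι ℝ E) {f : E → ℝ}
    {x : E} (hf : ContDiffAt ℝ 2 f x) :
    Laplacian.laplacian f x = ∑ i, fderiv ℝ (fun z => fderiv ℝ f z (b i)) x (b i) := by
  rw [InnerProductSpace.laplacian_eq_iteratedFDeriv_orthonormalBasis f b]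
  refine Finset.sum_congr rfl fun i _ => ?_
  have h1 : DifferentiableAt ℝ (fderiv ℝ f) x :=
    (hf.fderiv_right (m := 1) (by norm_num)).differentiableAt (by norm_num)
  rw [iteratedFDeriv_two_apply, fderiv_clm_apply h1 (by fun_prop)]
  simp

variable [MeasurableSpace E] [BorelSpace E]

omit [InnerProductSpace ℝ E] [FiniteDimensional ℝ E] in
theorem integrable_mul_of_hasCompactSupport {μ : Measure E} [IsFiniteMeasureOnCompacts μ]
    {f g : E → ℝ} (hf : Continuous f) (hg : Continuous g) (hc : HasCompactSupport g) :
    Integrable (fun z => g z * f z) μ :=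
  (hg.mul hf).integrable_of_hasCompactSupport hc.mul_right

/-- Two integrations by parts. Compact support of `g` supplies all the integrability, so no growth
condition on `f` enters. -/
theorem integral_fderiv_fderiv_mul_eq {f g : E → ℝ} (hf : ContDiff ℝ 2 f) (hg : ContDiff ℝ 2 g)
    (hc : HasCompactSupport g) (v : E) :
    ∫ z, fderiv ℝ (fun x => fderiv ℝ g x v) z v * f z =
      ∫ z, g z * fderiv ℝ (fun x => fderiv ℝ f x v) z v := by
  have hg1 : ContDiff ℝ 1 (fun x => fderiv ℝ g x v) :=
    (hg.fderiv_right (m := 1) (by norm_num)).clm_apply contDiff_const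
  have hf1 : ContDiff ℝ 1 (fun x => fderiv ℝ f x v) :=
    (hf.fderiv_right (m := 1) (by norm_num)).clm_apply contDiff_const
  have hc1 : HasCompactSupport (fun x => fderiv ℝ g x v) := hc.fderiv_apply ℝ v
  have hc2 : HasCompactSupport (fun x => fderiv ℝ (fun x => fderiv ℝ g x v) x v) :=
    hc1.fderiv_apply ℝ v
  have hg2 : Continuous (fun x => fderiv ℝ (fun x => fderiv ℝ g x v) x v) :=
    ((hg1.fderiv_right (m := 0) (by norm_num)).clm_apply contDiff_const).continuous
  have hf2 : Continuous (fun x => fderiv ℝ (fun x => fderiv ℝ f x v) x v) :=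
    ((hf1.fderiv_right (m := 0) (by norm_num)).clm_apply contDiff_const).continuous
  rw [integral_mul_fderiv_eq_neg_fderiv_mul_of_integrable
      (integrable_mul_of_hasCompactSupport hf1.continuous hg1.continuous hc1)
      (integrable_mul_of_hasCompactSupport hf2 hg.continuous hc)
      (integrable_mul_of_hasCompactSupport hf1.continuous hg.continuous hc)
      (fun x _ => hg.differentiable (by norm_num) x) (fun x _ => hf1.differentiable (by norm_num) x),
    integral_mul_fderiv_eq_neg_fderiv_mul_of_integrable
      (integrable_mul_of_hasCompactSupport hf.continuous hg2 hc2)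
      (integrable_mul_of_hasCompactSupport hf1.continuous hg1.continuous hc1)
      (integrable_mul_of_hasCompactSupport hf.continuous hg1.continuous hc1)
      (fun x _ => hg1.differentiable (by norm_num) x) (fun x _ => hf.differentiable (by norm_num) x),
    neg_neg]

omit [InnerProductSpace ℝ E] [FiniteDimensional ℝ E] in
/-- Differentiation under the integral sign against a compactly supported weight. -/
theorem hasDerivAt_integral_mul_of_hasCompactSupport [NormedSpace ℝ E] {μ : Measure E}
    [IsFiniteMeasureOnCompacts μ] {g : E → ℝ}
    (hg : Continuous g) (hc : HasCompactSupport g) {f f' : E → ℝ → ℝ}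
    (hf : ∀ y ∈ Ioi (0 : ℝ), Continuous fun z => f z y)
    (hff' : ∀ z, ∀ y ∈ Ioi (0 : ℝ), HasDerivAt (f z) (f' z y) y)
    (hf' : ContinuousOn (Function.uncurry f') (univ ×ˢ Ioi 0)) {y : ℝ} (hy : 0 < y) :
    HasDerivAt (fun y => ∫ z, g z * f z y ∂μ) (∫ z, g z * f' z y ∂μ) y := by
  have hslice : ∀ y ∈ Ioi (0 : ℝ), Continuous fun z => f' z y := fun y hy =>
    hf'.comp_continuous (f := fun z => (z, y)) (by fun_prop) fun z => ⟨mem_univ _, hy⟩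
  -- A bound of `f'` on this compact set, times `‖g‖`, is the dominating function.
  have hKc : IsCompact (tsupport g ×ˢ Icc (y / 2) (2 * y)) := hc.isCompact.prod isCompact_Icc
  obtain ⟨C, hC⟩ := hKc.exists_bound_of_continuousOn (hf'.mono fun p hp =>
    ⟨mem_univ _, lt_of_lt_of_le (by positivity) hp.2.1⟩)
  refine (hasDerivAt_integral_of_dominated_loc_of_deriv_le (μ := μ)
    (s := Icc (y / 2) (2 * y)) (F' := fun y z => g z * f' z y) (bound := fun z => C * ‖g z‖)
    (Icc_mem_nhds (by linarith) (by linarith)) ?_ ?_ ?_ ?_ ?_ ?_).2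
  · filter_upwards [lt_mem_nhds hy] with x hx
    exact (hg.mul (hf x hx)).integrable_of_hasCompactSupport hc.mul_right |>.aestronglyMeasurable
  · exact (hg.mul (hf y hy)).integrable_of_hasCompactSupport hc.mul_right
  · exact (hg.mul (hslice y hy)).integrable_of_hasCompactSupport hc.mul_right |>.aestronglyMeasurable
  · refine Eventually.of_forall fun z x hx => ?_
    rw [norm_mul, mul_comm]
    by_cases hz : z ∈ tsupport g
    · exact mul_le_mul_of_nonneg_right (hC (z, x) ⟨hz, hx⟩) (norm_nonneg _)
    · simp [image_eq_zero_of_notMem_tsupport hz]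
  · exact (hg.norm.integrable_of_hasCompactSupport hc.norm).const_mul C
  · refine Eventually.of_forall fun z x hx => ?_
    exact (hff' z x (lt_of_lt_of_le (by positivity : 0 < y / 2) hx.1)).const_mul (g z)

end CompactPairing

section Slices

variable {n : ℕ}

/-- Taking the total derivative in the direction `(0, 1)` gives `y`-derivatives that are visibly
continuous in both variables jointly, as differentiation under the integral requires. -/
theorem IsExtensionSolution.exists_partial_derivs {s : ℝ} {u : EuclideanSpace ℝ (Fin n) → ℝ}
    {W : EuclideanSpace ℝ (Fin n) → ℝ → ℝ} (hW : IsExtensionSolution s u W) :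
    ∃ W1 W2 : EuclideanSpace ℝ (Fin n) → ℝ → ℝ,
      (∀ z, ∀ y ∈ Ioi (0 : ℝ), HasDerivAt (W z) (W1 z y) y) ∧
      (∀ z, ∀ y ∈ Ioi (0 : ℝ), HasDerivAt (W1 z) (W2 z y) y) ∧
      ContinuousOn (Function.uncurry W1) (univ ×ˢ Ioi 0) ∧
      ContinuousOn (Function.uncurry W2) (univ ×ˢ Ioi 0) ∧
      (∀ y ∈ Ioi (0 : ℝ), ContDiff ℝ 2 fun z => W z y) ∧
      ∀ z, ∀ y ∈ Ioi (0 : ℝ),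
        W2 z y + (1 - 2 * s) / y * W1 z y = -Laplacian.laplacian (fun x => W x y) z := by
  have hopen : IsOpen (univ ×ˢ Ioi (0 : ℝ) : Set (EuclideanSpace ℝ (Fin n) × ℝ)) :=
    isOpen_univ.prod isOpen_Ioi
  have key : ∀ (k : ℕ∞) (f : EuclideanSpace ℝ (Fin n) × ℝ → ℝ),
      ContDiffOn ℝ (k + 1) f (univ ×ˢ Ioi 0) →
      ContDiffOn ℝ k (fun p => fderiv ℝ f p (0, 1)) (univ ×ˢ Ioi 0) ∧
      ∀ z, ∀ y ∈ Ioi (0 : ℝ), HasDerivAt (fun y => f (z, y)) (fderiv ℝ f (z, y) (0, 1)) y := by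
    intro k f hf
    refine ⟨(hf.fderiv_of_isOpen hopen le_rfl).clm_apply contDiffOn_const, fun z y hy => ?_⟩
    have h1 : HasFDerivAt f (fderiv ℝ f (z, y)) (z, y) :=
      ((hf.contDiffAt (hopen.mem_nhds ⟨mem_univ _, hy⟩)).differentiableAt
        (by simp)).hasFDerivAt
    exact h1.comp_hasDerivAt y ((hasDerivAt_const y z).prodMk (hasDerivAt_id y))
  obtain ⟨h1, h1'⟩ := key 1 _ (by simpa [one_add_one_eq_two] using hW.contDiffOn)
  obtain ⟨h2, h2'⟩ := key 0 _ (by simpa using h1)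
  refine ⟨fun z y => fderiv ℝ (Function.uncurry W) (z, y) (0, 1), _, h1', h2', h1.continuousOn,
    h2.continuousOn, fun y hy => ?_, fun z y hy => ?_⟩
  · exact hW.contDiffOn.comp_contDiff (f := fun z => (z, y)) (by fun_prop)
      fun z => ⟨mem_univ _, hy⟩
  · have h3 := hW.equation z y hy
    have h4 : deriv (W z) =ᶠ[𝓝 y] fun y => fderiv ℝ (Function.uncurry W) (z, y) (0, 1) := by
      filter_upwards [lt_mem_nhds hy] with x hx
      exact (h1' z x hx).deriv
    rw [h4.deriv_eq, (h2' z y hy).deriv, h4.eq_of_nhds] at h3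
    linarith

/-- Pairing a solution with a compactly supported function of `x` gives a solution of the Bessel
equation with a right-hand side. -/
theorem IsExtensionSolution.exists_pairing_derivs {s : ℝ} {u : EuclideanSpace ℝ (Fin n) → ℝ}
    {W : EuclideanSpace ℝ (Fin n) → ℝ → ℝ} (hW : IsExtensionSolution s u W)
    {g : EuclideanSpace ℝ (Fin n) → ℝ} (hg : ContDiff ℝ 2 g) (hc : HasCompactSupport g) :
    ∃ P1 P2 : ℝ → ℝ, ∀ y, 0 < y →
      HasDerivAt (fun y => ∫ z, g z * W z y) (P1 y) y ∧ HasDerivAt P1 (P2 y) y ∧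
      P2 y + (1 - 2 * s) / y * P1 y =
        -∫ z, (∑ i, fderiv ℝ (fun x => fderiv ℝ g x (EuclideanSpace.basisFun (Fin n) ℝ i)) z
          (EuclideanSpace.basisFun (Fin n) ℝ i)) * W z y := by
  obtain ⟨W1, W2, h1, h2, c1, c2, hsm, heq⟩ := hW.exists_partial_derivs
  have hslice : ∀ f : EuclideanSpace ℝ (Fin n) → ℝ → ℝ,
      ContinuousOn (Function.uncurry f) (univ ×ˢ Ioi 0) →
      ∀ y ∈ Ioi (0 : ℝ), Continuous fun z => f z y := fun f hf y hy =>
    hf.comp_continuous (f := fun z => (z, y)) (by fun_prop) fun z => ⟨mem_univ _, hy⟩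
  refine ⟨fun y => ∫ z, g z * W1 z y, fun y => ∫ z, g z * W2 z y, fun y hy => ⟨?_, ?_, ?_⟩⟩
  · exact hasDerivAt_integral_mul_of_hasCompactSupport hg.continuous hc
      (fun y hy => (hsm y hy).continuous) h1 c1 hy
  · exact hasDerivAt_integral_mul_of_hasCompactSupport hg.continuous hc (hslice W1 c1) h2 c2 hy
  · rw [← integral_const_mul, ← integral_add
      (integrable_mul_of_hasCompactSupport (hslice W2 c2 y hy) hg.continuous hc)
      ((integrable_mul_of_hasCompactSupport (hslice W1 c1 y hy) hg.continuous hc).const_mul _)]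
    -- Here the Laplacian moves from the slice of `W` to `g`, one coordinate direction at a time.
    have hb := fun i => integral_fderiv_fderiv_mul_eq (hsm y hy) hg hc
      (EuclideanSpace.basisFun (Fin n) ℝ i)
    have hg1 : ∀ v, ContDiff ℝ 1 (fun x => fderiv ℝ g x v) := fun v =>
      (hg.fderiv_right (m := 1) (by norm_num)).clm_apply contDiff_const
    have hf1 : ∀ v, ContDiff ℝ 1 (fun x => fderiv ℝ (fun z => W z y) x v) := fun v =>
      ((hsm y hy).fderiv_right (m := 1) (by norm_num)).clm_apply contDiff_const
    have hI1 : ∀ v, Integrable fun z => fderiv ℝ (fun x => fderiv ℝ g x v) z v * W z y := fun v =>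
      integrable_mul_of_hasCompactSupport (hsm y hy).continuous
        (((hg1 v).fderiv_right (m := 0) (by norm_num)).clm_apply contDiff_const).continuous
        ((hc.fderiv_apply ℝ v).fderiv_apply ℝ v)
    have hI2 : ∀ v, Integrable fun z =>
        g z * fderiv ℝ (fun x => fderiv ℝ (fun z => W z y) x v) z v := fun v =>
      integrable_mul_of_hasCompactSupport
        (((hf1 v).fderiv_right (m := 0) (by norm_num)).clm_apply contDiff_const).continuous
        hg.continuous hc
    simp only [Finset.sum_mul]
    rw [integral_finsetSum _ fun i _ => hI1 _, Finset.sum_congr rfl fun i _ => hb i,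
      ← integral_finsetSum _ fun i _ => hI2 _, ← integral_neg]
    refine integral_congr_ae (Eventually.of_forall fun z => ?_)
    dsimp only
    rw [← Finset.mul_sum, ← laplacian_eq_sum_fderiv _ (hsm y hy).contDiffAt, ← mul_neg,
      ← heq z y hy]
    ring

end Slices

end FractionalExtension

/-! ### Parabolic rescaling: heat equation, decay and seminorms -/

namespace FractionalExtension

section HeatScale

open scoped LineDeriv Laplacian

variable {E : Type*} [NormedAddCommGroup E] [InnerProductSpace ℝ E]

/-- The parabolic rescaling `t ^ (-α) * h (z / √t)` of a Schwartz function. -/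
noncomputable def heatScale (α : ℝ) (h : 𝓢(E, ℝ)) (t : ℝ) (z : E) : ℝ :=
  t ^ (-α) * h ((√t)⁻¹ • z)

theorem contDiff_heatScale (α : ℝ) (h : 𝓢(E, ℝ)) (t : ℝ) {k : ℕ∞} :
    ContDiff ℝ k (heatScale α h t) :=
  contDiff_const.mul ((h.smooth k).comp (contDiff_const_smul _))

theorem fderiv_heatScale (α : ℝ) (h : 𝓢(E, ℝ)) {t : ℝ} (ht : 0 < t) (z v : E) :
    fderiv ℝ (heatScale α h t) z v = heatScale (α + 1 / 2) (∂_{v} h) t z := by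
  have h1 : HasFDerivAt (fun z : E => (√t)⁻¹ • z) ((√t)⁻¹ • ContinuousLinearMap.id ℝ E) z :=
    (hasFDerivAt_id z).const_smul _
  have h2 : HasFDerivAt (heatScale α h t) _ z :=
    ((h.hasFDerivAt ((√t)⁻¹ • z)).comp z h1).const_mul (t ^ (-α))
  rw [h2.fderiv, heatScale, SchwartzMap.lineDerivOp_apply_eq_fderiv, neg_add, Real.rpow_add ht,
    Real.rpow_neg ht.le (1 / 2), ← Real.sqrt_eq_rpow]
  simp
  ring

/-- With `w = z/√t`, the derivative is `t^{-α-1}` times `-α h(w) - ∇h(w) · w / 2`, which the profile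
equation turns into `Δ h (w)`. Since two spatial derivatives also cost `t^{-1}`, this is the heat
equation. -/
theorem hasDerivAt_heatScale [FiniteDimensional ℝ E] {α : ℝ} {h : 𝓢(E, ℝ)}
    (hh : IsHeatProfile α h) {t : ℝ} (ht : 0 < t) (z : E) :
    HasDerivAt (fun t => heatScale α h t z) (heatScale (α + 1) (Δ h) t z) t := by
  have hs : √t ≠ 0 := (Real.sqrt_pos.2 ht).ne'
  have h1 : HasDerivAt (fun t : ℝ => (√t)⁻¹ • z) ((-(1 / (2 * √t)) / √t ^ 2) • z) t :=
    ((Real.hasDerivAt_sqrt ht.ne').fun_inv hs).smul_const z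
  have h2 := (Real.hasDerivAt_rpow_const (p := -α) (Or.inl ht.ne')).fun_mul
    ((h.hasFDerivAt ((√t)⁻¹ • z)).comp_hasDerivAt t h1)
  refine h2.congr_deriv ?_
  have h3 : (-(1 / (2 * √t)) / √t ^ 2) • z = (-(1 / 2) * t⁻¹) • ((√t)⁻¹ • z) := by
    rw [smul_smul, Real.sq_sqrt ht.le]
    congr 1
    field_simp
  rw [h3, map_smul, heatScale, hh, neg_add, Real.rpow_add ht, Real.rpow_sub ht, Real.rpow_neg_one,
    Real.rpow_one, smul_eq_mul, Function.comp_apply]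
  ring

/-- For `t` in a compact subinterval of `(0, ∞)` the power of `t` is bounded, and `1 + |z| ≤ (1 +
√T)(1 + |z/√t|)` transfers the decay of `h`. The uniformity in `t` is used for domination. -/
theorem exists_heatScale_decay (α : ℝ) (h : 𝓢(E, ℝ)) (N : ℕ) {t₀ : ℝ} (ht₀ : 0 < t₀) (T : ℝ) :
    ∃ C, 0 ≤ C ∧ ∀ t ∈ Icc t₀ T, ∀ z, |heatScale α h t z| * (1 + ‖z‖) ^ N ≤ C := by
  obtain ⟨C₁, hC₁⟩ : ∃ C₁, ∀ w, (1 + ‖w‖) ^ N * ‖h w‖ ≤ C₁ := ⟨_, fun w => by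
    simpa using SchwartzMap.one_add_le_sup_seminorm_apply (𝕜 := ℝ) (m := (N, 0)) le_rfl le_rfl h w⟩
  have hcont : ContinuousOn (fun t : ℝ => t ^ (-α)) (Icc t₀ T) :=
    ContinuousOn.rpow_const continuousOn_id fun t ht => Or.inl (ht₀.trans_le ht.1).ne'
  obtain ⟨C₂, hC₂⟩ := isCompact_Icc.exists_bound_of_continuousOn hcont
  have h0 : 0 ≤ C₁ := le_trans (by positivity) (hC₁ 0)
  refine ⟨|C₂| * ((1 + √T) ^ N * C₁), by positivity, fun t ht z => ?_⟩
  have ht' : 0 < t := ht₀.trans_le ht.1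
  have hs : 0 < √t := Real.sqrt_pos.2 ht'
  have hz : 1 + ‖z‖ ≤ (1 + √T) * (1 + ‖(√t)⁻¹ • z‖) := by
    have h1 : ‖z‖ = √t * ‖(√t)⁻¹ • z‖ := by
      rw [norm_smul, Real.norm_of_nonneg (by positivity)]
      field_simp
    have h2 : √t ≤ √T := Real.sqrt_le_sqrt ht.2
    rw [h1]
    nlinarith [norm_nonneg ((√t)⁻¹ • z), mul_le_mul_of_nonneg_right h2
      (norm_nonneg ((√t)⁻¹ • z)), Real.sqrt_nonneg T]
  rw [heatScale, abs_mul, mul_assoc]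
  refine mul_le_mul ((hC₂ t ht).trans (le_abs_self _)) ?_ (by positivity) (abs_nonneg _)
  calc |h ((√t)⁻¹ • z)| * (1 + ‖z‖) ^ N
      ≤ |h ((√t)⁻¹ • z)| * ((1 + √T) * (1 + ‖(√t)⁻¹ • z‖)) ^ N := by gcongr
    _ = (1 + √T) ^ N * ((1 + ‖(√t)⁻¹ • z‖) ^ N * ‖h ((√t)⁻¹ • z)‖) := by
        rw [mul_pow, Real.norm_eq_abs]; ring
    _ ≤ (1 + √T) ^ N * C₁ := by gcongr; exact hC₁ _

/-- Each factor `‖z‖` contributes `√t` and each derivative `1/√t`. Thus a large `α` makes any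
finitely many seminorms bounded as `t → ∞`. -/
theorem exists_schwartz_eq_heatScale (α : ℝ) (h : 𝓢(E, ℝ)) {t : ℝ} (ht : 0 < t) :
    ∃ φ : 𝓢(E, ℝ), (∀ z, φ z = heatScale α h t z) ∧ ∀ a b : ℕ,
      SchwartzMap.seminorm ℝ a b φ ≤
        t ^ (-α + (a - b) / 2) * SchwartzMap.seminorm ℝ a b h := by
  have hs : 0 < √t := Real.sqrt_pos.2 ht
  let e : E ≃L[ℝ] E := ContinuousLinearEquiv.smulLeft (Units.mk0 (√t)⁻¹ (inv_ne_zero hs.ne'))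
  let φ : 𝓢(E, ℝ) := t ^ (-α) • SchwartzMap.compCLMOfContinuousLinearEquiv ℝ e h
  have hφ : ∀ z, φ z = heatScale α h t z := fun z => rfl
  refine ⟨φ, hφ, fun a b => ?_⟩
  refine SchwartzMap.seminorm_le_bound ℝ a b φ (by positivity) fun z => ?_
  have hc : ContDiff ℝ b fun z => h ((√t)⁻¹ • z) :=
    (h.smooth b).comp (contDiff_const_smul _)
  have h1 : iteratedFDeriv ℝ b φ z =
      t ^ (-α) • (√t)⁻¹ ^ b • iteratedFDeriv ℝ b h ((√t)⁻¹ • z) := by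
    rw [show (φ : E → ℝ) = fun z => t ^ (-α) • h ((√t)⁻¹ • z) from rfl,
      iteratedFDeriv_const_smul_apply' hc.contDiffAt,
      congrFun (iteratedFDeriv_comp_const_smul (𝕜 := ℝ) (√t)⁻¹ (h.smooth b)) z]
  have h2 : ‖z‖ = √t * ‖(√t)⁻¹ • z‖ := by
    rw [norm_smul, Real.norm_of_nonneg (by positivity)]
    field_simp
  have h3 : t ^ (-α + ((a : ℝ) - b) / 2) = t ^ (-α) * (√t ^ a * (√t)⁻¹ ^ b) := by
    rw [Real.rpow_add ht, sub_div, Real.rpow_sub ht, inv_pow, ← Real.rpow_natCast (√t) a,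
      ← Real.rpow_natCast (√t) b, Real.sqrt_eq_rpow, ← Real.rpow_mul ht.le, ← Real.rpow_mul ht.le]
    ring_nf
  rw [h1, norm_smul, norm_smul, h3, Real.norm_of_nonneg (by positivity),
    Real.norm_of_nonneg (by positivity), h2, mul_pow]
  calc √t ^ a * ‖(√t)⁻¹ • z‖ ^ a *
        (t ^ (-α) * ((√t)⁻¹ ^ b * ‖iteratedFDeriv ℝ b h ((√t)⁻¹ • z)‖))
      = t ^ (-α) * (√t ^ a * (√t)⁻¹ ^ b) *
        (‖(√t)⁻¹ • z‖ ^ a * ‖iteratedFDeriv ℝ b h ((√t)⁻¹ • z)‖) := by ring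
    _ ≤ _ := by gcongr; exact SchwartzMap.le_seminorm ℝ a b h _

end HeatScale

end FractionalExtension

namespace FractionalExtension

/-! ### A maximum principle for the backward Bessel heat equation -/

section MaximumPrinciple

/-- If `p₂` were positive, the second derivative test would make `y` a local minimum as well; `p`
would be locally constant and `p₂` zero. -/
theorem IsLocalMax.second_deriv_nonpos {p p₁ : ℝ → ℝ} {p₂ y : ℝ} (hmax : IsLocalMax p y)
    (h1 : ∀ᶠ x in 𝓝 y, HasDerivAt p (p₁ x) x) (h2 : HasDerivAt p₁ p₂ y) :
    p₁ y = 0 ∧ p₂ ≤ 0 := by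
  have hd : deriv p =ᶠ[𝓝 y] p₁ := h1.mono fun x hx => hx.deriv
  have h0 : deriv p y = 0 := hmax.deriv_eq_zero
  have hdd : deriv (deriv p) y = p₂ := by rw [hd.deriv_eq, h2.deriv]
  refine ⟨hd.eq_of_nhds ▸ h0, not_lt.1 fun hpos => ?_⟩
  have hmin := isLocalMin_of_deriv_deriv_pos (hdd ▸ hpos) h0 h1.self_of_nhds.continuousAt
  have hconst : p =ᶠ[𝓝 y] fun _ => p y := by
    filter_upwards [hmax, hmin] with x hx hx' using le_antisymm hx hx'
  have h3 : deriv p =ᶠ[𝓝 y] fun _ => 0 := by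
    filter_upwards [hconst.eventuallyEq_nhds] with x hx
    rw [hx.deriv_eq, deriv_const]
  rw [h3.deriv_eq, deriv_const] at hdd
  exact hpos.ne hdd

/-- Weak maximum principle for strict subsolutions of the backward equation
`v_t + v_yy + (a / y) v_y = 0` on a rectangle. -/
theorem backward_maximum_principle {a t₀ T Y : ℝ} {v : ℝ → ℝ → ℝ}
    (hcont : ContinuousOn (Function.uncurry v) (Icc t₀ T ×ˢ Icc 0 Y))
    (hT : ∀ y ∈ Icc 0 Y, v T y ≤ 0) (h0 : ∀ t ∈ Icc t₀ T, v t 0 ≤ 0)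
    (hYb : ∀ t ∈ Icc t₀ T, v t Y ≤ 0)
    (hint : ∀ t ∈ Ico t₀ T, ∀ y ∈ Ioo 0 Y, ∃ (d : ℝ) (p₁ : ℝ → ℝ) (p₂ : ℝ),
      HasDerivAt (fun t => v t y) d t ∧ (∀ᶠ x in 𝓝 y, HasDerivAt (v t) (p₁ x) x) ∧
      HasDerivAt p₁ p₂ y ∧ 0 < d + p₂ + a / y * p₁ y) :
    ∀ t ∈ Icc t₀ T, ∀ y ∈ Icc 0 Y, v t y ≤ 0 := by
  intro t ht y hy
  obtain ⟨⟨t', y'⟩, ⟨ht', hy'⟩, hmax⟩ :=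
    (isCompact_Icc.prod isCompact_Icc).exists_isMaxOn ⟨(t, y), ht, hy⟩ hcont
  have hmax' : ∀ t ∈ Icc t₀ T, ∀ y ∈ Icc 0 Y, v t y ≤ v t' y' := fun t ht y hy =>
    hmax (a := (t, y)) ⟨ht, hy⟩
  refine (hmax' t ht y hy).trans (not_lt.1 fun hpos => ?_)
  have htT : t' < T := lt_of_le_of_ne ht'.2 fun h => hpos.not_ge (h ▸ hT y' hy')
  have hy0 : 0 < y' := lt_of_le_of_ne hy'.1 fun h => hpos.not_ge (h.symm ▸ h0 t' ht')
  have hyY : y' < Y := lt_of_le_of_ne hy'.2 fun h => hpos.not_ge (h ▸ hYb t' ht')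
  obtain ⟨d, p₁, p₂, hd, hp1, hp2, hlt⟩ := hint t' ⟨ht'.1, htT⟩ y' ⟨hy0, hyY⟩
  have hloc : IsLocalMax (v t') y' := by
    filter_upwards [Ioo_mem_nhds hy0 hyY] with x hx
    exact hmax' t' ht' x ⟨hx.1.le, hx.2.le⟩
  obtain ⟨hz, hle⟩ := IsLocalMax.second_deriv_nonpos hloc hp1 hp2
  -- Only difference quotients to the right of `t'` are compared, so `t' = t₀` is allowed; `t' < T`
  -- leaves the room for them.
  have hdle : d ≤ 0 := by
    refine le_of_tendsto ((hasDerivAt_iff_tendsto_slope.1 hd).mono_left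
      (nhdsGT_le_nhdsNE t')) ?_
    filter_upwards [Ioo_mem_nhdsGT htT] with x hx
    rw [slope_def_field]
    exact div_nonpos_of_nonpos_of_nonneg
      (sub_nonpos.2 (hmax' x ⟨ht'.1.trans hx.1.le, hx.2.le⟩ y' hy')) (sub_nonneg.2 hx.1.le)
  rw [hz, mul_zero, add_zero] at hlt
  linarith

end MaximumPrinciple

/-! ### Weighted integrals and wide cutoffs -/

section Cutoff

open scoped LineDeriv Laplacian

variable {n : ℕ}

theorem continuousOn_heatScale {E : Type*} [NormedAddCommGroup E] [InnerProductSpace ℝ E]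
    (α : ℝ) (h : 𝓢(E, ℝ)) :
    ContinuousOn (fun p : ℝ × E => heatScale α h p.1 p.2) (Ioi 0 ×ˢ univ) := by
  refine ContinuousOn.mul (ContinuousOn.rpow_const (by fun_prop) fun p hp => Or.inl hp.1.ne') ?_
  refine h.continuous.comp_continuousOn (ContinuousOn.smul (ContinuousOn.inv₀ (by fun_prop) ?_)
    (by fun_prop))
  exact fun p hp => (Real.sqrt_pos.2 hp.1).ne'

theorem abs_integral_mul_le_of_weighted {E : Type*} [NormedAddCommGroup E] [MeasurableSpace E]
    {μ : Measure E} {f w : E → ℝ} {N : ℕ} {c C : ℝ}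
    (hw : Integrable (fun x => |w x| / (1 + ‖x‖) ^ N) μ)
    (hC : ∫ x, |w x| / (1 + ‖x‖) ^ N ∂μ ≤ C) (hc : 0 ≤ c)
    (hf : ∀ z, |f z| * (1 + ‖z‖) ^ N ≤ c) : |∫ z, f z * w z ∂μ| ≤ c * C := by
  rw [← Real.norm_eq_abs]
  refine (norm_integral_le_of_norm_le (hw.const_mul c) (Eventually.of_forall fun z => ?_)).trans ?_
  · have h0 : 0 < (1 + ‖z‖) ^ N := by positivity
    rw [norm_mul, Real.norm_eq_abs, Real.norm_eq_abs, mul_div_assoc', le_div_iff₀ h0,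
      mul_right_comm]
    exact mul_le_mul_of_nonneg_right (hf z) (abs_nonneg _)
  · rw [integral_const_mul]
    exact mul_le_mul_of_nonneg_left hC hc

theorem integrable_mul_of_weighted {E : Type*} [NormedAddCommGroup E] [MeasurableSpace E]
    [BorelSpace E] [SecondCountableTopology E]
    {μ : Measure E} {f w : E → ℝ} {N : ℕ} {c : ℝ}
    (hw : Integrable (fun x => |w x| / (1 + ‖x‖) ^ N) μ) (hwc : Continuous w)
    (hfc : Continuous f) (hf : ∀ z, |f z| * (1 + ‖z‖) ^ N ≤ c) :
    Integrable (fun z => f z * w z) μ := by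
  refine Integrable.mono' (hw.const_mul c) (hfc.mul hwc).aestronglyMeasurable
    (Eventually.of_forall fun z => ?_)
  have h0 : 0 < (1 + ‖z‖) ^ N := by positivity
  rw [norm_mul, Real.norm_eq_abs, Real.norm_eq_abs, mul_div_assoc', le_div_iff₀ h0,
    mul_right_comm]
  exact mul_le_mul_of_nonneg_right (hf z) (abs_nonneg _)

/-- A Schwartz function equal to `1` on the unit ball and supported in the ball of radius `2`. -/
noncomputable def cutoff {E : Type*} [NormedAddCommGroup E] [InnerProductSpace ℝ E]
    [FiniteDimensional ℝ E] : 𝓢(E, ℝ) :=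
  (⟨1, 2, one_pos, one_lt_two⟩ : ContDiffBump (0 : E)).hasCompactSupport.toSchwartzMap
    (ContDiffBump.contDiff _)

variable {E : Type*} [NormedAddCommGroup E] [InnerProductSpace ℝ E] [FiniteDimensional ℝ E]

theorem hasCompactSupport_heatScale_cutoff {τ : ℝ} (hτ : 0 < τ) :
    HasCompactSupport (heatScale 0 (cutoff : 𝓢(E, ℝ)) τ) := by
  have h1 : HasCompactSupport (cutoff : 𝓢(E, ℝ)) :=
    (⟨1, 2, one_pos, one_lt_two⟩ : ContDiffBump (0 : E)).hasCompactSupport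
  exact (h1.comp_smul (inv_ne_zero (Real.sqrt_pos.2 hτ).ne')).mul_left

/-- The cutoff is `1` on the ball of radius `√τ`, and off that ball `|z|/√τ > 1`. Smallness is
bought with one additional power of `1 + |z|`. -/
theorem abs_one_sub_heatScale_cutoff_le {τ : ℝ} (hτ : 0 < τ) (z : E) :
    |1 - heatScale 0 (cutoff : 𝓢(E, ℝ)) τ z| ≤ (√τ)⁻¹ * (1 + ‖z‖) := by
  have hs : 0 < √τ := Real.sqrt_pos.2 hτ
  let b : ContDiffBump (0 : E) := ⟨1, 2, one_pos, one_lt_two⟩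
  have h1 : heatScale 0 (cutoff : 𝓢(E, ℝ)) τ z = b ((√τ)⁻¹ • z) := by
    rw [heatScale, neg_zero, Real.rpow_zero, one_mul]; rfl
  rw [h1]
  have h2 : ‖(√τ)⁻¹ • z‖ = (√τ)⁻¹ * ‖z‖ := by
    rw [norm_smul, Real.norm_of_nonneg (by positivity)]
  by_cases hz : ‖(√τ)⁻¹ • z‖ ≤ 1
  · rw [b.one_of_mem_closedBall (by simpa [b] using hz)]
    simp only [sub_self, abs_zero]
    positivity
  · rw [abs_of_nonneg (sub_nonneg.2 b.le_one)]
    have := b.nonneg (x := (√τ)⁻¹ • z)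
    push Not at hz
    rw [h2] at hz
    have h3 : 0 < (√τ)⁻¹ := by positivity
    nlinarith

omit [FiniteDimensional ℝ E] in
-- Used with `h` a first or second derivative of the cutoff, where the exponent is `1/2` or `1`:
-- derivatives of the wide cutoff are of size `1/√τ`.
theorem abs_heatScale_le_of_one_le {α : ℝ} (hα : 1 / 2 ≤ α) (h : 𝓢(E, ℝ)) {τ : ℝ} (hτ : 1 ≤ τ)
    (z : E) : |heatScale α h τ z| ≤ (√τ)⁻¹ * SchwartzMap.seminorm ℝ 0 0 h := by
  rw [heatScale, abs_mul, abs_of_nonneg (Real.rpow_nonneg (by linarith) _)]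
  refine mul_le_mul ?_ (SchwartzMap.norm_le_seminorm ℝ h _) (abs_nonneg _) (by positivity)
  rw [Real.sqrt_eq_rpow, ← Real.rpow_neg (by linarith)]
  exact Real.rpow_le_rpow_of_exponent_le hτ (by linarith)

theorem abs_heatScale_cutoff_le_one {τ : ℝ} (z : E) :
    |heatScale 0 (cutoff : 𝓢(E, ℝ)) τ z| ≤ 1 := by
  let b : ContDiffBump (0 : E) := ⟨1, 2, one_pos, one_lt_two⟩
  have h1 : heatScale 0 (cutoff : 𝓢(E, ℝ)) τ z = b ((√τ)⁻¹ • z) := by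
    rw [heatScale, neg_zero, Real.rpow_zero, one_mul]; rfl
  rw [h1, abs_of_nonneg b.nonneg]
  exact b.le_one

end Cutoff

end FractionalExtension

/-! ### Cutoff pairings as approximate solutions -/

namespace FractionalExtension

section Liouville

open scoped LineDeriv Laplacian

variable {n : ℕ}

theorem fderiv_fderiv_mul_apply {E : Type*} [NormedAddCommGroup E] [NormedSpace ℝ E] {f g : E → ℝ}
    (hf : ContDiff ℝ 2 f) (hg : ContDiff ℝ 2 g) (v z : E) :
    fderiv ℝ (fun x => fderiv ℝ (fun x => f x * g x) x v) z v =
      f z * fderiv ℝ (fun x => fderiv ℝ g x v) z v +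
        (2 * (fderiv ℝ f z v * fderiv ℝ g z v) +
          fderiv ℝ (fun x => fderiv ℝ f x v) z v * g z) := by
  have hf0 := hf.differentiable (by norm_num)
  have hg0 := hg.differentiable (by norm_num)
  have hf1 : Differentiable ℝ fun x => fderiv ℝ f x v :=
    ((hf.fderiv_right (m := 1) (by norm_num)).clm_apply contDiff_const).differentiable (by norm_num)
  have hg1 : Differentiable ℝ fun x => fderiv ℝ g x v :=
    ((hg.fderiv_right (m := 1) (by norm_num)).clm_apply contDiff_const).differentiable (by norm_num)
  have h1 : (fun x => fderiv ℝ (fun x => f x * g x) x v) =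
      fun x => f x * fderiv ℝ g x v + g x * fderiv ℝ f x v := by
    ext x
    rw [fderiv_fun_mul (hf0 x) (hg0 x)]
    simp
  rw [h1, fderiv_fun_add ((hf0 z).fun_mul (hg1 z)) ((hg0 z).fun_mul (hf1 z)),
    fderiv_fun_mul (hf0 z) (hg1 z), fderiv_fun_mul (hg0 z) (hf1 z)]
  simp
  ring

theorem fderiv_fderiv_heatScale {E : Type*} [NormedAddCommGroup E] [InnerProductSpace ℝ E]
    (α : ℝ) (h : 𝓢(E, ℝ)) {t : ℝ} (ht : 0 < t) (z v : E) :
    fderiv ℝ (fun x => fderiv ℝ (heatScale α h t) x v) z v =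
      heatScale (α + 1) (∂_{v} (∂_{v} h)) t z := by
  have h1 : (fun x => fderiv ℝ (heatScale α h t) x v) = heatScale (α + 1 / 2) (∂_{v} h) t :=
    funext fun x => fderiv_heatScale α h ht x v
  rw [h1, fderiv_heatScale _ _ ht, add_assoc, add_halves]

/-- The commutator of the Laplacian with multiplication by a wide cutoff is small. -/
theorem exists_commutator_bound (α : ℝ) (h : 𝓢(EuclideanSpace ℝ (Fin n), ℝ)) (N : ℕ) {t₀ : ℝ}
    (ht₀ : 0 < t₀) (T : ℝ) :
    ∃ K, 0 ≤ K ∧ ∀ τ, 1 ≤ τ → ∀ t ∈ Icc t₀ T, ∀ z : EuclideanSpace ℝ (Fin n),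
      |heatScale 0 cutoff τ z * heatScale (α + 1) (Δ h) t z -
        ∑ i, fderiv ℝ (fun x => fderiv ℝ (fun x => heatScale 0 cutoff τ x * heatScale α h t x) x
          (EuclideanSpace.basisFun (Fin n) ℝ i)) z (EuclideanSpace.basisFun (Fin n) ℝ i)| *
        (1 + ‖z‖) ^ N ≤ K * (√τ)⁻¹ := by
  obtain ⟨C, hC0, hC⟩ := exists_heatScale_decay α h N ht₀ T
  have hC' := fun i => exists_heatScale_decay (α + 1 / 2)
    (∂_{EuclideanSpace.basisFun (Fin n) ℝ i} h) N ht₀ T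
  choose C' hC'0 hC' using hC'
  let A : Fin n → ℝ := fun i => SchwartzMap.seminorm ℝ 0 0
    (∂_{EuclideanSpace.basisFun (Fin n) ℝ i} (cutoff : 𝓢(EuclideanSpace ℝ (Fin n), ℝ)))
  let B : Fin n → ℝ := fun i => SchwartzMap.seminorm ℝ 0 0
    (∂_{EuclideanSpace.basisFun (Fin n) ℝ i} (∂_{EuclideanSpace.basisFun (Fin n) ℝ i}
      (cutoff : 𝓢(EuclideanSpace ℝ (Fin n), ℝ))))
  have hA : ∀ i, 0 ≤ A i := fun i => apply_nonneg _ _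
  have hB : ∀ i, 0 ≤ B i := fun i => apply_nonneg _ _
  refine ⟨∑ i, (2 * (A i * C' i) + B i * C), Finset.sum_nonneg fun i _ => by
    have := hA i; have := hB i; have := hC'0 i; positivity, fun τ hτ t ht z => ?_⟩
  have hτ0 : 0 < τ := by linarith
  have ht' : 0 < t := ht₀.trans_le ht.1
  have hsum : heatScale (α + 1) (Δ h) t z = ∑ i, heatScale (α + 1)
      (∂_{EuclideanSpace.basisFun (Fin n) ℝ i} (∂_{EuclideanSpace.basisFun (Fin n) ℝ i} h)) t z := by
    simp only [heatScale]
    rw [SchwartzMap.laplacian_eq_sum (EuclideanSpace.basisFun (Fin n) ℝ), sum_apply,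
      Finset.mul_sum]
  rw [hsum, Finset.mul_sum, ← Finset.sum_sub_distrib]
  rw [Finset.sum_mul]
  refine (mul_le_mul_of_nonneg_right (Finset.abs_sum_le_sum_abs _ _) (by positivity)).trans ?_
  rw [Finset.sum_mul]
  refine Finset.sum_le_sum fun i _ => ?_
  -- By the Leibniz rule the term with both derivatives on `heatScale α h t` cancels; every
  -- remaining term has a derivative on the cutoff.
  rw [fderiv_fderiv_mul_apply (contDiff_heatScale 0 _ τ (k := 2)) (contDiff_heatScale α h t (k := 2)),
    fderiv_fderiv_heatScale _ _ ht', fderiv_fderiv_heatScale _ _ hτ0, fderiv_heatScale _ _ hτ0,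
    fderiv_heatScale _ _ ht', sub_add_cancel_left, abs_neg, zero_add, zero_add]
  have h1 := abs_heatScale_le_of_one_le (α := 1 / 2) le_rfl
    (∂_{EuclideanSpace.basisFun (Fin n) ℝ i} (cutoff : 𝓢(EuclideanSpace ℝ (Fin n), ℝ))) hτ z
  have h2 := abs_heatScale_le_of_one_le (α := 1) (by norm_num)
    (∂_{EuclideanSpace.basisFun (Fin n) ℝ i} (∂_{EuclideanSpace.basisFun (Fin n) ℝ i}
      (cutoff : 𝓢(EuclideanSpace ℝ (Fin n), ℝ)))) hτ z
  have h3 := hC' i t ht z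
  have h4 := hC t ht z
  refine (mul_le_mul_of_nonneg_right (abs_add_le _ _) (by positivity)).trans ?_
  rw [abs_mul, abs_mul, abs_mul, abs_two, add_mul]
  calc _ = 2 * (|heatScale (1 / 2) (∂_{EuclideanSpace.basisFun (Fin n) ℝ i}
          (cutoff : 𝓢(EuclideanSpace ℝ (Fin n), ℝ))) τ z| *
          (|heatScale (α + 1 / 2) (∂_{EuclideanSpace.basisFun (Fin n) ℝ i} h) t z| *
            (1 + ‖z‖) ^ N)) +
        |heatScale 1 (∂_{EuclideanSpace.basisFun (Fin n) ℝ i}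
          (∂_{EuclideanSpace.basisFun (Fin n) ℝ i}
            (cutoff : 𝓢(EuclideanSpace ℝ (Fin n), ℝ)))) τ z| *
          (|heatScale α h t z| * (1 + ‖z‖) ^ N) := by ring
    _ ≤ 2 * (((√τ)⁻¹ * A i) * C' i) + ((√τ)⁻¹ * B i) * C := by
        have := hA i
        have := hB i
        gcongr
    _ = _ := by ring

/-- Temperedness controls `W` but not its derivatives, so the full pairing cannot be differentiated
in `y` directly. With a cutoff of width `√τ` it can be, and both the change of the pairing and the
defect in the equation are `O(1/√τ)`, uniformly on the rectangle, because the weighted `L¹` norms of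
`W(·, y)` are bounded on `[0, Y]`. -/
theorem exists_cutoff_pairing {s : ℝ} {W : EuclideanSpace ℝ (Fin n) → ℝ → ℝ}
    (hW : IsExtensionSolution s (fun _ => 0) W) (hloc : IsLocallyTempered W) {α : ℝ}
    {h : 𝓢(EuclideanSpace ℝ (Fin n), ℝ)} (hh : IsHeatProfile α h) {t₀ : ℝ} (ht₀ : 0 < t₀) (T Y : ℝ)
    {ε : ℝ} (hε : 0 < ε) :
    ∃ v : ℝ → ℝ → ℝ, ContinuousOn (Function.uncurry v) (Icc t₀ T ×ˢ Icc 0 Y) ∧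
      (∀ t ∈ Icc t₀ T, ∀ y ∈ Icc 0 Y, |v t y - ∫ z, heatScale α h t z * W z y| ≤ ε) ∧
      (∀ t, v t 0 = 0) ∧
      ∀ t ∈ Icc t₀ T, ∀ y ∈ Ioc 0 Y, ∃ (d : ℝ) (p₁ : ℝ → ℝ) (p₂ : ℝ),
        HasDerivAt (fun t => v t y) d t ∧ (∀ᶠ x in 𝓝 y, HasDerivAt (v t) (p₁ x) x) ∧
        HasDerivAt p₁ p₂ y ∧ |d + p₂ + (1 - 2 * s) / y * p₁ y| ≤ ε := by
  obtain ⟨N, Cw, hCw⟩ := hloc Y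
  obtain ⟨K₁, hK₁0, hK₁⟩ := exists_commutator_bound α h N ht₀ T
  -- The exponent `N + 1` pays for the factor `1 + ‖z‖` in the bound of `1 - χ`.
  obtain ⟨K₂, hK₂0, hK₂⟩ := exists_heatScale_decay α h (N + 1) ht₀ T
  obtain ⟨K₃, hK₃0, hK₃⟩ := exists_heatScale_decay α h N ht₀ T
  obtain ⟨τ, hτ1, hτ⟩ : ∃ τ : ℝ, 1 ≤ τ ∧ (K₁ + K₂) * |Cw| * (√τ)⁻¹ ≤ ε := by
    have h1 : Tendsto (fun τ : ℝ => (K₁ + K₂) * |Cw| * (√τ)⁻¹) atTop (𝓝 ((K₁ + K₂) * |Cw| * 0)) :=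
      (tendsto_inv_atTop_zero.comp Real.tendsto_sqrt_atTop).const_mul _
    rw [mul_zero] at h1
    obtain ⟨τ, h2, h3⟩ := ((h1.eventually (gt_mem_nhds hε)).and (eventually_ge_atTop 1)).exists
    exact ⟨τ, h3, h2.le⟩
  have hτ0 : 0 < τ := by linarith
  have hs0 : 0 ≤ (√τ)⁻¹ := by positivity
  set χ : EuclideanSpace ℝ (Fin n) → ℝ := heatScale 0 cutoff τ with hχ
  have hχc : HasCompactSupport χ := hasCompactSupport_heatScale_cutoff hτ0
  have hχs : ContDiff ℝ 2 χ := contDiff_heatScale 0 _ τ (k := 2)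
  have hslice : ∀ y, 0 ≤ y → Continuous fun z => W z y := fun y hy =>
    hW.continuousOn.comp_continuous (f := fun z => (z, y)) (by fun_prop) fun z => ⟨mem_univ _, hy⟩
  have hFc : ∀ (β : ℝ) (k : 𝓢(EuclideanSpace ℝ (Fin n), ℝ)) (t : ℝ), Continuous (heatScale β k t) :=
    fun β k t => (contDiff_heatScale β k t (k := 0)).continuous
  refine ⟨fun t y => ∫ z, (χ z * heatScale α h t z) * W z y, ?_, ?_, ?_, ?_⟩
  · refine continuousOn_integral_of_compact_support (k := tsupport χ)
      (f := fun (p : ℝ × ℝ) z => (χ z * heatScale α h p.1 z) * W z p.2) hχc.isCompact ?_ ?_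
    · refine ContinuousOn.mul (ContinuousOn.mul (hχs.continuous.comp continuous_snd).continuousOn
        ?_) ?_
      · exact (continuousOn_heatScale α h).comp
          (f := fun q : (ℝ × ℝ) × EuclideanSpace ℝ (Fin n) => (q.1.1, q.2)) (by fun_prop)
          fun q hq => ⟨ht₀.trans_le hq.1.1.1, mem_univ _⟩
      · exact hW.continuousOn.comp
          (f := fun q : (ℝ × ℝ) × EuclideanSpace ℝ (Fin n) => (q.2, q.1.2)) (by fun_prop)
          fun q hq => ⟨mem_univ _, hq.1.2.1⟩
    · intro p z _ hz
      simp [image_eq_zero_of_notMem_tsupport hz]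
  · intro t ht y hy
    obtain ⟨hint, hle⟩ := hCw y hy
    have hχF : ∀ z, |χ z * heatScale α h t z| * (1 + ‖z‖) ^ N ≤ K₃ := fun z => by
      rw [abs_mul, mul_assoc]
      exact (mul_le_of_le_one_left (by positivity) (abs_heatScale_cutoff_le_one z)).trans (hK₃ t ht z)
    have hI1 : Integrable fun z => heatScale α h t z * W z y :=
      integrable_mul_of_weighted hint (hslice y hy.1) (hFc α h t) (hK₃ t ht)
    have hI2 : Integrable fun z => (χ z * heatScale α h t z) * W z y :=
      integrable_mul_of_weighted hint (hslice y hy.1) (hχs.continuous.mul (hFc α h t)) hχF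
    rw [abs_sub_comm, ← integral_sub hI1 hI2]
    simp only [← sub_mul]
    refine (abs_integral_mul_le_of_weighted (c := K₂ * (√τ)⁻¹) hint (hle.trans (le_abs_self _))
      (by positivity) fun z => ?_).trans (le_trans ?_ hτ)
    · have h1 := abs_one_sub_heatScale_cutoff_le hτ0 z
      rw [← one_sub_mul, abs_mul]
      calc |1 - χ z| * |heatScale α h t z| * (1 + ‖z‖) ^ N
          ≤ ((√τ)⁻¹ * (1 + ‖z‖)) * |heatScale α h t z| * (1 + ‖z‖) ^ N := by gcongr
        _ = (|heatScale α h t z| * (1 + ‖z‖) ^ (N + 1)) * (√τ)⁻¹ := by ring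
        _ ≤ _ := by gcongr; exact hK₂ t ht z
    · nlinarith [mul_nonneg (mul_nonneg hK₁0 (abs_nonneg Cw)) hs0]
  · intro t
    simp [hW.boundary]
  · intro t ht y hy
    have ht' : 0 < t := ht₀.trans_le ht.1
    have hg : ContDiff ℝ 2 fun z => χ z * heatScale α h t z :=
      hχs.mul (contDiff_heatScale α h t (k := 2))
    obtain ⟨P1, P2, hP⟩ := hW.exists_pairing_derivs hg hχc.mul_right
    obtain ⟨-, hP2, hPeq⟩ := hP y hy.1
    obtain ⟨hint, hle⟩ := hCw y ⟨hy.1.le, hy.2⟩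
    have hχW : Integrable fun z => χ z * W z y :=
      integrable_mul_of_hasCompactSupport (hslice y hy.1.le) hχs.continuous hχc
    obtain ⟨C, hC0, hC⟩ := exists_heatScale_decay (α + 1) (Δ h) 0 (half_pos ht') (2 * t)
    have hd : HasDerivAt (fun t => ∫ z, (χ z * heatScale α h t z) * W z y)
        (∫ z, (χ z * heatScale (α + 1) (Δ h) t z) * W z y) t := by
      refine (hasDerivAt_integral_of_dominated_loc_of_deriv_le (s := Icc (t / 2) (2 * t))
        (F' := fun t z => (χ z * heatScale (α + 1) (Δ h) t z) * W z y)
        (bound := fun z => C * ‖χ z * W z y‖)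
        (Icc_mem_nhds (by linarith) (by linarith)) ?_ ?_ ?_ ?_ ?_ ?_).2
      · exact Eventually.of_forall fun x =>
          ((hχs.continuous.mul (hFc α h x)).mul (hslice y hy.1.le)).aestronglyMeasurable
      · exact integrable_mul_of_hasCompactSupport (hslice y hy.1.le) hg.continuous hχc.mul_right
      · exact ((hχs.continuous.mul (hFc _ _ t)).mul (hslice y hy.1.le)).aestronglyMeasurable
      · refine Eventually.of_forall fun z x hx => ?_
        have h1 := hC x hx z
        rw [pow_zero, mul_one] at h1
        rw [mul_right_comm, norm_mul, mul_comm]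
        exact mul_le_mul_of_nonneg_right h1 (norm_nonneg _)
      · exact hχW.norm.const_mul C
      · refine Eventually.of_forall fun z x hx => ?_
        exact ((hasDerivAt_heatScale hh (lt_of_lt_of_le (half_pos ht') hx.1) z).const_mul
          (χ z)).mul_const _
    refine ⟨_, P1, P2 y, hd, ?_, hP2, ?_⟩
    · filter_upwards [lt_mem_nhds hy.1] with x hx
      exact (hP x hx).1
    · have hg2 : ∀ v, Continuous fun z =>
          fderiv ℝ (fun x => fderiv ℝ (fun x => χ x * heatScale α h t x) x v) z v := fun v =>
        ((((hg.fderiv_right (m := 1) (by norm_num)).clm_apply contDiff_const).fderiv_right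
          (m := 0) (by norm_num)).clm_apply contDiff_const).continuous
      have hI1 : Integrable fun z => (χ z * heatScale (α + 1) (Δ h) t z) * W z y :=
        integrable_mul_of_hasCompactSupport (hslice y hy.1.le)
          (hχs.continuous.mul (hFc _ _ t)) hχc.mul_right
      have hI2 : Integrable fun z =>
          (∑ i, fderiv ℝ (fun x => fderiv ℝ (fun x => χ x * heatScale α h t x) x
            (EuclideanSpace.basisFun (Fin n) ℝ i)) z (EuclideanSpace.basisFun (Fin n) ℝ i)) *
            W z y := by
        simp only [Finset.sum_mul]
        exact integrable_finsetSum _ fun i _ => integrable_mul_of_hasCompactSupport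
          (hslice y hy.1.le) (hg2 _) ((hχc.mul_right.fderiv_apply ℝ _).fderiv_apply ℝ _)
      -- The `t`-derivative pairs `W` with `χ ΔF` and the Bessel operator in `y` pairs it with
      -- `-Δ(χF)`, so the defect is the commutator.
      rw [add_assoc, hPeq, ← sub_eq_add_neg, ← integral_sub hI1 hI2]
      simp only [← sub_mul]
      refine (abs_integral_mul_le_of_weighted (c := K₁ * (√τ)⁻¹) hint
        (hle.trans (le_abs_self _)) (by positivity) fun z => hK₁ τ hτ1 t ht z).trans
          (le_trans ?_ hτ)
      nlinarith [mul_nonneg (mul_nonneg hK₂0 (abs_nonneg Cw)) hs0]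

end Liouville

end FractionalExtension

/-! ### The barrier and the Liouville theorem -/

namespace FractionalExtension

section Liouville

open scoped LineDeriv Laplacian

variable {n : ℕ}

/-- Comparison on a rectangle with the barrier
`M (y / Y) ^ 2s + M e ^ {-λ (T - t)} (2 Y² - y²) / Y²`. -/
theorem heatScale_pairing_le_barrier {s : ℝ} (hs0 : 0 < s) (hs1 : s < 1)
    {W : EuclideanSpace ℝ (Fin n) → ℝ → ℝ}
    (hW : IsExtensionSolution s (fun _ => 0) W) (hloc : IsLocallyTempered W) {α : ℝ}
    {h : 𝓢(EuclideanSpace ℝ (Fin n), ℝ)} (hh : IsHeatProfile α h) {t₀ T Y M ε : ℝ} (ht₀ : 0 < t₀)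
    (hT : t₀ ≤ T) (hY : 0 < Y) (hM0 : 0 ≤ M) (hε : 0 < ε)
    (hM : ∀ t, t₀ ≤ t → ∀ y, 0 ≤ y → |∫ z, heatScale α h t z * W z y| ≤ M)
    {y : ℝ} (hy : y ∈ Icc 0 Y) :
    ∫ z, heatScale α h t₀ z * W z y ≤ ε + ((M + ε) * ((Y ^ (2 * s))⁻¹ * y ^ (2 * s)) +
      ((M + ε) * Real.exp ((4 - 4 * s) / (2 * Y ^ 2) * (t₀ - T)) +
        2 * ε * Y ^ 2 / (4 - 4 * s)) * ((2 * Y ^ 2 - y ^ 2) / Y ^ 2)) := by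
  obtain ⟨v, hvc, hvV, hv0, hvint⟩ := exists_cutoff_pairing hW hloc hh ht₀ T Y hε
  -- With `a = 1 - 2s`, the operator `∂_yy + (a/y) ∂_y` kills `y^{2s}` and sends `(2Y² - y²)/Y²` to
  -- `-(2 + 2a)/Y² = -(4 - 4s)/Y²`.
  have hκ : 0 < 4 - 4 * s := by linarith
  set κ := 4 - 4 * s with hκdef
  -- The quadratic factor is at most `2`, so the `t`-derivative of the exponential term is at most
  -- `2l = κ/Y²` times the exponential: just what the Bessel operator removes.
  set l := κ / (2 * Y ^ 2) with hl
  set c := (Y ^ (2 * s))⁻¹ with hc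
  have hc0 : 0 < c := by positivity
  have hq : ∀ x ∈ Icc 0 Y, 1 ≤ (2 * Y ^ 2 - x ^ 2) / Y ^ 2 ∧ (2 * Y ^ 2 - x ^ 2) / Y ^ 2 ≤ 2 := by
    intro x hx
    have h1 : x ^ 2 ≤ Y ^ 2 := pow_le_pow_left₀ hx.1 hx.2 2
    constructor
    · rw [le_div_iff₀ (by positivity)]; linarith
    · rw [div_le_iff₀ (by positivity)]; nlinarith
  -- The constant summand contributes `2ε` under the operator. It beats the defect `ε` of the
  -- approximate solution and leaves the strict inequality the maximum principle asks for.
  let A : ℝ → ℝ := fun t => (M + ε) * Real.exp (l * (t - T)) + 2 * ε * Y ^ 2 / κ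
  have hA0 : ∀ t, 0 ≤ A t := fun t => by positivity
  let B : ℝ → ℝ → ℝ := fun t y =>
    (M + ε) * (c * y ^ (2 * s)) + A t * ((2 * Y ^ 2 - y ^ 2) / Y ^ 2)
  have hvM : ∀ t ∈ Icc t₀ T, ∀ x ∈ Icc 0 Y, v t x ≤ M + ε := fun t ht x hx => by
    have h1 := (abs_le.1 (hvV t ht x hx)).2
    have h2 := (abs_le.1 (hM t ht.1 x hx.1)).2
    linarith
  have hmax := backward_maximum_principle (a := 1 - 2 * s) (v := fun t y => v t y - B t y)
    (t₀ := t₀) (T := T) (Y := Y) ?_ ?_ ?_ ?_ ?_ t₀ ⟨le_rfl, hT⟩ y hy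
  · have h1 := (abs_le.1 (hvV t₀ ⟨le_rfl, hT⟩ y hy)).1
    have h2 : v t₀ y ≤ B t₀ y := sub_nonpos.1 hmax
    have h3 : B t₀ y = (M + ε) * (c * y ^ (2 * s)) +
      ((M + ε) * Real.exp (l * (t₀ - T)) + 2 * ε * Y ^ 2 / κ) *
        ((2 * Y ^ 2 - y ^ 2) / Y ^ 2) := rfl
    linarith
  · refine hvc.sub (Continuous.continuousOn ?_)
    have h1 : Continuous fun p : ℝ × ℝ => p.2 ^ (2 * s) :=
      continuous_snd.rpow_const fun _ => Or.inr (by positivity)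
    change Continuous fun p : ℝ × ℝ => (M + ε) * (c * p.2 ^ (2 * s)) +
      ((M + ε) * Real.exp (l * (p.1 - T)) + 2 * ε * Y ^ 2 / κ) * ((2 * Y ^ 2 - p.2 ^ 2) / Y ^ 2)
    fun_prop
  · intro x hx
    have h1 := hvM T ⟨hT, le_rfl⟩ x hx
    have h2 : 0 ≤ (M + ε) * (c * x ^ (2 * s)) :=
      mul_nonneg (by positivity) (mul_nonneg hc0.le (Real.rpow_nonneg hx.1 _))
    have h3 : M + ε ≤ A T := by
      change M + ε ≤ (M + ε) * Real.exp (l * (T - T)) + 2 * ε * Y ^ 2 / κ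
      rw [sub_self, mul_zero, Real.exp_zero, mul_one]
      exact le_add_of_nonneg_right (by positivity)
    have h4 : A T ≤ A T * ((2 * Y ^ 2 - x ^ 2) / Y ^ 2) := le_mul_of_one_le_right (hA0 T) (hq x hx).1
    change v T x - ((M + ε) * (c * x ^ (2 * s)) + A T * ((2 * Y ^ 2 - x ^ 2) / Y ^ 2)) ≤ 0
    linarith
  · intro t ht
    have h4 : 0 ≤ A t * ((2 * Y ^ 2 - 0 ^ 2) / Y ^ 2) :=
      mul_nonneg (hA0 t) (zero_le_one.trans (hq 0 ⟨le_rfl, hY.le⟩).1)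
    change v t 0 - ((M + ε) * (c * 0 ^ (2 * s)) + A t * ((2 * Y ^ 2 - 0 ^ 2) / Y ^ 2)) ≤ 0
    rw [hv0, Real.zero_rpow (by positivity)]
    linarith
  · intro t ht
    have h1 := hvM t ht Y ⟨hY.le, le_rfl⟩
    have h4 : 0 ≤ A t * ((2 * Y ^ 2 - Y ^ 2) / Y ^ 2) :=
      mul_nonneg (hA0 t) (zero_le_one.trans (hq Y ⟨hY.le, le_rfl⟩).1)
    change v t Y - ((M + ε) * (c * Y ^ (2 * s)) + A t * ((2 * Y ^ 2 - Y ^ 2) / Y ^ 2)) ≤ 0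
    rw [hc, inv_mul_cancel₀ (by positivity)]
    linarith
  · intro t ht x hx
    obtain ⟨d, p₁, p₂, hd, hp1, hp2, hle⟩ := hvint t ⟨ht.1, ht.2.le⟩ x ⟨hx.1, hx.2.le⟩
    have hpow : ∀ (r : ℝ) {x : ℝ}, 0 < x → HasDerivAt (fun x : ℝ => x ^ r) (r * x ^ (r - 1)) x :=
      fun r x hx => Real.hasDerivAt_rpow_const (Or.inl hx.ne')
    refine ⟨d - (M + ε) * (Real.exp (l * (t - T)) * l) * ((2 * Y ^ 2 - x ^ 2) / Y ^ 2),
      fun x => p₁ x - ((M + ε) * (c * (2 * s * x ^ (2 * s - 1))) + A t * (-(2 * x) / Y ^ 2)),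
      p₂ - ((M + ε) * (c * (2 * s * ((2 * s - 1) * x ^ (2 * s - 1 - 1)))) +
        A t * (-(2 * 1) / Y ^ 2)), ?_, ?_, ?_, ?_⟩
    · refine hd.sub ?_
      have h1 : HasDerivAt (fun t => Real.exp (l * (t - T))) (Real.exp (l * (t - T)) * l) t := by
        simpa using (((hasDerivAt_id t).sub_const T).const_mul l).exp
      exact (((h1.const_mul (M + ε)).add_const _).mul_const _).const_add _
    · filter_upwards [hp1, lt_mem_nhds hx.1] with x' hx' hpos
      refine hx'.sub ?_
      have h1 : HasDerivAt (fun x : ℝ => (2 * Y ^ 2 - x ^ 2) / Y ^ 2) (-(2 * x') / Y ^ 2) x' := by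
        simpa using ((hasDerivAt_pow 2 x').const_sub (2 * Y ^ 2)).div_const (Y ^ 2)
      exact (((hpow (2 * s) hpos).const_mul c).const_mul (M + ε)).add (h1.const_mul (A t))
    · refine hp2.sub ?_
      have h1 : HasDerivAt (fun x : ℝ => -(2 * x) / Y ^ 2) (-(2 * 1) / Y ^ 2) x :=
        (((hasDerivAt_id x).const_mul 2).fun_neg).div_const _
      exact ((((hpow (2 * s - 1) hx.1).const_mul (2 * s)).const_mul c).const_mul (M + ε)).add
        (h1.const_mul (A t))
    · have h1 := (abs_le.1 hle).1
      have h2 := (hq x ⟨hx.1.le, hx.2.le⟩).2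
      have hpx : x ^ (2 * s - 1) = x * x ^ (2 * s - 1 - 1) := by
        rw [Real.rpow_sub_one hx.1.ne' (2 * s - 1), mul_div_cancel₀ _ hx.1.ne']
      have hx0 : x ≠ 0 := hx.1.ne'
      have hY0 : Y ≠ 0 := hY.ne'
      have hAκ : A t * (κ / Y ^ 2) = 2 * ε + (M + ε) * Real.exp (l * (t - T)) * (2 * l) := by
        change ((M + ε) * Real.exp (l * (t - T)) + 2 * ε * Y ^ 2 / κ) * (κ / Y ^ 2) = _
        rw [hl]
        field_simp
        ring
      have h3 : (M + ε) * (Real.exp (l * (t - T)) * l) * ((2 * Y ^ 2 - x ^ 2) / Y ^ 2) ≤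
          (M + ε) * (Real.exp (l * (t - T)) * l) * 2 :=
        mul_le_mul_of_nonneg_left h2 (by positivity)
      -- All terms in powers of `x` from the `y^{2s}` part of the barrier cancel.
      have h4 : d - (M + ε) * (Real.exp (l * (t - T)) * l) * ((2 * Y ^ 2 - x ^ 2) / Y ^ 2) +
          (p₂ - ((M + ε) * (c * (2 * s * ((2 * s - 1) * x ^ (2 * s - 1 - 1)))) +
            A t * (-(2 * 1) / Y ^ 2))) + (1 - 2 * s) / x *
          (p₁ x - ((M + ε) * (c * (2 * s * x ^ (2 * s - 1))) + A t * (-(2 * x) / Y ^ 2))) =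
          (d + p₂ + (1 - 2 * s) / x * p₁ x) -
          (M + ε) * (Real.exp (l * (t - T)) * l) * ((2 * Y ^ 2 - x ^ 2) / Y ^ 2) +
          A t * (κ / Y ^ 2) := by
        rw [hpx, hκdef]
        field_simp
        ring
      rw [h4, hAκ]
      linarith

theorem heatScale_neg {E : Type*} [NormedAddCommGroup E] [InnerProductSpace ℝ E] (α : ℝ)
    (h : 𝓢(E, ℝ)) (t : ℝ) (z : E) : heatScale α (-h) t z = -heatScale α h t z := by
  rw [heatScale, heatScale, neg_apply, mul_neg]

theorem IsHeatProfile.neg {E : Type*} [NormedAddCommGroup E] [InnerProductSpace ℝ E]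
    [FiniteDimensional ℝ E] {α : ℝ} {h : 𝓢(E, ℝ)} (hh : IsHeatProfile α h) :
    IsHeatProfile α (-h) := by
  intro z
  have h1 : Δ (-h) = -Δ h := by rw [← SchwartzMap.laplacianCLM_eq', map_neg]; rfl
  have h2 : fderiv ℝ (⇑(-h)) z = -fderiv ℝ h z := fderiv_neg
  rw [h1, h2, neg_apply, neg_apply, hh z, neg_apply]
  ring

/-- **Liouville theorem**: a bounded ancient solution of the Bessel heat equation with zero
boundary values vanishes. -/
theorem heatScale_pairing_eq_zero_of_bounded {s : ℝ} (hs0 : 0 < s) (hs1 : s < 1)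
    {W : EuclideanSpace ℝ (Fin n) → ℝ → ℝ}
    (hW : IsExtensionSolution s (fun _ => 0) W) (hloc : IsLocallyTempered W) {α : ℝ}
    {h : 𝓢(EuclideanSpace ℝ (Fin n), ℝ)} (hh : IsHeatProfile α h) {t₀ M : ℝ} (ht₀ : 0 < t₀)
    (hM : ∀ t, t₀ ≤ t → ∀ y, 0 ≤ y → |∫ z, heatScale α h t z * W z y| ≤ M) {y : ℝ} (hy : 0 ≤ y) :
    ∫ z, heatScale α h t₀ z * W z y = 0 := by
  have key : ∀ h : 𝓢(EuclideanSpace ℝ (Fin n), ℝ), IsHeatProfile α h →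
      (∀ t, t₀ ≤ t → ∀ y, 0 ≤ y → |∫ z, heatScale α h t z * W z y| ≤ M) →
      ∫ z, heatScale α h t₀ z * W z y ≤ 0 := by
    intro h hh hM
    have hM0 : 0 ≤ M := (abs_nonneg _).trans (hM t₀ le_rfl y hy)
    -- The limits are taken in the order `ε → 0`, `T → ∞`, `Y → ∞`: the exponential rate depends on
    -- `Y` and degenerates as `Y` grows, so `T` goes first.
    have step1 : ∀ T Y, t₀ ≤ T → 0 < Y → y ≤ Y → ∫ z, heatScale α h t₀ z * W z y ≤
        M * ((Y ^ (2 * s))⁻¹ * y ^ (2 * s)) +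
        M * Real.exp ((4 - 4 * s) / (2 * Y ^ 2) * (t₀ - T)) * ((2 * Y ^ 2 - y ^ 2) / Y ^ 2) := by
      intro T Y hT hY hyY
      let g : ℝ → ℝ := fun ε => ε + ((M + ε) * ((Y ^ (2 * s))⁻¹ * y ^ (2 * s)) +
        ((M + ε) * Real.exp ((4 - 4 * s) / (2 * Y ^ 2) * (t₀ - T)) +
        2 * ε * Y ^ 2 / (4 - 4 * s)) * ((2 * Y ^ 2 - y ^ 2) / Y ^ 2))
      have hg : Continuous g := by fun_prop
      have hlim : Tendsto g (𝓝[>] 0) (𝓝 (g 0)) := hg.continuousAt.tendsto.mono_left inf_le_left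
      have h0 := ge_of_tendsto hlim (eventually_mem_nhdsWithin.mono fun ε hε =>
        heatScale_pairing_le_barrier hs0 hs1 hW hloc hh ht₀ hT hY hM0 hε hM ⟨hy, hyY⟩)
      simpa [g] using h0
    have step2 : ∀ Y, 0 < Y → y ≤ Y → ∫ z, heatScale α h t₀ z * W z y ≤
        M * ((Y ^ (2 * s))⁻¹ * y ^ (2 * s)) := by
      intro Y hY hyY
      have hκ : 0 < (4 - 4 * s) / (2 * Y ^ 2) := div_pos (by linarith) (by positivity)
      have h1 : Tendsto (fun T => Real.exp ((4 - 4 * s) / (2 * Y ^ 2) * (t₀ - T))) atTop (𝓝 0) :=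
        Real.tendsto_exp_atBot.comp
          ((tendsto_atBot_add_const_left _ t₀ tendsto_neg_atTop_atBot).const_mul_atBot hκ)
      have h2 := ((h1.const_mul M).mul_const ((2 * Y ^ 2 - y ^ 2) / Y ^ 2)).const_add
        (M * ((Y ^ (2 * s))⁻¹ * y ^ (2 * s)))
      rw [mul_zero, zero_mul, add_zero] at h2
      exact ge_of_tendsto h2 ((eventually_ge_atTop t₀).mono fun T hT => step1 T Y hT hY hyY)
    have h3 : Tendsto (fun Y : ℝ => M * ((Y ^ (2 * s))⁻¹ * y ^ (2 * s))) atTop (𝓝 0) := by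
      have := ((tendsto_inv_atTop_zero.comp (tendsto_rpow_atTop (y := 2 * s)
        (by positivity))).mul_const (y ^ (2 * s))).const_mul M
      simpa using this
    refine ge_of_tendsto h3 ?_
    filter_upwards [eventually_gt_atTop 0, eventually_ge_atTop y] with Y hY hyY
    exact step2 Y hY hyY
  refine le_antisymm (key h hh hM) ?_
  have h1 := key (-h) hh.neg fun t ht y hy => by
    simp only [heatScale_neg, neg_mul, integral_neg, abs_neg]
    exact hM t ht y hy
  simp only [heatScale_neg, neg_mul, integral_neg] at h1
  linarith

end Liouville

end FractionalExtension

/-! ### Vanishing of Gaussian pairings -/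

namespace FractionalExtension

section Uniqueness

open scoped LineDeriv Laplacian

variable {n : ℕ}

theorem exists_weighted_bound {E : Type*} [NormedAddCommGroup E] [NormedSpace ℝ E] (φ : 𝓢(E, ℝ))
    (N : ℕ) (z : E) : |φ z| * (1 + ‖z‖) ^ N ≤
      2 ^ N * (Finset.Iic (N, 0)).sup (fun m => SchwartzMap.seminorm ℝ m.1 m.2) φ := by
  have := SchwartzMap.one_add_le_sup_seminorm_apply (𝕜 := ℝ) (m := (N, 0)) le_rfl le_rfl φ z
  rw [mul_comm]
  simpa using this

/-- Integration against a tempered continuous function, as a functional on the Schwartz space. -/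
theorem exists_clm_integral_mul {w : EuclideanSpace ℝ (Fin n) → ℝ} {N : ℕ}
    (hw : Integrable (fun x => |w x| / (1 + ‖x‖) ^ N)) (hwc : Continuous w) :
    ∃ T : 𝓢(EuclideanSpace ℝ (Fin n), ℝ) →L[ℝ] ℝ, ∀ φ, T φ = ∫ z, φ z * w z := by
  have hI : ∀ φ : 𝓢(EuclideanSpace ℝ (Fin n), ℝ), Integrable fun z => φ z * w z := fun φ =>
    integrable_mul_of_weighted hw hwc φ.continuous (exists_weighted_bound φ N)
  refine ⟨SchwartzMap.mkCLMtoNormedSpace (𝕜 := ℝ) (σ := RingHom.id ℝ)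
    (fun φ => ∫ z, φ z * w z) (fun φ ψ => ?_) (fun a φ => ?_) ?_, fun φ => rfl⟩
  · rw [← integral_add (hI φ) (hI ψ)]
    simp only [add_apply, add_mul]
  · rw [RingHom.id_apply, smul_eq_mul, ← integral_const_mul]
    exact integral_congr_ae (Eventually.of_forall fun z => mul_assoc a (φ z) (w z))
  · refine ⟨Finset.Iic (N, 0), 2 ^ N * |∫ x, |w x| / (1 + ‖x‖) ^ N|, by positivity, fun φ => ?_⟩
    rw [Real.norm_eq_abs, mul_right_comm]
    exact abs_integral_mul_le_of_weighted hw (le_abs_self _) (by positivity)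
      (exists_weighted_bound φ N)

/-- Convergence to zero bounds the pairing for large `y`, and local temperedness on the remaining
compact interval. This is the pointwise hypothesis of Banach–Steinhaus. -/
theorem WeaklyVanishes.exists_bound {W : EuclideanSpace ℝ (Fin n) → ℝ → ℝ} (hW : WeaklyVanishes W)
    (φ : 𝓢(EuclideanSpace ℝ (Fin n), ℝ)) :
    ∃ C, ∀ y, 0 ≤ y → |∫ z, φ z * W z y| ≤ C := by
  have h1 := hW.tendsto φ
  simp only [mul_comm (W _ _)] at h1
  obtain ⟨Y, hY⟩ := eventually_atTop.1 ((h1.abs).eventually (gt_mem_nhds (show |(0 : ℝ)| < 1 by simp)))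
  obtain ⟨N, C, hC⟩ := hW.tempered Y
  set c := 2 ^ N * (Finset.Iic (N, 0)).sup (fun m => SchwartzMap.seminorm ℝ m.1 m.2) φ with hc
  have hc0 : 0 ≤ c := by positivity
  refine ⟨max 1 (c * C), fun y hy => ?_⟩
  rcases le_total Y y with hYy | hyY
  · exact (hY y hYy).le.trans (le_max_left _ _)
  · obtain ⟨hi, hle⟩ := hC y ⟨hy, hyY⟩
    exact (abs_integral_mul_le_of_weighted hi hle hc0 (exists_weighted_bound φ N)).trans
      (le_max_right _ _)

/-- The iterated Laplacians of the Gaussian. -/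
noncomputable def laplacianProfile (n k : ℕ) : 𝓢(EuclideanSpace ℝ (Fin n), ℝ) :=
  (fun h => Δ h)^[k] gaussianProfile

theorem laplacianProfile_succ (k : ℕ) :
    laplacianProfile n (k + 1) = Δ (laplacianProfile n k) :=
  Function.iterate_succ_apply' _ _ _

theorem isHeatProfile_laplacianProfile (k : ℕ) :
    IsHeatProfile ((n : ℝ) / 2 + k) (laplacianProfile n k) := by
  induction k with
  | zero =>
    have := isHeatProfile_gaussianProfile (E := EuclideanSpace ℝ (Fin n))
    rw [finrank_euclideanSpace_fin] at this
    rw [Nat.cast_zero, add_zero]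
    exact this
  | succ k ih =>
    rw [laplacianProfile_succ, Nat.cast_succ, ← add_assoc]
    exact ih.laplacian

section

variable {s : ℝ} {W : EuclideanSpace ℝ (Fin n) → ℝ → ℝ}

theorem IsExtensionSolution.continuous_slice {u : EuclideanSpace ℝ (Fin n) → ℝ}
    (hW : IsExtensionSolution s u W) {y : ℝ} (hy : 0 ≤ y) : Continuous fun z => W z y :=
  hW.continuousOn.comp_continuous (f := fun z => (z, y)) (by fun_prop) fun z => ⟨mem_univ _, hy⟩

/-- Banach–Steinhaus bounds all slices at once by finitely many seminorms, and `k` Laplacians add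
`k` to the decay exponent in `t`. Enough of them outweigh the polynomial weights in those seminorms.
-/
theorem exists_laplacianProfile_pairing_bounded {u : EuclideanSpace ℝ (Fin n) → ℝ}
    (hW : IsExtensionSolution s u W) (hv : WeaklyVanishes W) :
    ∃ k : ℕ, ∀ t₀ : ℝ, 0 < t₀ → ∃ M, ∀ t, t₀ ≤ t → ∀ y, 0 ≤ y →
      |∫ z, heatScale ((n : ℝ) / 2 + k) (laplacianProfile n k) t z * W z y| ≤ M := by
  have hT : ∀ y : Ici (0 : ℝ), ∃ T : 𝓢(EuclideanSpace ℝ (Fin n), ℝ) →L[ℝ] ℝ,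
      ∀ φ, T φ = ∫ z, φ z * W z y := fun y => by
    obtain ⟨N, C, hC⟩ := hv.tempered y
    exact exists_clm_integral_mul (hC y ⟨y.2, le_rfl⟩).1 (hW.continuous_slice y.2)
  choose T hT using hT
  obtain ⟨S, C, hC0, hC⟩ := SchwartzMap.exists_seminorm_bound_of_pointwise_bounded T fun φ => by
    obtain ⟨C, hC⟩ := hv.exists_bound φ
    exact ⟨C, fun y => by rw [hT]; exact hC y y.2⟩
  -- The sum dominates each weight `p.1`, so every exponent `-(n/2 + k) + (p.1 - p.2)/2` is
  -- nonpositive and its power of `t` is largest at `t₀`.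
  let k : ℕ := ∑ p ∈ S, p.1
  refine ⟨k, fun t₀ ht₀ => ?_⟩
  refine ⟨C * ∑ p ∈ S, t₀ ^ (-((n : ℝ) / 2 + k) + ((p.1 : ℝ) - p.2) / 2) *
    SchwartzMap.seminorm ℝ p.1 p.2 (laplacianProfile n k), fun t ht y hy => ?_⟩
  obtain ⟨φ, hφ, hφs⟩ := exists_schwartz_eq_heatScale ((n : ℝ) / 2 + k) (laplacianProfile n k)
    (ht₀.trans_le ht)
  have h1 := hC ⟨y, hy⟩ φ
  rw [hT] at h1
  simp only [hφ] at h1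
  refine h1.trans (mul_le_mul_of_nonneg_left (Finset.sum_le_sum fun p hp => (hφs p.1 p.2).trans ?_)
    hC0)
  refine mul_le_mul_of_nonneg_right ?_ (apply_nonneg _ _)
  refine Real.rpow_le_rpow_of_nonpos ht₀ ht ?_
  have h2 : (p.1 : ℝ) ≤ k := by
    exact_mod_cast Finset.single_le_sum (f := fun p : ℕ × ℕ => p.1) (fun _ _ => Nat.zero_le _) hp
  have h3 : (0 : ℝ) ≤ p.2 := Nat.cast_nonneg _
  have h4 : (0 : ℝ) ≤ k := Nat.cast_nonneg _
  have h5 : (0 : ℝ) ≤ n := Nat.cast_nonneg _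
  linarith

theorem hasDerivAt_heatScale_pairing {α : ℝ} {h : 𝓢(EuclideanSpace ℝ (Fin n), ℝ)}
    (hh : IsHeatProfile α h) {w : EuclideanSpace ℝ (Fin n) → ℝ} {N : ℕ}
    (hw : Integrable (fun x => |w x| / (1 + ‖x‖) ^ N)) (hwc : Continuous w) {t : ℝ} (ht : 0 < t) :
    HasDerivAt (fun t => ∫ z, heatScale α h t z * w z)
      (∫ z, heatScale (α + 1) (Δ h) t z * w z) t := by
  obtain ⟨C, hC0, hC⟩ := exists_heatScale_decay (α + 1) (Δ h) N (half_pos ht) (2 * t)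
  obtain ⟨C', hC'0, hC'⟩ := exists_heatScale_decay α h N ht t
  have hFc : ∀ (β : ℝ) (k : 𝓢(EuclideanSpace ℝ (Fin n), ℝ)) (t : ℝ), Continuous (heatScale β k t) :=
    fun β k t => (contDiff_heatScale β k t (k := 0)).continuous
  refine (hasDerivAt_integral_of_dominated_loc_of_deriv_le (s := Icc (t / 2) (2 * t))
    (F' := fun t z => heatScale (α + 1) (Δ h) t z * w z)
    (bound := fun z => C * (|w z| / (1 + ‖z‖) ^ N))
    (Icc_mem_nhds (by linarith) (by linarith)) ?_ ?_ ?_ ?_ (hw.const_mul C) ?_).2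
  · exact Eventually.of_forall fun x => ((hFc α h x).mul hwc).aestronglyMeasurable
  · exact integrable_mul_of_weighted hw hwc (hFc α h t) (hC' t ⟨le_rfl, le_rfl⟩)
  · exact ((hFc _ _ t).mul hwc).aestronglyMeasurable
  · refine Eventually.of_forall fun z x hx => ?_
    have h0 : 0 < (1 + ‖z‖) ^ N := by positivity
    rw [norm_mul, Real.norm_eq_abs, Real.norm_eq_abs, mul_div_assoc', le_div_iff₀ h0,
      mul_right_comm]
    exact mul_le_mul_of_nonneg_right (hC x hx z) (abs_nonneg _)
  · exact Eventually.of_forall fun z x hx =>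
      (hasDerivAt_heatScale hh (lt_of_lt_of_le (half_pos ht) hx.1) z).mul_const _

/-- By the heat equation the `t`-derivative of the pairing is the pairing with `Δ h`, which is zero.
So the pairing does not depend on `t`; the bound for one fixed Schwartz function then holds for all
`t`, and the Liouville theorem applies. -/
theorem heatScale_pairing_eq_zero_of_laplacian (hs0 : 0 < s) (hs1 : s < 1)
    (hW : IsExtensionSolution s (fun _ => 0) W) (hv : WeaklyVanishes W) {α : ℝ}
    {h : 𝓢(EuclideanSpace ℝ (Fin n), ℝ)} (hh : IsHeatProfile α h)
    (hΔ : ∀ t, 0 < t → ∀ y, 0 ≤ y → ∫ z, heatScale (α + 1) (Δ h) t z * W z y = 0)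
    {t y : ℝ} (ht : 0 < t) (hy : 0 ≤ y) : ∫ z, heatScale α h t z * W z y = 0 := by
  have hconst : ∀ t', 0 < t' → ∀ y, 0 ≤ y →
      ∫ z, heatScale α h t' z * W z y = ∫ z, heatScale α h t z * W z y := by
    intro t' ht' y hy
    obtain ⟨N, C, hC⟩ := hv.tempered y
    have h1 := (convex_Ioi (0 : ℝ)).norm_image_sub_le_of_norm_hasDerivWithin_le
      (f := fun t => ∫ z, heatScale α h t z * W z y) (f' := fun _ => 0) (C := 0)
      (fun x hx => by
        have := hasDerivAt_heatScale_pairing hh (hC y ⟨hy, le_rfl⟩).1 (hW.continuous_slice hy) hx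
        rw [hΔ x hx y hy] at this
        exact this.hasDerivWithinAt) (fun x _ => by simp) ht ht'
    rw [zero_mul, norm_le_zero_iff, sub_eq_zero] at h1
    exact h1
  obtain ⟨φ, hφ, -⟩ := exists_schwartz_eq_heatScale α h ht
  obtain ⟨M, hM⟩ := hv.exists_bound φ
  simp only [hφ] at hM
  exact heatScale_pairing_eq_zero_of_bounded hs0 hs1 hW hv.tempered hh ht
    (fun t' ht' y hy => by rw [hconst t' (ht.trans_le ht') y hy]; exact hM y hy) hy

/-- The Liouville theorem starts at a large number of Laplacians, where the pairing is bounded; the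
Laplacians are then removed one by one. -/
theorem gaussian_pairing_eq_zero (hs0 : 0 < s) (hs1 : s < 1)
    (hW : IsExtensionSolution s (fun _ => 0) W) (hv : WeaklyVanishes W)
    {t y : ℝ} (ht : 0 < t) (hy : 0 ≤ y) :
    ∫ z, heatScale ((n : ℝ) / 2) gaussianProfile t z * W z y = 0 := by
  obtain ⟨k, hk⟩ := exists_laplacianProfile_pairing_bounded hW hv
  have hk0 : ∀ t, 0 < t → ∀ y, 0 ≤ y →
      ∫ z, heatScale ((n : ℝ) / 2 + k) (laplacianProfile n k) t z * W z y = 0 := by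
    intro t ht y hy
    obtain ⟨M, hM⟩ := hk t ht
    exact heatScale_pairing_eq_zero_of_bounded hs0 hs1 hW hv.tempered
      (isHeatProfile_laplacianProfile k) ht hM hy
  have hdesc : ∀ j : ℕ, (∀ t, 0 < t → ∀ y, 0 ≤ y →
      ∫ z, heatScale ((n : ℝ) / 2 + j) (laplacianProfile n j) t z * W z y = 0) →
      ∀ t, 0 < t → ∀ y, 0 ≤ y →
      ∫ z, heatScale ((n : ℝ) / 2 + (0 : ℕ)) (laplacianProfile n 0) t z * W z y = 0 := by
    intro j
    induction j with
    | zero => exact id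
    | succ j ih =>
      intro h
      refine ih fun t ht y hy => heatScale_pairing_eq_zero_of_laplacian hs0 hs1 hW hv
        (isHeatProfile_laplacianProfile j) (fun t ht y hy => ?_) ht hy
      rw [← laplacianProfile_succ, add_assoc, ← Nat.cast_succ]
      exact h t ht y hy
  have := hdesc k hk0 t ht y hy
  rwa [Nat.cast_zero, add_zero] at this

end

end Uniqueness

end FractionalExtension

/-! ### From Gaussian pairings to uniqueness -/

namespace FractionalExtension

section Uniqueness

variable {n : ℕ} {s : ℝ} {W : EuclideanSpace ℝ (Fin n) → ℝ → ℝ}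

theorem tendsto_norm_pow_mul_cobounded {E : Type*} [NormedAddCommGroup E] [NormedSpace ℝ E]
    (φ : 𝓢(E, ℝ)) (m : ℕ) :
    Tendsto (fun x => ‖x‖ ^ m * φ x) (Bornology.cobounded E) (𝓝 0) := by
  obtain ⟨C, hC⟩ := φ.decay (m + 1) 0
  have h1 : Tendsto (fun x : E => C * ‖x‖⁻¹) (Bornology.cobounded E) (𝓝 (C * 0)) :=
    (tendsto_inv_atTop_zero.comp tendsto_norm_cobounded_atTop).const_mul C
  rw [mul_zero] at h1
  refine squeeze_zero_norm' ?_ h1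
  filter_upwards [tendsto_norm_cobounded_atTop.eventually_gt_atTop 0] with x hx
  have h2 := hC.2 x
  rw [norm_iteratedFDeriv_zero, pow_succ] at h2
  rw [norm_mul, norm_pow, norm_norm, ← div_eq_mul_inv, le_div_iff₀ hx, mul_right_comm]
  exact h2

/-- The approximate identity requires an integrable function, and `w` is only tempered, so it is
applied to `G w` with `G` the Gaussian. As `G(cz) G(z) = G(√(c² + 1) z)`, the integrals met are
again Gaussian pairings of `w`, at `t = 1/(c² + 1)`. They vanish, so `G(0) w(0) = 0`. -/
theorem eq_zero_of_gaussian_pairing {w : EuclideanSpace ℝ (Fin n) → ℝ} {N : ℕ}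
    (hw : Integrable (fun x => |w x| / (1 + ‖x‖) ^ N)) (hwc : Continuous w)
    (h0 : ∀ t, 0 < t → ∫ z, heatScale ((n : ℝ) / 2) gaussianProfile t z * w z = 0) : w 0 = 0 := by
  let G : 𝓢(EuclideanSpace ℝ (Fin n), ℝ) := gaussianProfile
  have hG0 : ∀ x, 0 < G x := fun x => Real.exp_pos _
  have hI : 0 < ∫ x, G x := by
    refine (integral_pos_iff_support_of_nonneg (fun x => (hG0 x).le) G.integrable).2 ?_
    rw [show Function.support (G : EuclideanSpace ℝ (Fin n) → ℝ) = univ from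
      eq_univ_of_forall fun x => (hG0 x).ne']
    exact Measure.measure_univ_pos.2 (NeZero.ne volume)
  set I := ∫ x, G x
  let g : EuclideanSpace ℝ (Fin n) → ℝ := fun z => G z * w z
  have hg : Integrable g :=
    integrable_mul_of_weighted hw hwc G.continuous (exists_weighted_bound G N)
  have hdecay : Tendsto (fun x => ‖x‖ ^ Module.finrank ℝ (EuclideanSpace ℝ (Fin n)) *
      (I⁻¹ * G x)) (Bornology.cobounded _) (𝓝 0) := by
    have h1 := (tendsto_norm_pow_mul_cobounded G
      (Module.finrank ℝ (EuclideanSpace ℝ (Fin n)))).const_mul I⁻¹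
    rw [mul_zero] at h1
    exact h1.congr fun x => mul_left_comm _ _ _
  have hlim := tendsto_integral_comp_smul_smul_of_integrable (μ := volume)
    (φ := fun x => I⁻¹ * G x) (fun x => mul_nonneg (by positivity) (hG0 x).le)
    (by rw [integral_const_mul]; exact inv_mul_cancel₀ hI.ne') hdecay hg
    (G.continuous.mul hwc).continuousAt
  have hzero : ∀ c : ℝ, 0 < c → ∫ x, (c ^ Module.finrank ℝ (EuclideanSpace ℝ (Fin n)) *
      (I⁻¹ * G (c • x))) • g x = 0 := by
    intro c hc
    have ht : 0 < (c ^ 2 + 1)⁻¹ := by positivity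
    have h1 : ∀ x, (c ^ Module.finrank ℝ (EuclideanSpace ℝ (Fin n)) *
        (I⁻¹ * G (c • x))) • g x = (c ^ Module.finrank ℝ (EuclideanSpace ℝ (Fin n)) * I⁻¹ *
        ((c ^ 2 + 1)⁻¹ ^ (-((n : ℝ) / 2)))⁻¹) *
        (heatScale ((n : ℝ) / 2) gaussianProfile (c ^ 2 + 1)⁻¹ x * w x) := by
      intro x
      have h2 : G (c • x) * G x = G ((√(c ^ 2 + 1)⁻¹)⁻¹ • x) := by
        change Real.exp _ * Real.exp _ = Real.exp _
        rw [← Real.exp_add, norm_smul, norm_smul, mul_pow, mul_pow, norm_inv, inv_pow,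
          Real.norm_of_nonneg (Real.sqrt_nonneg _), Real.sq_sqrt ht.le, inv_inv, Real.norm_eq_abs,
          sq_abs]
        congr 1
        ring
      have h3 : (c ^ 2 + 1)⁻¹ ^ (-((n : ℝ) / 2)) ≠ 0 := (Real.rpow_pos_of_pos ht _).ne'
      have h4 : heatScale ((n : ℝ) / 2) gaussianProfile (c ^ 2 + 1)⁻¹ x =
        (c ^ 2 + 1)⁻¹ ^ (-((n : ℝ) / 2)) * (G (c • x) * G x) := by rw [h2]; rfl
      rw [h4, smul_eq_mul]
      simp only [g]
      field_simp
    simp only [h1]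
    rw [integral_const_mul, h0 _ ht, mul_zero]
  have hlim0 := tendsto_nhds_unique hlim ((tendsto_congr' (by
    filter_upwards [eventually_gt_atTop 0] with c hc using hzero c hc)).2 tendsto_const_nhds)
  exact (mul_eq_zero.1 hlim0).resolve_left (hG0 0).ne'

theorem IsExtensionSolution.sub {u u' : EuclideanSpace ℝ (Fin n) → ℝ}
    {U V : EuclideanSpace ℝ (Fin n) → ℝ → ℝ} (hU : IsExtensionSolution s u U)
    (hV : IsExtensionSolution s u' V) :
    IsExtensionSolution s (fun x => u x - u' x) (fun x y => U x y - V x y) where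
  contDiffOn := hU.contDiffOn.sub hV.contDiffOn
  continuousOn := hU.continuousOn.sub hV.continuousOn
  boundary x := by rw [hU.boundary, hV.boundary]
  equation x y hy := by
    obtain ⟨U1, U2, hU1, hU2, -, -, hUs, hUe⟩ := hU.exists_partial_derivs
    obtain ⟨V1, V2, hV1, hV2, -, -, hVs, hVe⟩ := hV.exists_partial_derivs
    have h1 : deriv (fun y => U x y - V x y) =ᶠ[𝓝 y] fun y => U1 x y - V1 x y := by
      filter_upwards [lt_mem_nhds hy] with r hr
      exact ((hU1 x r hr).sub (hV1 x r hr)).deriv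
    rw [h1.deriv_eq, h1.eq_of_nhds, ((hU2 x y hy).fun_sub (hV2 x y hy)).deriv]
    have h2 : Laplacian.laplacian (fun x' => U x' y - V x' y) x =
        Laplacian.laplacian (fun x' => U x' y) x - Laplacian.laplacian (fun x' => V x' y) x :=
      (hUs y hy).contDiffAt.laplacian_sub (hVs y hy).contDiffAt
    rw [h2]
    linear_combination hUe x y hy - hVe x y hy

theorem laplacian_comp_add_right {E F : Type*} [NormedAddCommGroup E] [InnerProductSpace ℝ E]
    [FiniteDimensional ℝ E] [NormedAddCommGroup F] [NormedSpace ℝ F] (f : E → F) (a x : E) :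
    Laplacian.laplacian (fun z => f (z + a)) x = Laplacian.laplacian f (x + a) := by
  rw [InnerProductSpace.laplacian_eq_iteratedFDeriv_stdOrthonormalBasis,
    InnerProductSpace.laplacian_eq_iteratedFDeriv_stdOrthonormalBasis]
  simp only [iteratedFDeriv_comp_add_right]

theorem IsExtensionSolution.comp_add_right {u : EuclideanSpace ℝ (Fin n) → ℝ}
    (hW : IsExtensionSolution s u W) (a : EuclideanSpace ℝ (Fin n)) :
    IsExtensionSolution s (fun x => u (x + a)) (fun x y => W (x + a) y) where
  contDiffOn := hW.contDiffOn.comp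
    (f := fun p : EuclideanSpace ℝ (Fin n) × ℝ => (p.1 + a, p.2)) (by fun_prop)
    fun p hp => ⟨mem_univ _, hp.2⟩
  continuousOn := hW.continuousOn.comp
    (f := fun p : EuclideanSpace ℝ (Fin n) × ℝ => (p.1 + a, p.2)) (by fun_prop)
    fun p hp => ⟨mem_univ _, hp.2⟩
  equation x y hy := by
    rw [laplacian_comp_add_right (fun z => W z y)]
    exact hW.equation (x + a) y hy
  boundary x := hW.boundary (x + a)

theorem IsLocallyTempered.sub {U V : EuclideanSpace ℝ (Fin n) → ℝ → ℝ}
    (hU : IsLocallyTempered U) (hV : IsLocallyTempered V)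
    (hUc : ∀ y, 0 ≤ y → Continuous fun x => U x y) (hVc : ∀ y, 0 ≤ y → Continuous fun x => V x y) :
    IsLocallyTempered fun x y => U x y - V x y := by
  intro Y
  obtain ⟨N, C, hC⟩ := hU Y
  obtain ⟨N', C', hC'⟩ := hV Y
  refine ⟨N + N', C + C', fun y hy => ?_⟩
  obtain ⟨h1, h1'⟩ := hC y hy
  obtain ⟨h2, h2'⟩ := hC' y hy
  have hle : ∀ x, |U x y - V x y| / (1 + ‖x‖) ^ (N + N') ≤
      |U x y| / (1 + ‖x‖) ^ N + |V x y| / (1 + ‖x‖) ^ N' := by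
    intro x
    have hx : 1 ≤ 1 + ‖x‖ := by linarith [norm_nonneg x]
    calc |U x y - V x y| / (1 + ‖x‖) ^ (N + N')
        ≤ (|U x y| + |V x y|) / (1 + ‖x‖) ^ (N + N') := by gcongr; exact abs_sub _ _
      _ = |U x y| / (1 + ‖x‖) ^ (N + N') + |V x y| / (1 + ‖x‖) ^ (N + N') := add_div _ _ _
      _ ≤ _ := by
        gcongr <;> first | exact hx | omega
  have hI : Integrable fun x => |U x y - V x y| / (1 + ‖x‖) ^ (N + N') := by
    refine (h1.add h2).mono' ?_ (Eventually.of_forall fun x => ?_)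
    · refine Continuous.aestronglyMeasurable (Continuous.div₀
        ((hUc y hy.1).sub (hVc y hy.1)).abs (by fun_prop) fun x => ?_)
      positivity
    · rw [Real.norm_of_nonneg (by positivity)]
      exact hle x
  refine ⟨hI, (integral_mono hI (h1.add h2) hle).trans ?_⟩
  exact (integral_add h1 h2).trans_le (add_le_add h1' h2')

theorem WeaklyVanishes.sub {U V : EuclideanSpace ℝ (Fin n) → ℝ → ℝ}
    (hU : WeaklyVanishes U) (hV : WeaklyVanishes V)
    (hUc : ∀ y, 0 ≤ y → Continuous fun x => U x y) (hVc : ∀ y, 0 ≤ y → Continuous fun x => V x y) :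
    WeaklyVanishes fun x y => U x y - V x y where
  tempered := hU.tempered.sub hV.tempered hUc hVc
  tendsto φ := by
    have h1 := (hU.tendsto φ).sub (hV.tendsto φ)
    rw [sub_zero] at h1
    refine h1.congr' ?_
    filter_upwards [eventually_ge_atTop 0] with y hy
    obtain ⟨N, C, hC⟩ := hU.tempered y
    obtain ⟨N', C', hC'⟩ := hV.tempered y
    have h2 : Integrable fun z => φ z * U z y := integrable_mul_of_weighted (hC y ⟨hy, le_rfl⟩).1
      (hUc y hy) φ.continuous (exists_weighted_bound φ N)
    have h3 : Integrable fun z => φ z * V z y := integrable_mul_of_weighted (hC' y ⟨hy, le_rfl⟩).1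
      (hVc y hy) φ.continuous (exists_weighted_bound φ N')
    simp only [mul_comm (φ _)] at h2 h3
    rw [← integral_sub h2 h3]
    simp only [sub_mul]

theorem WeaklyVanishes.comp_add_right (hW : WeaklyVanishes W) (a : EuclideanSpace ℝ (Fin n))
    (hc : ∀ y, 0 ≤ y → Continuous fun x => W x y) :
    WeaklyVanishes fun x y => W (x + a) y where
  tempered Y := by
    obtain ⟨N, C, hC⟩ := hW.tempered Y
    refine ⟨N, (1 + ‖a‖) ^ N * C, fun y hy => ?_⟩
    obtain ⟨h1, h1'⟩ := hC y hy
    have h2 := (h1.comp_add_right a).const_mul ((1 + ‖a‖) ^ N)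
    have hle : ∀ x, |W (x + a) y| / (1 + ‖x‖) ^ N ≤
        (1 + ‖a‖) ^ N * (|W (x + a) y| / (1 + ‖x + a‖) ^ N) := by
      intro x
      rw [mul_div_assoc', div_le_div_iff₀ (by positivity) (by positivity), mul_right_comm,
        mul_comm ((1 + ‖a‖) ^ N * _), ← mul_pow]
      gcongr
      nlinarith [norm_add_le x a, norm_nonneg x, norm_nonneg a,
        mul_nonneg (norm_nonneg x) (norm_nonneg a)]
    have hI : Integrable fun x => |W (x + a) y| / (1 + ‖x‖) ^ N := by
      refine h2.mono' ?_ (Eventually.of_forall fun x => ?_)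
      · refine Continuous.aestronglyMeasurable (Continuous.div₀
          ((hc y hy.1).comp (continuous_add_const a)).abs (by fun_prop) fun x => ?_)
        positivity
      · rw [Real.norm_of_nonneg (by positivity)]
        exact hle x
    refine ⟨hI, (integral_mono hI h2 hle).trans ?_⟩
    rw [integral_const_mul, integral_add_right_eq_self (fun x => |W x y| / (1 + ‖x‖) ^ N)]
    gcongr
  tendsto φ := by
    refine (hW.tendsto (SchwartzMap.compSubConstCLM ℝ a φ)).congr fun y => ?_
    rw [← integral_add_right_eq_self _ a]
    simp

/-- A weakly vanishing solution of the extension problem with zero boundary values is zero. -/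
theorem IsExtensionSolution.eq_zero (hs0 : 0 < s) (hs1 : s < 1)
    (hW : IsExtensionSolution s (fun _ => 0) W) (hv : WeaklyVanishes W)
    (x : EuclideanSpace ℝ (Fin n)) {y : ℝ} (hy : 0 ≤ y) : W x y = 0 := by
  -- The Gaussians are centred at the origin and detect the value there only; translation by `x`
  -- brings every point to the origin.
  have h1 := hW.comp_add_right x
  have h2 := hv.comp_add_right x fun y hy => hW.continuous_slice hy
  obtain ⟨N, C, hC⟩ := h2.tempered y
  have h3 := eq_zero_of_gaussian_pairing (hC y ⟨hy, le_rfl⟩).1 (h1.continuous_slice hy)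
    fun t ht => gaussian_pairing_eq_zero hs0 hs1 h1 h2 ht hy
  simpa using h3

/-- Uniqueness for the extension problem. -/
theorem IsExtensionSolution.unique (hs0 : 0 < s) (hs1 : s < 1)
    {u : EuclideanSpace ℝ (Fin n) → ℝ} {U V : EuclideanSpace ℝ (Fin n) → ℝ → ℝ}
    (hU : IsExtensionSolution s u U) (hUv : WeaklyVanishes U) (hV : IsExtensionSolution s u V)
    (hVv : WeaklyVanishes V) (x : EuclideanSpace ℝ (Fin n)) {y : ℝ} (hy : 0 ≤ y) :
    V x y = U x y := by
  have h1 := hV.sub hU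
  simp only [sub_self] at h1
  exact sub_eq_zero.1 (h1.eq_zero hs0 hs1 (hVv.sub hUv (fun y hy => hV.continuous_slice hy)
    fun y hy => hU.continuous_slice hy) x hy)

end Uniqueness

end FractionalExtension

/-! ### The heat semigroup on the Fourier side -/

namespace FractionalExtension

variable {n : ℕ}

/-- The heat flow on the Fourier side: the inverse Fourier transform of
`exp (-t (2π|ξ|)²) g(ξ)`. -/
noncomputable def heatFlow (g : EuclideanSpace ℝ (Fin n) → ℂ) (t : ℝ)
    (x : EuclideanSpace ℝ (Fin n)) : ℂ :=
  𝓕⁻ (fun ξ => ((Real.exp (-(t * (2 * Real.pi * ‖ξ‖) ^ 2)) : ℝ) : ℂ) * g ξ) x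

theorem integrable_heatKernel {t : ℝ} (ht : 0 < t) :
    Integrable (heatKernel t : EuclideanSpace ℝ (Fin n) → ℝ) := by
  unfold heatKernel
  refine Integrable.const_mul ?_ _
  have h := GaussianFourier.integrable_cexp_neg_mul_sq_norm_add (V := EuclideanSpace ℝ (Fin n))
    (b := ((1 / (4 * t) : ℝ) : ℂ)) (by rw [Complex.ofReal_re]; positivity) 0 0
  refine h.norm.congr (Eventually.of_forall fun v => ?_)
  simp only [zero_mul, add_zero, Complex.norm_exp]
  congr 1
  rw [← Complex.ofReal_pow, ← Complex.ofReal_neg, ← Complex.ofReal_mul, Complex.ofReal_re]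
  ring

/-- The heat kernel is the Fourier transform of a modulated Gaussian. -/
theorem ofReal_heatKernel_eq_fourier {t : ℝ} (ht : 0 < t) (x w : EuclideanSpace ℝ (Fin n)) :
    ((heatKernel t (x - w) : ℝ) : ℂ) =
      𝓕 (fun v : EuclideanSpace ℝ (Fin n) => Complex.exp (-((4 * Real.pi ^ 2 * t : ℝ) : ℂ) *
        ‖v‖ ^ 2 + 2 * Real.pi * Complex.I * (⟪x, v⟫_ℝ : ℝ))) w := by
  rw [fourier_gaussian_innerProductSpace' (by rw [Complex.ofReal_re]; positivity)]
  have hpi := Real.pi_pos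
  have h1 : (Real.pi : ℂ) / ((4 * Real.pi ^ 2 * t : ℝ) : ℂ) =
      (((4 * Real.pi * t)⁻¹ : ℝ) : ℂ) := by
    rw [← Complex.ofReal_div]; congr 1; field_simp
  rw [h1, finrank_euclideanSpace_fin]
  have h2 : ((n : ℂ) / 2) = (((n : ℝ) / 2 : ℝ) : ℂ) := by push_cast; rfl
  rw [h2, ← Complex.ofReal_cpow (by positivity)]
  have h3 : -(Real.pi : ℂ) ^ 2 * (‖x - w‖ : ℂ) ^ 2 / ((4 * Real.pi ^ 2 * t : ℝ) : ℂ) =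
      ((-(‖x - w‖ ^ 2 / (4 * t)) : ℝ) : ℂ) := by
    rw [← Complex.ofReal_pow, ← Complex.ofReal_pow, ← Complex.ofReal_neg, ← Complex.ofReal_mul,
      ← Complex.ofReal_div]
    congr 1; field_simp
  rw [h3, ← Complex.ofReal_exp, ← Complex.ofReal_mul]
  congr 1
  rw [heatKernel, Real.inv_rpow (by positivity), one_div]

/-- The heat semigroup acts on an inverse Fourier transform as multiplication of the symbol. -/
theorem ofReal_heatSemigroup {g : EuclideanSpace ℝ (Fin n) → ℂ} (hg : Integrable g)
    {f : EuclideanSpace ℝ (Fin n) → ℝ} (hf : ∀ x, (f x : ℂ) = 𝓕⁻ g x) {t : ℝ} (ht : 0 < t)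
    (x : EuclideanSpace ℝ (Fin n)) :
    ((heatSemigroup t f x : ℝ) : ℂ) = heatFlow g t x := by
  have hb : 0 < (((4 * Real.pi ^ 2 * t : ℝ) : ℂ)).re := by
    rw [Complex.ofReal_re]; have := Real.pi_pos; positivity
  have hK : Integrable (fun w : EuclideanSpace ℝ (Fin n) => ((heatKernel t (x - w) : ℝ) : ℂ)) :=
    ((integrable_heatKernel ht).comp_sub_left x).ofReal
  have hJ := GaussianFourier.integrable_cexp_neg_mul_sq_norm_add hb (2 * Real.pi * Complex.I) x
  have hKJ : (fun w : EuclideanSpace ℝ (Fin n) => ((heatKernel t (x - w) : ℝ) : ℂ)) =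
      𝓕 (fun v : EuclideanSpace ℝ (Fin n) => Complex.exp (-((4 * Real.pi ^ 2 * t : ℝ) : ℂ) *
        ‖v‖ ^ 2 + 2 * Real.pi * Complex.I * (⟪x, v⟫_ℝ : ℝ))) :=
    funext (ofReal_heatKernel_eq_fourier ht x)
  -- Kernel and modulated Gaussian are both integrable and the latter is continuous, so Fourier
  -- inversion applies.
  have hinv : 𝓕⁻ (fun w : EuclideanSpace ℝ (Fin n) => ((heatKernel t (x - w) : ℝ) : ℂ)) =
      fun v : EuclideanSpace ℝ (Fin n) => Complex.exp (-((4 * Real.pi ^ 2 * t : ℝ) : ℂ) *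
        ‖v‖ ^ 2 + 2 * Real.pi * Complex.I * (⟪x, v⟫_ℝ : ℝ)) := by
    rw [hKJ]
    refine Continuous.fourierInv_fourier_eq (by fun_prop) hJ ?_
    rw [← hKJ]; exact hK
  -- The inverse transform is the Fourier integral of the bilinear form `-⟪·, ·⟫`, which is its own
  -- flip; hence it moves from `g` to the kernel.
  have hflip : ∫ w, (𝓕⁻ g w) • ((heatKernel t (x - w) : ℝ) : ℂ) =
      ∫ ξ, g ξ • 𝓕⁻ (fun w : EuclideanSpace ℝ (Fin n) => ((heatKernel t (x - w) : ℝ) : ℂ)) ξ := by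
    have := VectorFourier.integral_fourierIntegral_smul_eq_flip
      (L := -innerₗ (EuclideanSpace ℝ (Fin n))) (μ := volume) (ν := volume)
      Real.continuous_fourierChar (by simpa using! continuous_inner.neg) hg hK
    rw [show (-innerₗ (EuclideanSpace ℝ (Fin n))).flip = -innerₗ (EuclideanSpace ℝ (Fin n)) by
      ext a b; simp [real_inner_comm]] at this
    exact this
  unfold heatSemigroup heatFlow
  rw [← integral_complex_ofReal]
  have h1 : ∀ w, ((heatKernel t (x - w) * f w : ℝ) : ℂ) =
      (𝓕⁻ g w) • ((heatKernel t (x - w) : ℝ) : ℂ) := by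
    intro w; rw [Complex.ofReal_mul, hf, smul_eq_mul, mul_comm]
  simp_rw [h1]
  rw [hflip, hinv, Real.fourierInv_eq']
  congr 1; ext ξ
  simp only [smul_eq_mul]
  rw [Complex.exp_add, real_inner_comm x ξ, Complex.ofReal_exp]
  have e1 : -((4 * Real.pi ^ 2 * t : ℝ) : ℂ) * (‖ξ‖ : ℂ) ^ 2 =
      ((-(t * (2 * Real.pi * ‖ξ‖) ^ 2) : ℝ) : ℂ) := by push_cast; ring
  have e2 : 2 * (Real.pi : ℂ) * Complex.I * ((⟪x, ξ⟫_ℝ : ℝ) : ℂ) =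
      ((2 * Real.pi * ⟪x, ξ⟫_ℝ : ℝ) : ℂ) * Complex.I := by push_cast; ring
  rw [e1, e2]; ring

theorem norm_heatMultiplier_le {t : ℝ} (ht : 0 ≤ t) (r : ℝ) :
    ‖((Real.exp (-(t * r ^ 2)) : ℝ) : ℂ)‖ ≤ 1 := by
  rw [Complex.norm_real, Real.norm_eq_abs, abs_of_pos (Real.exp_pos _), Real.exp_le_one_iff]
  have := mul_nonneg ht (sq_nonneg r)
  linarith

theorem heatFlow_eq_integral (g : EuclideanSpace ℝ (Fin n) → ℂ) (t : ℝ)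
    (x : EuclideanSpace ℝ (Fin n)) :
    heatFlow g t x = ∫ ξ, Complex.exp (((2 * Real.pi * ⟪ξ, x⟫_ℝ : ℝ) : ℂ) * Complex.I) *
      (((Real.exp (-(t * (2 * Real.pi * ‖ξ‖) ^ 2)) : ℝ) : ℂ) * g ξ) := by
  rw [heatFlow, Real.fourierInv_eq']; rfl

theorem norm_heatFlow_integrand_le (g : EuclideanSpace ℝ (Fin n) → ℂ) {t : ℝ} (ht : 0 ≤ t)
    (x ξ : EuclideanSpace ℝ (Fin n)) :
    ‖Complex.exp (((2 * Real.pi * ⟪ξ, x⟫_ℝ : ℝ) : ℂ) * Complex.I) *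
      (((Real.exp (-(t * (2 * Real.pi * ‖ξ‖) ^ 2)) : ℝ) : ℂ) * g ξ)‖ ≤ ‖g ξ‖ := by
  rw [norm_mul, Complex.norm_exp_ofReal_mul_I, one_mul, norm_mul]
  exact mul_le_of_le_one_left (norm_nonneg _) (norm_heatMultiplier_le ht _)

theorem norm_heatFlow_le {g : EuclideanSpace ℝ (Fin n) → ℂ} (hg : Integrable g) {t : ℝ}
    (ht : 0 ≤ t) (x : EuclideanSpace ℝ (Fin n)) : ‖heatFlow g t x‖ ≤ ∫ ξ, ‖g ξ‖ := by
  rw [heatFlow_eq_integral]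
  exact norm_integral_le_of_norm_le hg.norm
    (Eventually.of_forall fun ξ => norm_heatFlow_integrand_le g ht x ξ)

theorem heatFlow_zero (g : EuclideanSpace ℝ (Fin n) → ℂ) (x : EuclideanSpace ℝ (Fin n)) :
    heatFlow g 0 x = 𝓕⁻ g x := by
  simp [heatFlow]

/-- The integrand is dominated by `‖g‖` for all `t ≥ 0`. Having `t = 0` included supplies both the
boundary values of the extension and the boundary limits. -/
theorem continuousOn_heatFlow {g : EuclideanSpace ℝ (Fin n) → ℂ} (hg : Integrable g) :
    ContinuousOn (fun p : EuclideanSpace ℝ (Fin n) × ℝ => heatFlow g p.2 p.1)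
      (univ ×ˢ Ici 0) := by
  simp_rw [heatFlow_eq_integral]
  refine continuousOn_of_dominated (bound := fun ξ => ‖g ξ‖) ?_ ?_ hg.norm ?_
  · intro p _
    exact (Continuous.aestronglyMeasurable (by fun_prop)).mul
      ((Continuous.aestronglyMeasurable (by fun_prop)).mul hg.aestronglyMeasurable)
  · intro p hp
    exact Eventually.of_forall fun ξ => norm_heatFlow_integrand_le g hp.2 _ ξ
  · refine Eventually.of_forall fun ξ => Continuous.continuousOn ?_
    fun_prop

/-- Fourier transform of a real Schwartz function. -/
noncomputable def fourierTransform (u : 𝓢(EuclideanSpace ℝ (Fin n), ℝ)) :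
    𝓢(EuclideanSpace ℝ (Fin n), ℂ) :=
  𝓕 (SchwartzMap.postcompCLM Complex.ofRealCLM u)

theorem fourierTransform_apply (u : 𝓢(EuclideanSpace ℝ (Fin n), ℝ)) :
    (fourierTransform u : EuclideanSpace ℝ (Fin n) → ℂ) =
      𝓕 (fun z : EuclideanSpace ℝ (Fin n) => (u z : ℂ)) := rfl

theorem ofReal_eq_fourierInv_fourierTransform (u : 𝓢(EuclideanSpace ℝ (Fin n), ℝ))
    (x : EuclideanSpace ℝ (Fin n)) :
    (u x : ℂ) = 𝓕⁻ (fourierTransform u : EuclideanSpace ℝ (Fin n) → ℂ) x := by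
  have h : 𝓕⁻ (fourierTransform u) = SchwartzMap.postcompCLM Complex.ofRealCLM u :=
    FourierTransform.fourierInv_fourier_eq _
  rw [← SchwartzMap.fourierInv_coe, h]
  rfl

theorem fracLaplacianSymbol_eq (s : ℝ) (u : 𝓢(EuclideanSpace ℝ (Fin n), ℝ))
    (ξ : EuclideanSpace ℝ (Fin n)) :
    fracLaplacianSymbol s u ξ =
      (((2 * Real.pi * ‖ξ‖) ^ (2 * s) : ℝ) : ℂ) * fourierTransform u ξ := by
  rw [fracLaplacianSymbol, fourierTransform_apply]

/-- For `0 < s < 1` and `r ≥ 0` one has `r^{2s} ≤ 1 + r²`, and the Fourier transform of `u` has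
finite moments. -/
theorem integrable_fracLaplacianSymbol {s : ℝ} (hs0 : 0 < s) (hs1 : s < 1)
    (u : 𝓢(EuclideanSpace ℝ (Fin n), ℝ)) :
    Integrable (fracLaplacianSymbol s (u : EuclideanSpace ℝ (Fin n) → ℝ)) := by
  have hbd : Integrable (fun ξ : EuclideanSpace ℝ (Fin n) =>
      ‖fourierTransform u ξ‖ +
        (2 * Real.pi) ^ 2 * (‖ξ‖ ^ 2 * ‖fourierTransform u ξ‖)) :=
    (fourierTransform u).integrable.norm.add
      (((fourierTransform u).integrable_pow_mul volume 2).const_mul _)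
  refine hbd.mono' ?_ (Eventually.of_forall fun ξ => ?_)
  · have : Continuous (fracLaplacianSymbol s (u : EuclideanSpace ℝ (Fin n) → ℝ)) := by
      rw [funext (fracLaplacianSymbol_eq s u)]
      refine Continuous.mul ?_ (fourierTransform u).continuous
      refine Complex.continuous_ofReal.comp ?_
      exact (continuous_const.mul continuous_norm).rpow_const fun _ => Or.inr (by linarith)
    exact this.aestronglyMeasurable
  · rw [fracLaplacianSymbol_eq, norm_mul, Complex.norm_real, Real.norm_eq_abs]
    have hr : 0 ≤ 2 * Real.pi * ‖ξ‖ := by have := Real.pi_pos; positivity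
    rw [abs_of_nonneg (Real.rpow_nonneg hr _)]
    have h1 : (2 * Real.pi * ‖ξ‖) ^ (2 * s) ≤ 1 + (2 * Real.pi * ‖ξ‖) ^ 2 := by
      rcases le_total (2 * Real.pi * ‖ξ‖) 1 with h | h
      · exact (Real.rpow_le_one hr h (by linarith)).trans (by nlinarith [sq_nonneg (2 * Real.pi * ‖ξ‖)])
      · calc (2 * Real.pi * ‖ξ‖) ^ (2 * s) ≤ (2 * Real.pi * ‖ξ‖) ^ (2 : ℝ) :=
              Real.rpow_le_rpow_of_exponent_le h (by linarith)
          _ = (2 * Real.pi * ‖ξ‖) ^ 2 := Real.rpow_two _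
          _ ≤ _ := by linarith
    calc (2 * Real.pi * ‖ξ‖) ^ (2 * s) * ‖fourierTransform u ξ‖
        ≤ (1 + (2 * Real.pi * ‖ξ‖) ^ 2) * ‖fourierTransform u ξ‖ := by gcongr
      _ = _ := by ring

end FractionalExtension

/-! ### The extension as an average of the heat flow -/

namespace FractionalExtension

variable {n : ℕ}

theorem integrableOn_gammaWeight {s : ℝ} (hs0 : 0 < s) :
    IntegrableOn (fun t : ℝ => Real.exp (-t) / t ^ (1 - s)) (Ioi 0) := by
  refine (Real.GammaIntegral_convergent hs0).congr_fun (fun t ht => ?_) measurableSet_Ioi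
  simp only []
  rw [show s - 1 = -(1 - s) by ring, Real.rpow_neg (le_of_lt ht), div_eq_mul_inv]

theorem integral_gammaWeight {s : ℝ} (hs0 : 0 < s) :
    ∫ t in Ioi (0 : ℝ), Real.exp (-t) / t ^ (1 - s) = Real.Gamma s := by
  rw [Real.Gamma_eq_integral hs0]
  refine setIntegral_congr_fun measurableSet_Ioi (fun t ht => ?_)
  rw [show s - 1 = -(1 - s) by ring, Real.rpow_neg (le_of_lt ht), div_eq_mul_inv]

/-- The extension of a Schwartz function, written as an average of its heat flow. -/
noncomputable def extension (s : ℝ) (u : 𝓢(EuclideanSpace ℝ (Fin n), ℝ))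
    (x : EuclideanSpace ℝ (Fin n)) (y : ℝ) : ℝ :=
  1 / Real.Gamma s * ∫ t in Ioi (0 : ℝ),
    Real.exp (-t) / t ^ (1 - s) * (heatFlow (fourierTransform u) (y ^ 2 / (4 * t)) x).re

theorem heatSemigroup_eq_heatFlow_re (u : 𝓢(EuclideanSpace ℝ (Fin n), ℝ)) {t : ℝ} (ht : 0 < t)
    (x : EuclideanSpace ℝ (Fin n)) :
    heatSemigroup t u x = (heatFlow (fourierTransform u) t x).re := by
  rw [← ofReal_heatSemigroup (fourierTransform u).integrable
    (ofReal_eq_fourierInv_fourierTransform u) ht x, Complex.ofReal_re]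

theorem continuousOn_heatFlow_re {g : EuclideanSpace ℝ (Fin n) → ℂ} (hg : Integrable g) :
    ContinuousOn (fun p : EuclideanSpace ℝ (Fin n) × ℝ => (heatFlow g p.2 p.1).re)
      (univ ×ˢ Ici 0) :=
  Complex.continuous_re.comp_continuousOn (continuousOn_heatFlow hg)

theorem abs_heatFlow_re_le {g : EuclideanSpace ℝ (Fin n) → ℂ} (hg : Integrable g) {t : ℝ}
    (ht : 0 ≤ t) (x : EuclideanSpace ℝ (Fin n)) : |(heatFlow g t x).re| ≤ ∫ ξ, ‖g ξ‖ :=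
  (Complex.abs_re_le_norm _).trans (norm_heatFlow_le hg ht x)

theorem continuousOn_extension_integrand {g : EuclideanSpace ℝ (Fin n) → ℂ} (hg : Integrable g)
    (s : ℝ) (x : EuclideanSpace ℝ (Fin n)) (y : ℝ) :
    ContinuousOn (fun t : ℝ => Real.exp (-t) / t ^ (1 - s) *
      (heatFlow g (y ^ 2 / (4 * t)) x).re) (Ioi 0) := by
  refine ContinuousOn.mul (ContinuousOn.div (by fun_prop) ?_ ?_) ?_
  · exact fun t ht => (Real.continuousAt_rpow_const _ _ (Or.inl (ne_of_gt ht))).continuousWithinAt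
  · exact fun t ht => (Real.rpow_pos_of_pos ht _).ne'
  · refine (continuousOn_heatFlow_re hg).comp (f := fun t : ℝ => (x, y ^ 2 / (4 * t))) ?_ ?_
    · refine continuousOn_const.prodMk (continuousOn_const.div (by fun_prop) ?_)
      intro t ht; have : (0 : ℝ) < t := ht; positivity
    · intro t ht; have : (0 : ℝ) < t := ht
      exact ⟨mem_univ _, by simp only [mem_Ici]; positivity⟩

theorem norm_extension_integrand_le {g : EuclideanSpace ℝ (Fin n) → ℂ} (hg : Integrable g)
    (s : ℝ) (x : EuclideanSpace ℝ (Fin n)) (y : ℝ) {t : ℝ} (ht : 0 < t) :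
    ‖Real.exp (-t) / t ^ (1 - s) * (heatFlow g (y ^ 2 / (4 * t)) x).re‖ ≤
      Real.exp (-t) / t ^ (1 - s) * ∫ ξ, ‖g ξ‖ := by
  have h0 : 0 ≤ Real.exp (-t) / t ^ (1 - s) := by positivity
  rw [norm_mul, Real.norm_eq_abs, abs_of_nonneg h0]
  exact mul_le_mul_of_nonneg_left (abs_heatFlow_re_le hg (by positivity) x) h0

theorem integrableOn_extension_integrand {g : EuclideanSpace ℝ (Fin n) → ℂ} (hg : Integrable g)
    {s : ℝ} (hs0 : 0 < s) (x : EuclideanSpace ℝ (Fin n)) (y : ℝ) :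
    IntegrableOn (fun t : ℝ => Real.exp (-t) / t ^ (1 - s) *
      (heatFlow g (y ^ 2 / (4 * t)) x).re) (Ioi 0) := by
  refine Integrable.mono' ((integrableOn_gammaWeight hs0).mul_const (∫ ξ, ‖g ξ‖))
    ((continuousOn_extension_integrand hg s x y).aestronglyMeasurable measurableSet_Ioi) ?_
  filter_upwards [ae_restrict_mem measurableSet_Ioi] with t ht
  exact norm_extension_integrand_le hg s x y ht

theorem abs_extension_le {s : ℝ} (hs0 : 0 < s) (u : 𝓢(EuclideanSpace ℝ (Fin n), ℝ))
    (x : EuclideanSpace ℝ (Fin n)) (y : ℝ) :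
    |extension s u x y| ≤ ∫ ξ, ‖fourierTransform u ξ‖ := by
  have hG := Real.Gamma_pos_of_pos hs0
  have hg := (fourierTransform u).integrable (μ := volume)
  have h : |∫ t in Ioi (0 : ℝ), Real.exp (-t) / t ^ (1 - s) *
      (heatFlow (fourierTransform u) (y ^ 2 / (4 * t)) x).re| ≤
      Real.Gamma s * ∫ ξ, ‖fourierTransform u ξ‖ := by
    rw [← integral_gammaWeight hs0, ← integral_mul_const]
    rw [← Real.norm_eq_abs]
    refine norm_integral_le_of_norm_le ((integrableOn_gammaWeight hs0).mul_const _) ?_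
    filter_upwards [ae_restrict_mem measurableSet_Ioi] with t ht
    exact norm_extension_integrand_le hg s x y ht
  rw [extension, abs_mul, abs_of_pos (by positivity)]
  calc _ ≤ 1 / Real.Gamma s * (Real.Gamma s * ∫ ξ, ‖fourierTransform u ξ‖) := by gcongr
    _ = _ := by field_simp

theorem extension_zero {s : ℝ} (hs0 : 0 < s) (u : 𝓢(EuclideanSpace ℝ (Fin n), ℝ))
    (x : EuclideanSpace ℝ (Fin n)) : extension s u x 0 = u x := by
  have hG := Real.Gamma_pos_of_pos hs0
  simp only [extension, zero_pow two_ne_zero, zero_div, heatFlow_zero,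
    ← ofReal_eq_fourierInv_fourierTransform, Complex.ofReal_re]
  rw [integral_mul_const, integral_gammaWeight hs0]
  field_simp

/-- The weight is integrable and free of `y`, so domination works across `y = 0`. Only `y²` enters,
which is why continuity holds on all of `ℝⁿ × ℝ`. -/
theorem continuous_extension {s : ℝ} (hs0 : 0 < s) (u : 𝓢(EuclideanSpace ℝ (Fin n), ℝ)) :
    Continuous (Function.uncurry (extension s u)) := by
  have hg := (fourierTransform u).integrable (μ := volume)
  change Continuous fun p : EuclideanSpace ℝ (Fin n) × ℝ => 1 / Real.Gamma s *
    ∫ t in Ioi (0 : ℝ), Real.exp (-t) / t ^ (1 - s) *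
      (heatFlow (fourierTransform u) (p.2 ^ 2 / (4 * t)) p.1).re
  refine continuous_const.mul ?_
  refine continuous_of_dominated
    (bound := fun t => Real.exp (-t) / t ^ (1 - s) * ∫ ξ, ‖fourierTransform u ξ‖) ?_ ?_
    ((integrableOn_gammaWeight hs0).mul_const _) ?_
  · exact fun p => (continuousOn_extension_integrand hg s p.1 p.2).aestronglyMeasurable
      measurableSet_Ioi
  · intro p
    filter_upwards [ae_restrict_mem measurableSet_Ioi] with t ht
    exact norm_extension_integrand_le hg s p.1 p.2 ht
  · filter_upwards [ae_restrict_mem measurableSet_Ioi] with t ht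
    have ht' : (0 : ℝ) < t := ht
    refine continuous_const.mul ?_
    refine (continuousOn_heatFlow_re hg).comp_continuous
      (f := fun p : EuclideanSpace ℝ (Fin n) × ℝ => (p.1, p.2 ^ 2 / (4 * t))) (by fun_prop) ?_
    exact fun p => ⟨mem_univ _, by simp only [mem_Ici]; positivity⟩

theorem isLocallyTempered_extension {s : ℝ} (hs0 : 0 < s)
    (u : 𝓢(EuclideanSpace ℝ (Fin n), ℝ)) : IsLocallyTempered (extension s u) := by
  intro Y
  set M := ∫ ξ, ‖fourierTransform u ξ‖
  have hw : Integrable (fun x : EuclideanSpace ℝ (Fin n) => M / (1 + ‖x‖) ^ (n + 1)) := by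
    have h := integrable_one_add_norm (E := EuclideanSpace ℝ (Fin n)) (μ := volume)
      (r := (n + 1 : ℕ)) (by rw [finrank_euclideanSpace_fin]; push_cast; linarith)
    refine (h.const_mul M).congr (Eventually.of_forall fun x => ?_)
    simp only []
    rw [Real.rpow_neg (by positivity), Real.rpow_natCast, div_eq_mul_inv]
  have hle : ∀ (x : EuclideanSpace ℝ (Fin n)) (y : ℝ),
      |extension s u x y| / (1 + ‖x‖) ^ (n + 1) ≤ M / (1 + ‖x‖) ^ (n + 1) := fun x y => by
    have := abs_extension_le hs0 u x y
    gcongr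
  refine ⟨n + 1, ∫ x : EuclideanSpace ℝ (Fin n), M / (1 + ‖x‖) ^ (n + 1), fun y _ => ?_⟩
  have hi : Integrable (fun x : EuclideanSpace ℝ (Fin n) =>
      |extension s u x y| / (1 + ‖x‖) ^ (n + 1)) := by
    refine hw.mono' ?_ (Eventually.of_forall fun x => ?_)
    · have hc : Continuous fun x => extension s u x y :=
        Continuous.comp (f := fun x => (x, y)) (continuous_extension hs0 u) (by fun_prop)
      refine (Continuous.div hc.abs (by fun_prop) fun x => ?_).aestronglyMeasurable
      positivity
    · rw [Real.norm_eq_abs, abs_of_nonneg (by positivity)]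
      exact hle x y
  exact ⟨hi, integral_mono hi hw fun x => hle x y⟩

/-- The extension as an average of the heat semigroup, with the exponential weight. -/
theorem extension_eq_integral_exp {s : ℝ} (hs0 : 0 < s) (u : 𝓢(EuclideanSpace ℝ (Fin n), ℝ))
    (x : EuclideanSpace ℝ (Fin n)) {y : ℝ} (hy : 0 < y) :
    IntegrableOn (fun t : ℝ => Real.exp (-t) *
      heatSemigroup (y ^ 2 / (4 * t)) u x / t ^ (1 - s)) (Ioi 0) ∧
    extension s u x y = 1 / Real.Gamma s * ∫ t in Ioi (0 : ℝ), Real.exp (-t) *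
      heatSemigroup (y ^ 2 / (4 * t)) u x / t ^ (1 - s) := by
  have h : EqOn (fun t : ℝ => Real.exp (-t) / t ^ (1 - s) *
      (heatFlow (fourierTransform u) (y ^ 2 / (4 * t)) x).re) (fun t : ℝ => Real.exp (-t) *
      heatSemigroup (y ^ 2 / (4 * t)) u x / t ^ (1 - s)) (Ioi 0) := by
    intro t ht
    have : (0 : ℝ) < t := ht
    simp only []
    rw [heatSemigroup_eq_heatFlow_re u (by positivity)]
    ring
  refine ⟨(integrableOn_extension_integrand (fourierTransform u).integrable hs0 x y).congr_fun h
    measurableSet_Ioi, ?_⟩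
  rw [extension, setIntegral_congr_fun measurableSet_Ioi h]

/-- Invariance of Lebesgue measure under `τ = c / t`, integrability. -/
theorem integrableOn_Ioi_comp_const_div_iff (F : ℝ → ℝ) {c : ℝ} (hc : 0 < c) :
    IntegrableOn (fun t => c / t ^ 2 * F (c / t)) (Ioi 0) ↔ IntegrableOn F (Ioi 0) := by
  have h1 := integrableOn_Ioi_comp_rpow_iff (fun t => F (c * t)) (p := -1) (by norm_num)
  have h2 := integrableOn_Ioi_comp_mul_left_iff F 0 hc
  rw [mul_zero] at h2
  rw [← h2, ← h1, IntegrableOn, IntegrableOn, ← integrable_const_mul_iff (IsUnit.mk0 c hc.ne')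
    (fun t : ℝ => (|(-1 : ℝ)| * t ^ ((-1 : ℝ) - 1)) • F (c * t ^ (-1 : ℝ)))]
  refine integrableOn_congr_fun (fun t ht => ?_) measurableSet_Ioi
  have ht' : (0 : ℝ) < t := ht
  simp only [smul_eq_mul]
  rw [show (-1 : ℝ) - 1 = -2 by norm_num, Real.rpow_neg ht'.le, Real.rpow_two, Real.rpow_neg_one]
  simp only [abs_neg, abs_one, div_eq_mul_inv]
  ring

theorem integral_Ioi_comp_const_div (F : ℝ → ℝ) {c : ℝ} (hc : 0 < c) :
    ∫ t in Ioi (0 : ℝ), c / t ^ 2 * F (c / t) = ∫ t in Ioi (0 : ℝ), F t := by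
  have h1 := integral_comp_rpow_Ioi (fun t => F (c * t)) (p := -1) (by norm_num)
  have h2 := integral_comp_mul_left_Ioi' F 0 hc
  rw [mul_zero] at h2
  rw [← h2, ← h1, smul_eq_mul, ← integral_const_mul]
  refine setIntegral_congr_fun measurableSet_Ioi (fun t ht => ?_)
  have ht' : (0 : ℝ) < t := ht
  simp only [smul_eq_mul]
  rw [show (-1 : ℝ) - 1 = -2 by norm_num, Real.rpow_neg ht'.le, Real.rpow_two, Real.rpow_neg_one]
  simp only [abs_neg, abs_one, div_eq_mul_inv]
  ring

/-- The extension as an average of the heat semigroup, with the weight in the space variable. -/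
theorem extension_eq_integral_heatSemigroup {s : ℝ} (hs0 : 0 < s)
    (u : 𝓢(EuclideanSpace ℝ (Fin n), ℝ)) (x : EuclideanSpace ℝ (Fin n)) {y : ℝ} (hy : 0 < y) :
    IntegrableOn (fun t : ℝ => Real.exp (-(y ^ 2 / (4 * t))) *
      heatSemigroup t u x / t ^ (1 + s)) (Ioi 0) ∧
    extension s u x y = y ^ (2 * s) / (4 ^ s * Real.Gamma s) *
      ∫ t in Ioi (0 : ℝ), Real.exp (-(y ^ 2 / (4 * t))) *
        heatSemigroup t u x / t ^ (1 + s) := by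
  obtain ⟨hi, he⟩ := extension_eq_integral_exp hs0 u x hy
  -- The substitution replaces `t` by `(y²/4)/t`, which interchanges `t` with `y²/(4t)`.
  have hc : 0 < y ^ 2 / 4 := by positivity
  rw [← integrableOn_Ioi_comp_const_div_iff _ hc] at hi
  rw [← integral_Ioi_comp_const_div _ hc] at he
  have hpow : (y ^ 2 / 4) ^ s = y ^ (2 * s) / 4 ^ s := by
    rw [Real.div_rpow (by positivity) (by norm_num), ← Real.rpow_two, ← Real.rpow_mul hy.le]
  have h : EqOn (fun t : ℝ => y ^ 2 / 4 / t ^ 2 * (Real.exp (-(y ^ 2 / 4 / t)) *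
      heatSemigroup (y ^ 2 / (4 * (y ^ 2 / 4 / t))) u x / (y ^ 2 / 4 / t) ^ (1 - s)))
      (fun t : ℝ => (y ^ (2 * s) / 4 ^ s) * (Real.exp (-(y ^ 2 / (4 * t))) *
      heatSemigroup t u x / t ^ (1 + s))) (Ioi 0) := by
    intro t ht
    have ht' : (0 : ℝ) < t := ht
    simp only []
    have e1 : y ^ 2 / (4 * (y ^ 2 / 4 / t)) = t := by field_simp
    rw [e1, ← hpow, div_div (y ^ 2) 4 t, ← div_div (y ^ 2) 4 t, Real.div_rpow hc.le ht'.le,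
      Real.rpow_sub hc, Real.rpow_sub ht', Real.rpow_add ht', Real.rpow_one, Real.rpow_one]
    have := (Real.rpow_pos_of_pos hc s).ne'
    have := (Real.rpow_pos_of_pos ht' s).ne'
    field_simp
  have hpos : 0 < y ^ (2 * s) / 4 ^ s := by positivity
  constructor
  · have h1 := hi.congr_fun h measurableSet_Ioi
    exact (integrable_const_mul_iff (IsUnit.mk0 _ hpos.ne') _).1 h1
  · rw [he, setIntegral_congr_fun measurableSet_Ioi h, integral_const_mul]
    have := Real.Gamma_pos_of_pos hs0
    field_simp

end FractionalExtension

/-! ### The Poisson formula and decay in `y` -/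

namespace FractionalExtension

variable {n : ℕ}

theorem inverseGamma_aux {β A : ℝ} (hA : 0 < A) {t : ℝ} (ht : 0 < t) :
    A / t ^ 2 * (Real.exp (-(A / t)) / (A / t) ^ (1 - β)) =
      A ^ β * (Real.exp (-(A / t)) / t ^ (1 + β)) := by
  rw [Real.div_rpow hA.le ht.le, Real.rpow_sub hA, Real.rpow_sub ht, Real.rpow_add ht,
    Real.rpow_one, Real.rpow_one]
  have := (Real.rpow_pos_of_pos hA β).ne'
  have := (Real.rpow_pos_of_pos ht β).ne'
  field_simp

theorem integrableOn_inverseGamma {β A : ℝ} (hβ : 0 < β) (hA : 0 < A) :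
    IntegrableOn (fun t : ℝ => Real.exp (-(A / t)) / t ^ (1 + β)) (Ioi 0) := by
  have h := (integrableOn_Ioi_comp_const_div_iff _ hA).2 (integrableOn_gammaWeight hβ)
  have h1 := h.congr_fun (fun t ht => inverseGamma_aux hA ht) measurableSet_Ioi
  exact (integrable_const_mul_iff (IsUnit.mk0 _ (Real.rpow_pos_of_pos hA β).ne') _).1 h1

/-- The substitution `t ↦ A/t` turns this into the Gamma integral. -/
theorem integral_inverseGamma {β A : ℝ} (hβ : 0 < β) (hA : 0 < A) :
    ∫ t in Ioi (0 : ℝ), Real.exp (-(A / t)) / t ^ (1 + β) = Real.Gamma β / A ^ β := by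
  have h := integral_Ioi_comp_const_div (fun t => Real.exp (-t) / t ^ (1 - β)) hA
  rw [integral_gammaWeight hβ,
    setIntegral_congr_fun measurableSet_Ioi (fun t ht => inverseGamma_aux hA ht),
    integral_const_mul] at h
  have := (Real.rpow_pos_of_pos hA β).ne'
  rw [← h]; field_simp

/-- The Poisson kernel as a superposition of heat kernels, pointwise. -/
theorem heatKernel_weight_eq {s y : ℝ} (x z : EuclideanSpace ℝ (Fin n)) {t : ℝ} (ht : 0 < t) :
    Real.exp (-(y ^ 2 / (4 * t))) / t ^ (1 + s) * heatKernel t (x - z) =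
      (4 * Real.pi) ^ (-((n : ℝ) / 2)) *
        (Real.exp (-((y ^ 2 + ‖x - z‖ ^ 2) / 4 / t)) / t ^ (1 + ((n : ℝ) / 2 + s))) := by
  have hpi := Real.pi_pos
  rw [heatKernel, Real.mul_rpow (by positivity) ht.le, Real.rpow_neg (by positivity),
    show 1 + ((n : ℝ) / 2 + s) = (1 + s) + (n : ℝ) / 2 by ring, Real.rpow_add ht (1 + s),
    show -((y ^ 2 + ‖x - z‖ ^ 2) / 4 / t) = -(y ^ 2 / (4 * t)) + -(‖x - z‖ ^ 2 / (4 * t)) by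
      field_simp; ring, Real.exp_add]
  field_simp

theorem poissonKernel_bounds {β : ℝ} (hβ : 0 < β) (x z : EuclideanSpace ℝ (Fin n)) {y : ℝ}
    (hy : 0 < y) :
    0 ≤ 1 / (y ^ 2 + ‖x - z‖ ^ 2) ^ β ∧
      1 / (y ^ 2 + ‖x - z‖ ^ 2) ^ β ≤ 1 / (y ^ 2) ^ β := by
  have : 0 < y ^ 2 := by positivity
  refine ⟨by positivity, ?_⟩
  gcongr
  nlinarith [sq_nonneg ‖x - z‖]

theorem integrable_poissonKernel_mul {β : ℝ} (hβ : 0 < β) (x : EuclideanSpace ℝ (Fin n)) {y : ℝ}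
    (hy : 0 < y) {f : EuclideanSpace ℝ (Fin n) → ℝ} (hf : Integrable f) :
    Integrable (fun z => 1 / (y ^ 2 + ‖x - z‖ ^ 2) ^ β * f z) := by
  refine hf.bdd_mul (c := 1 / (y ^ 2) ^ β) ?_ (Eventually.of_forall fun z => ?_)
  · refine Continuous.aestronglyMeasurable ?_
    refine continuous_const.div ?_ fun z => ?_
    · exact Continuous.rpow_const (by fun_prop) fun _ => Or.inr hβ.le
    · positivity
  · obtain ⟨h0, h1⟩ := poissonKernel_bounds hβ x z hy
    rwa [Real.norm_eq_abs, abs_of_nonneg h0]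

/-- The extension as a Poisson integral. -/
theorem extension_eq_poisson {s : ℝ} (hs0 : 0 < s)
    (u : 𝓢(EuclideanSpace ℝ (Fin n), ℝ)) (x : EuclideanSpace ℝ (Fin n)) {y : ℝ} (hy : 0 < y) :
    Integrable (fun z => y ^ (2 * s) /
      (y ^ 2 + ‖x - z‖ ^ 2) ^ (((n : ℝ) + 2 * s) / 2) * u z) ∧
    extension s u x y =
      Real.Gamma ((n : ℝ) / 2 + s) / (Real.Gamma s * Real.pi ^ ((n : ℝ) / 2)) *
        ∫ z, y ^ (2 * s) / (y ^ 2 + ‖x - z‖ ^ 2) ^ (((n : ℝ) + 2 * s) / 2) * u z := by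
  have hβ : 0 < (n : ℝ) / 2 + s := by positivity
  have hpi := Real.pi_pos
  have hG := Real.Gamma_pos_of_pos hs0
  have hGβ := Real.Gamma_pos_of_pos hβ
  set β := (n : ℝ) / 2 + s with hβdef
  rw [show ((n : ℝ) + 2 * s) / 2 = β by rw [hβdef]; ring]
  have hA : ∀ z : EuclideanSpace ℝ (Fin n), 0 < (y ^ 2 + ‖x - z‖ ^ 2) / 4 := fun z => by positivity
  have hker : ∀ z : EuclideanSpace ℝ (Fin n), y ^ (2 * s) / (y ^ 2 + ‖x - z‖ ^ 2) ^ β * u z =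
      y ^ (2 * s) * (1 / (y ^ 2 + ‖x - z‖ ^ 2) ^ β * u z) := fun z => by ring
  have hint := integrable_poissonKernel_mul hβ x hy (u.integrable (μ := volume))
  simp_rw [hker]
  refine ⟨hint.const_mul _, ?_⟩
  rw [integral_const_mul, (extension_eq_integral_heatSemigroup hs0 u x hy).2]
  have hinner : ∀ z : EuclideanSpace ℝ (Fin n), ∀ c : ℝ,
      ∫ t in Ioi (0 : ℝ), Real.exp (-(y ^ 2 / (4 * t))) / t ^ (1 + s) * heatKernel t (x - z) * c =
        (4 * Real.pi) ^ (-((n : ℝ) / 2)) * Real.Gamma β * 4 ^ β *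
          (1 / (y ^ 2 + ‖x - z‖ ^ 2) ^ β * c) := by
    intro z c
    rw [integral_mul_const, setIntegral_congr_fun measurableSet_Ioi
      (fun t ht => heatKernel_weight_eq x z ht), integral_const_mul,
      integral_inverseGamma hβ (hA z), Real.div_rpow (by positivity) (by norm_num)]
    field_simp
  have hmeas : Measurable (fun p : ℝ × EuclideanSpace ℝ (Fin n) =>
      Real.exp (-(y ^ 2 / (4 * p.1))) / p.1 ^ (1 + s) * heatKernel p.1 (x - p.2) * u p.2) := by
    have hu : Measurable u := u.continuous.measurable
    unfold heatKernel
    fun_prop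
  -- Tonelli with the `t`-integral inside: the kernel is nonnegative, so its `t`-integral is
  -- explicitly a multiple of the Poisson kernel, which is bounded in `z` and hence integrable
  -- against `|u|`.
  have hprod : Integrable (fun p : ℝ × EuclideanSpace ℝ (Fin n) =>
      Real.exp (-(y ^ 2 / (4 * p.1))) / p.1 ^ (1 + s) * heatKernel p.1 (x - p.2) * u p.2)
      ((volume.restrict (Ioi 0)).prod volume) := by
    rw [integrable_prod_iff' hmeas.aestronglyMeasurable]
    constructor
    · refine Eventually.of_forall fun z => Integrable.mul_const (f := fun t : ℝ =>
        Real.exp (-(y ^ 2 / (4 * t))) / t ^ (1 + s) * heatKernel t (x - z)) ?_ (u z)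
      exact IntegrableOn.congr_fun ((integrableOn_inverseGamma hβ (hA z)).const_mul _)
        (fun t ht => (heatKernel_weight_eq x z ht).symm) measurableSet_Ioi
    · refine ((integrable_poissonKernel_mul hβ x hy (u.integrable (μ := volume)).abs).const_mul
        ((4 * Real.pi) ^ (-((n : ℝ) / 2)) * Real.Gamma β * 4 ^ β)).congr
        (Eventually.of_forall fun z => ?_)
      simp only []
      rw [← hinner]
      refine setIntegral_congr_fun measurableSet_Ioi fun t ht => ?_
      have ht' : (0 : ℝ) < t := ht
      simp only [norm_mul, Real.norm_eq_abs]
      rw [← abs_mul, abs_of_nonneg (a := _ * heatKernel t (x - z))]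
      unfold heatKernel; positivity
  have hswap := integral_integral_swap (f := fun (t : ℝ) (z : EuclideanSpace ℝ (Fin n)) =>
    Real.exp (-(y ^ 2 / (4 * t))) / t ^ (1 + s) * heatKernel t (x - z) * u z) hprod
  simp_rw [hinner] at hswap
  rw [integral_const_mul] at hswap
  have hL : ∫ t in Ioi (0 : ℝ), Real.exp (-(y ^ 2 / (4 * t))) * heatSemigroup t u x / t ^ (1 + s) =
      ∫ t in Ioi (0 : ℝ), ∫ z : EuclideanSpace ℝ (Fin n),
        Real.exp (-(y ^ 2 / (4 * t))) / t ^ (1 + s) * heatKernel t (x - z) * u z := by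
    refine integral_congr_ae (Eventually.of_forall fun t => ?_)
    simp only [heatSemigroup, mul_assoc]
    rw [integral_const_mul]; ring
  rw [hL, hswap, hβdef, Real.rpow_add (by norm_num : (0 : ℝ) < 4), Real.rpow_neg (by positivity),
    Real.mul_rpow (by norm_num) hpi.le]
  field_simp

/-- The Poisson kernel is largest at `z = x`, where it is a multiple of `y^{2s}/y^{n+2s} = y^{-n}`.
For `n ≥ 1` this gives uniform, hence weak, vanishing. -/
theorem abs_extension_le_rpow {s : ℝ} (hs0 : 0 < s) (u : 𝓢(EuclideanSpace ℝ (Fin n), ℝ)) :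
    ∃ C : ℝ, 0 ≤ C ∧ ∀ (x : EuclideanSpace ℝ (Fin n)) (y : ℝ), 0 < y →
      |extension s u x y| ≤ C * (1 / y ^ n) := by
  have hβ : 0 < ((n : ℝ) + 2 * s) / 2 := by positivity
  have hG := Real.Gamma_pos_of_pos hs0
  have hG2 := Real.Gamma_pos_of_pos (show 0 < (n : ℝ) / 2 + s by positivity)
  have hpi := Real.pi_pos
  set c := Real.Gamma ((n : ℝ) / 2 + s) / (Real.Gamma s * Real.pi ^ ((n : ℝ) / 2))
  have hc : 0 ≤ c := by positivity
  refine ⟨c * ∫ z, |u z|, mul_nonneg hc (integral_nonneg fun _ => abs_nonneg _), ?_⟩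
  intro x y hy
  rw [(extension_eq_poisson hs0 u x hy).2, abs_mul, abs_of_nonneg hc, mul_assoc]
  refine mul_le_mul_of_nonneg_left ?_ hc
  rw [← integral_mul_const, ← Real.norm_eq_abs]
  refine norm_integral_le_of_norm_le ((u.integrable (μ := volume)).abs.mul_const _)
    (Eventually.of_forall fun z => ?_)
  rw [norm_mul, Real.norm_eq_abs, Real.norm_eq_abs, mul_comm]
  refine mul_le_mul_of_nonneg_left ?_ (abs_nonneg _)
  obtain ⟨h0, h1⟩ := poissonKernel_bounds hβ x z hy
  rw [div_eq_mul_one_div, abs_of_nonneg (mul_nonneg (by positivity) h0)]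
  calc y ^ (2 * s) * (1 / (y ^ 2 + ‖x - z‖ ^ 2) ^ (((n : ℝ) + 2 * s) / 2))
      ≤ y ^ (2 * s) * (1 / (y ^ 2) ^ (((n : ℝ) + 2 * s) / 2)) := by gcongr
    _ = 1 / y ^ n := by
      rw [← Real.rpow_two, ← Real.rpow_mul hy.le,
        show 2 * (((n : ℝ) + 2 * s) / 2) = n + 2 * s by ring, Real.rpow_add hy,
        Real.rpow_natCast]
      field_simp

theorem weaklyVanishes_extension (hn : 1 ≤ n) {s : ℝ} (hs0 : 0 < s)
    (u : 𝓢(EuclideanSpace ℝ (Fin n), ℝ)) : WeaklyVanishes (extension s u) := by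
  refine ⟨isLocallyTempered_extension hs0 u, fun φ => ?_⟩
  obtain ⟨C, hC, hb⟩ := abs_extension_le_rpow hs0 u
  have h0 : Tendsto (fun y : ℝ => C * (1 / y ^ n) * ∫ x, |φ x|) atTop (𝓝 0) := by
    have h1 : Tendsto (fun y : ℝ => (y ^ n)⁻¹) atTop (𝓝 0) :=
      tendsto_inv_atTop_zero.comp (tendsto_pow_atTop (by omega))
    simpa using (h1.const_mul C).mul_const (∫ x, |φ x|)
  refine squeeze_zero_norm' ?_ h0
  filter_upwards [eventually_gt_atTop 0] with y hy
  rw [← integral_const_mul]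
  refine norm_integral_le_of_norm_le ((φ.integrable (μ := volume)).abs.const_mul _)
    (Eventually.of_forall fun x => ?_)
  rw [norm_mul, Real.norm_eq_abs, Real.norm_eq_abs]
  exact mul_le_mul_of_nonneg_right (hb x y hy) (abs_nonneg _)

end FractionalExtension

/-! ### The fractional Laplacian moved to the datum -/

namespace FractionalExtension

variable {n : ℕ}

/-- The scalar identity behind the passage of `(-Δ)^s` to the datum. -/
theorem integral_gammaWeight_exp_eq {s : ℝ} (hs0 : 0 < s) (y : ℝ) {r : ℝ} (hr : 0 < r) :
    IntegrableOn (fun t : ℝ => Real.exp (-(y ^ 2 / (4 * t))) / t ^ (1 - s) *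
      Real.exp (-(t * r ^ 2))) (Ioi 0) ∧
    r ^ (2 * s) * ∫ t in Ioi (0 : ℝ), Real.exp (-(y ^ 2 / (4 * t))) / t ^ (1 - s) *
      Real.exp (-(t * r ^ 2)) =
    ∫ t in Ioi (0 : ℝ), Real.exp (-t) / t ^ (1 - s) *
      Real.exp (-(y ^ 2 / (4 * t) * r ^ 2)) := by
  set G : ℝ → ℝ := fun t => Real.exp (-t) / t ^ (1 - s) * Real.exp (-(y ^ 2 / (4 * t) * r ^ 2))
  have hb : 0 < r ^ 2 := by positivity
  have hG : IntegrableOn G (Ioi 0) := by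
    refine Integrable.mono' (integrableOn_gammaWeight hs0) ?_ ?_
    · exact (Measurable.aestronglyMeasurable (by fun_prop))
    · filter_upwards [ae_restrict_mem measurableSet_Ioi] with t ht
      have ht' : (0 : ℝ) < t := ht
      have h1 : Real.exp (-(y ^ 2 / (4 * t) * r ^ 2)) ≤ 1 := by
        rw [Real.exp_le_one_iff, neg_nonpos]; positivity
      have h0 : 0 ≤ Real.exp (-t) / t ^ (1 - s) := by positivity
      rw [Real.norm_eq_abs, abs_of_nonneg (by positivity)]
      exact mul_le_of_le_one_right h0 h1
  have hpow : (r ^ 2) ^ s = r ^ (2 * s) := by rw [← Real.rpow_two, ← Real.rpow_mul hr.le]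
  -- Replacing `t` by `r² t` exchanges the two exponentials; with the Jacobian `r²` the total power
  -- is `(r²)^s = r^{2s}`.
  have hE : EqOn (fun t => G (r ^ 2 * t)) (fun t : ℝ => (r ^ 2) ^ (s - 1) *
      (Real.exp (-(y ^ 2 / (4 * t))) / t ^ (1 - s) * Real.exp (-(t * r ^ 2)))) (Ioi 0) := by
    intro t ht
    have ht' : (0 : ℝ) < t := ht
    simp only [G]
    rw [Real.mul_rpow hb.le ht'.le, show s - 1 = -(1 - s) by ring, Real.rpow_neg hb.le,
      show y ^ 2 / (4 * (r ^ 2 * t)) * r ^ 2 = y ^ 2 / (4 * t) by field_simp, mul_comm t]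
    field_simp
  have h1 := (integrableOn_Ioi_comp_mul_left_iff G 0 hb).2 (by rwa [mul_zero])
  have h2 := integral_comp_mul_left_Ioi' G 0 hb
  rw [mul_zero, setIntegral_congr_fun measurableSet_Ioi hE, integral_const_mul, smul_eq_mul,
    ← mul_assoc] at h2
  constructor
  · have h3 := h1.congr_fun hE measurableSet_Ioi
    exact (integrable_const_mul_iff (IsUnit.mk0 _ (Real.rpow_pos_of_pos hb _).ne') _).1 h3
  · rw [← h2, ← hpow, Real.rpow_sub hb, Real.rpow_one]
    field_simp

theorem ae_norm_pos (hn : 1 ≤ n) : ∀ᵐ ξ : EuclideanSpace ℝ (Fin n), 0 < ‖ξ‖ := by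
  have : Nonempty (Fin n) := ⟨⟨0, by omega⟩⟩
  have h : ∀ᵐ ξ : EuclideanSpace ℝ (Fin n), ξ ≠ 0 := compl_mem_ae_iff.2 (measure_singleton 0)
  filter_upwards [h] with ξ hξ
  exact norm_pos_iff.2 hξ

/-- The heat flows of `u` and of `(-Δ)^s u` have equal averages. -/
theorem integral_heatFlow_fracLaplacianSymbol (hn : 1 ≤ n) {s : ℝ} (hs0 : 0 < s)
    (u : 𝓢(EuclideanSpace ℝ (Fin n), ℝ)) (x : EuclideanSpace ℝ (Fin n)) (y : ℝ) :
    IntegrableOn (fun t : ℝ => ((Real.exp (-(y ^ 2 / (4 * t))) / t ^ (1 - s) : ℝ) : ℂ) *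
      heatFlow (fracLaplacianSymbol s u) t x) (Ioi 0) ∧
    IntegrableOn (fun t : ℝ => ((Real.exp (-t) / t ^ (1 - s) : ℝ) : ℂ) *
      heatFlow (fourierTransform u) (y ^ 2 / (4 * t)) x) (Ioi 0) ∧
    ∫ t in Ioi (0 : ℝ), ((Real.exp (-(y ^ 2 / (4 * t))) / t ^ (1 - s) : ℝ) : ℂ) *
      heatFlow (fracLaplacianSymbol s u) t x =
    ∫ t in Ioi (0 : ℝ), ((Real.exp (-t) / t ^ (1 - s) : ℝ) : ℂ) *
      heatFlow (fourierTransform u) (y ^ 2 / (4 * t)) x := by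
  have hpi := Real.pi_pos
  have hg := (fourierTransform u).integrable (μ := volume)
  have hgm : Measurable (fourierTransform u) := (fourierTransform u).continuous.measurable
  let ph : EuclideanSpace ℝ (Fin n) → ℂ := fun ξ =>
    Complex.exp (((2 * Real.pi * ⟪ξ, x⟫_ℝ : ℝ) : ℂ) * Complex.I) * fourierTransform u ξ
  have hphm : Measurable ph := by
    have : Continuous ph := by
      have := (fourierTransform u).continuous
      fun_prop
    exact this.measurable
  have hphn : ∀ ξ, ‖ph ξ‖ = ‖fourierTransform u ξ‖ := fun ξ => by
    simp only [ph]; rw [norm_mul, Complex.norm_exp_ofReal_mul_I, one_mul]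
  let a : ℝ → EuclideanSpace ℝ (Fin n) → ℝ := fun t ξ => (2 * Real.pi * ‖ξ‖) ^ (2 * s) *
    (Real.exp (-(y ^ 2 / (4 * t))) / t ^ (1 - s) * Real.exp (-(t * (2 * Real.pi * ‖ξ‖) ^ 2)))
  let b : ℝ → EuclideanSpace ℝ (Fin n) → ℝ := fun t ξ => Real.exp (-t) / t ^ (1 - s) *
    Real.exp (-(y ^ 2 / (4 * t) * (2 * Real.pi * ‖ξ‖) ^ 2))
  have ham : Measurable (fun p : ℝ × EuclideanSpace ℝ (Fin n) => a p.1 p.2) := by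
    simp only [a]; fun_prop
  have hbm : Measurable (fun p : ℝ × EuclideanSpace ℝ (Fin n) => b p.1 p.2) := by
    simp only [b]; fun_prop
  have ha0 : ∀ t, 0 < t → ∀ ξ, 0 ≤ a t ξ := fun t ht ξ => by simp only [a]; positivity
  have hb0 : ∀ t, 0 < t → ∀ ξ, 0 ≤ b t ξ := fun t ht ξ => by simp only [b]; positivity
  have hble : ∀ t, 0 < t → ∀ ξ, b t ξ ≤ Real.exp (-t) / t ^ (1 - s) := fun t ht ξ => by
    simp only [b]
    refine mul_le_of_le_one_right (by positivity) ?_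
    rw [Real.exp_le_one_iff, neg_nonpos]; positivity
  have hab : ∀ ξ, 0 < ‖ξ‖ → IntegrableOn (fun t => a t ξ) (Ioi 0) ∧
      ∫ t in Ioi (0 : ℝ), a t ξ = ∫ t in Ioi (0 : ℝ), b t ξ := fun ξ hξ => by
    obtain ⟨h1, h2⟩ := integral_gammaWeight_exp_eq hs0 y (r := 2 * Real.pi * ‖ξ‖) (by positivity)
    exact ⟨h1.const_mul _, by simp only [a, b]; rw [← h2, integral_const_mul]⟩
  have hBint : Integrable (fun p : ℝ × EuclideanSpace ℝ (Fin n) => ((b p.1 p.2 : ℝ) : ℂ) * ph p.2)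
      ((volume.restrict (Ioi 0)).prod volume) := by
    refine ((integrableOn_gammaWeight hs0).mul_prod hg.norm).mono'
      (by fun_prop) ?_
    have hae : ∀ᵐ p : ℝ × EuclideanSpace ℝ (Fin n) ∂((volume.restrict (Ioi 0)).prod volume),
        0 < p.1 := Measure.quasiMeasurePreserving_fst.ae (ae_restrict_mem measurableSet_Ioi)
    filter_upwards [hae] with p hp
    rw [norm_mul, hphn, Complex.norm_real, Real.norm_eq_abs, abs_of_nonneg (hb0 _ hp _)]
    exact mul_le_mul_of_nonneg_right (hble _ hp _) (norm_nonneg _)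
  -- No product majorant is used here. For `ξ ≠ 0`, hence almost everywhere, the scalar identity
  -- makes the `t`-integral of the norm equal to that of the `b`-integrand, which is already known
  -- to be integrable.
  have hAint : Integrable (fun p : ℝ × EuclideanSpace ℝ (Fin n) => ((a p.1 p.2 : ℝ) : ℂ) * ph p.2)
      ((volume.restrict (Ioi 0)).prod volume) := by
    rw [integrable_prod_iff' (by fun_prop)]
    constructor
    · filter_upwards [ae_norm_pos hn] with ξ hξ
      exact (hab ξ hξ).1.ofReal.mul_const _
    · refine hBint.norm.integral_prod_right.congr ?_
      filter_upwards [ae_norm_pos hn] with ξ hξ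
      simp only [norm_mul, Complex.norm_real, Real.norm_eq_abs]
      rw [integral_mul_const, integral_mul_const]
      congr 1
      rw [setIntegral_congr_fun measurableSet_Ioi (fun t ht => abs_of_nonneg (ha0 t ht ξ)),
        setIntegral_congr_fun measurableSet_Ioi (fun t ht => abs_of_nonneg (hb0 t ht ξ)),
        (hab ξ hξ).2]
  have hA : ∀ t : ℝ, ((Real.exp (-(y ^ 2 / (4 * t))) / t ^ (1 - s) : ℝ) : ℂ) *
      heatFlow (fracLaplacianSymbol s u) t x = ∫ ξ, ((a t ξ : ℝ) : ℂ) * ph ξ := by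
    intro t
    rw [heatFlow_eq_integral, ← integral_const_mul]
    congr 1; ext ξ
    rw [fracLaplacianSymbol_eq]
    simp only [a, ph, Complex.ofReal_mul]
    ring
  have hB : ∀ t : ℝ, ((Real.exp (-t) / t ^ (1 - s) : ℝ) : ℂ) *
      heatFlow (fourierTransform u) (y ^ 2 / (4 * t)) x = ∫ ξ, ((b t ξ : ℝ) : ℂ) * ph ξ := by
    intro t
    rw [heatFlow_eq_integral, ← integral_const_mul]
    congr 1; ext ξ
    simp only [b, ph, Complex.ofReal_mul]
    ring
  simp_rw [hA, hB]
  refine ⟨hAint.integral_prod_left, hBint.integral_prod_left, ?_⟩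
  rw [integral_integral_swap (f := fun t ξ => ((a t ξ : ℝ) : ℂ) * ph ξ) hAint,
    integral_integral_swap (f := fun t ξ => ((b t ξ : ℝ) : ℂ) * ph ξ) hBint]
  refine integral_congr_ae ?_
  filter_upwards [ae_norm_pos hn] with ξ hξ
  rw [integral_mul_const, integral_mul_const, integral_complex_ofReal, integral_complex_ofReal,
    (hab ξ hξ).2]

theorem heatSemigroup_fracLaplacian {s : ℝ} (hs0 : 0 < s) (hs1 : s < 1)
    (u : 𝓢(EuclideanSpace ℝ (Fin n), ℝ)) {t : ℝ} (ht : 0 < t) (x : EuclideanSpace ℝ (Fin n)) :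
    heatSemigroup t (fracLaplacian s u) x = (heatFlow (fracLaplacianSymbol s u) t x).re := by
  rw [← ofReal_heatSemigroup (integrable_fracLaplacianSymbol hs0 hs1 u)
    (ofReal_fracLaplacian s u) ht x, Complex.ofReal_re]

/-- The extension as an average of the heat flow of `(-Δ)^s u`. -/
theorem extension_eq_integral_fracLaplacian (hn : 1 ≤ n) {s : ℝ} (hs0 : 0 < s) (hs1 : s < 1)
    (u : 𝓢(EuclideanSpace ℝ (Fin n), ℝ)) (x : EuclideanSpace ℝ (Fin n)) (y : ℝ) :
    IntegrableOn (fun t : ℝ => Real.exp (-(y ^ 2 / (4 * t))) *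
      heatSemigroup t (fracLaplacian s u) x / t ^ (1 - s)) (Ioi 0) ∧
    extension s u x y = 1 / Real.Gamma s *
      ∫ t in Ioi (0 : ℝ), Real.exp (-(y ^ 2 / (4 * t))) *
        heatSemigroup t (fracLaplacian s u) x / t ^ (1 - s) := by
  obtain ⟨h1, hi, h2⟩ := integral_heatFlow_fracLaplacianSymbol hn hs0 u x y
  have hE : EqOn (fun t : ℝ => (((Real.exp (-(y ^ 2 / (4 * t))) / t ^ (1 - s) : ℝ) : ℂ) *
      heatFlow (fracLaplacianSymbol s u) t x).re) (fun t : ℝ => Real.exp (-(y ^ 2 / (4 * t))) *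
      heatSemigroup t (fracLaplacian s u) x / t ^ (1 - s)) (Ioi 0) := by
    intro t ht
    simp only []
    rw [Complex.re_ofReal_mul, heatSemigroup_fracLaplacian hs0 hs1 u ht]
    ring
  refine ⟨IntegrableOn.congr_fun (Integrable.re h1) hE measurableSet_Ioi, ?_⟩
  rw [extension, ← setIntegral_congr_fun measurableSet_Ioi hE]
  have hre := integral_re h1
  simp only [RCLike.re_to_complex] at hre
  rw [hre, h2]
  have hre2 := integral_re hi
  simp only [RCLike.re_to_complex, Complex.re_ofReal_mul] at hre2
  rw [hre2]

end FractionalExtension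

/-! ### Boundary behaviour as `y → 0` -/

namespace FractionalExtension

variable {n : ℕ}

theorem hasDerivAt_exp_neg_sq_div (t y : ℝ) :
    HasDerivAt (fun y : ℝ => Real.exp (-(y ^ 2 / (4 * t))))
      (-(y / (2 * t)) * Real.exp (-(y ^ 2 / (4 * t)))) y := by
  have h := ((((hasDerivAt_id' y).fun_pow 2).div_const (4 * t)).fun_neg).exp
  convert! h using 1
  push_cast
  rw [mul_comm]
  congr 2
  rcases eq_or_ne t 0 with rfl | ht
  · simp
  · field_simp; ring

/-- Differentiation of a subordination integral in the extension variable. -/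
theorem hasDerivAt_integral_exp_neg_sq_div {s M : ℝ} (hs1 : s < 1) {h : ℝ → ℝ}
    (hm : AEStronglyMeasurable h (volume.restrict (Ioi 0))) (hM : ∀ t, 0 < t → |h t| ≤ M)
    {y : ℝ} (hy : 0 < y)
    (hint : IntegrableOn (fun t : ℝ => Real.exp (-(y ^ 2 / (4 * t))) * h t / t ^ (1 - s)) (Ioi 0)) :
    HasDerivAt (fun y : ℝ => ∫ t in Ioi (0 : ℝ), Real.exp (-(y ^ 2 / (4 * t))) * h t / t ^ (1 - s))
      (∫ t in Ioi (0 : ℝ), -(y / (2 * t)) * Real.exp (-(y ^ 2 / (4 * t))) * h t / t ^ (1 - s))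
      y := by
  -- For `y/2 ≤ w ≤ 2y` the exponential is largest at `w = y/2` and the prefactor `w/(2t)` at `w =
  -- 2y`; the additional `1/t` leads to an inverse Gamma integrand with parameter `1 - s > 0`.
  have hA : 0 < (y / 2) ^ 2 / 4 := by positivity
  have hrp : ∀ r : ℝ, Measurable (fun t : ℝ => t ^ r) := fun r => by fun_prop
  refine (hasDerivAt_integral_of_dominated_loc_of_deriv_le (s := Icc (y / 2) (2 * y))
    (F := fun y t => Real.exp (-(y ^ 2 / (4 * t))) * h t / t ^ (1 - s))
    (F' := fun y t => -(y / (2 * t)) * Real.exp (-(y ^ 2 / (4 * t))) * h t / t ^ (1 - s))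
    (bound := fun t => y * M * (Real.exp (-((y / 2) ^ 2 / 4 / t)) / t ^ (1 + (1 - s))))
    (Icc_mem_nhds (by linarith) (by linarith)) (Eventually.of_forall fun y => ?_) hint ?_ ?_
    ((integrableOn_inverseGamma (by linarith) hA).const_mul _) ?_).2
  · simp only [div_eq_mul_inv _ (_ ^ (1 - s))]
    exact (AEStronglyMeasurable.mul (Measurable.aestronglyMeasurable (by fun_prop)) hm).mul
      (Measurable.aestronglyMeasurable (by fun_prop))
  · simp only [div_eq_mul_inv _ (_ ^ (1 - s))]
    exact (AEStronglyMeasurable.mul (Measurable.aestronglyMeasurable (by fun_prop)) hm).mul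
      (Measurable.aestronglyMeasurable (by fun_prop))
  · filter_upwards [ae_restrict_mem measurableSet_Ioi] with t ht w hw
    have ht' : (0 : ℝ) < t := ht
    have hw0 : 0 < w := by linarith [hw.1]
    have hM0 : 0 ≤ M := (abs_nonneg _).trans (hM t ht)
    have e1 : Real.exp (-(w ^ 2 / (4 * t))) ≤ Real.exp (-((y / 2) ^ 2 / 4 / t)) := by
      rw [Real.exp_le_exp, neg_le_neg_iff, div_div]
      have := hw.1
      gcongr
    have e2 : w / (2 * t) ≤ y / t := by
      rw [div_le_div_iff₀ (by positivity) ht']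
      nlinarith [hw.2]
    have hp : 0 < t ^ (1 - s) := Real.rpow_pos_of_pos ht' _
    rw [Real.norm_eq_abs, abs_div, abs_mul, abs_mul, abs_neg, abs_of_pos hp,
      abs_of_pos (Real.exp_pos _), abs_of_pos (by positivity)]
    calc w / (2 * t) * Real.exp (-(w ^ 2 / (4 * t))) * |h t| / t ^ (1 - s)
        ≤ y / t * Real.exp (-((y / 2) ^ 2 / 4 / t)) * M / t ^ (1 - s) := by
          gcongr
          exact hM t ht
      _ = _ := by
          rw [Real.rpow_add ht', Real.rpow_one]
          field_simp
  · filter_upwards with t w _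
    exact ((hasDerivAt_exp_neg_sq_div t w).mul_const (h t)).div_const _

/-- Replacing `t` by `y² t` clears `y` from the weight and collects the power `y^{2s-1}`, the
reciprocal of the factor `y^a` in the weighted derivative. -/
theorem integral_deriv_exp_neg_sq_div_rescale {s : ℝ} (h : ℝ → ℝ) {y : ℝ} (hy : 0 < y) :
    ∫ t in Ioi (0 : ℝ), -(y / (2 * t)) * Real.exp (-(y ^ 2 / (4 * t))) * h t / t ^ (1 - s) =
      -(1 / 2) * y ^ (2 * s - 1) * ∫ t in Ioi (0 : ℝ),
        Real.exp (-(1 / 4 / t)) / t ^ (1 + (1 - s)) * h (y ^ 2 * t) := by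
  have hb : 0 < y ^ 2 := by positivity
  have h2 := integral_comp_mul_left_Ioi'
    (fun t => -(y / (2 * t)) * Real.exp (-(y ^ 2 / (4 * t))) * h t / t ^ (1 - s)) 0 hb
  rw [mul_zero, smul_eq_mul] at h2
  rw [← h2, ← integral_const_mul, ← integral_const_mul]
  refine setIntegral_congr_fun measurableSet_Ioi fun t ht => ?_
  have ht' : (0 : ℝ) < t := ht
  have e1 : y ^ 2 / (4 * (y ^ 2 * t)) = 1 / 4 / t := by field_simp
  have e2 : (y ^ 2 * t) ^ (1 - s) = y ^ 2 / y ^ (2 * s) * t ^ (1 - s) := by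
    rw [Real.mul_rpow hb.le ht'.le, Real.rpow_sub hb, Real.rpow_one, ← Real.rpow_two,
      ← Real.rpow_mul hy.le]
  rw [e1, e2, Real.rpow_add ht' 1, Real.rpow_one, Real.rpow_sub hy, Real.rpow_one]
  have := (Real.rpow_pos_of_pos hy (2 * s)).ne'
  have := (Real.rpow_pos_of_pos ht' (1 - s)).ne'
  field_simp

/-- For fixed `t` the argument `y² t` tends to `0` from the right, so `L` comes out by dominated
convergence, times the inverse Gamma integral at `A = 1/4`. -/
theorem tendsto_integral_inverseGamma_mul {β M : ℝ} (hβ : 0 < β) {h : ℝ → ℝ} {L : ℝ}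
    (hc : ContinuousOn h (Ioi 0)) (hM : ∀ t, 0 < t → |h t| ≤ M)
    (hL : Tendsto h (𝓝[>] 0) (𝓝 L)) :
    Tendsto (fun y : ℝ => ∫ t in Ioi (0 : ℝ),
      Real.exp (-(1 / 4 / t)) / t ^ (1 + β) * h (y ^ 2 * t)) (𝓝[>] 0)
      (𝓝 (Real.Gamma β * 4 ^ β * L)) := by
  have hI := integrableOn_inverseGamma hβ (show (0 : ℝ) < 1 / 4 by norm_num)
  have hval : Real.Gamma β * 4 ^ β * L = ∫ t in Ioi (0 : ℝ),
      Real.exp (-(1 / 4 / t)) / t ^ (1 + β) * L := by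
    rw [integral_mul_const, integral_inverseGamma hβ (by norm_num), one_div,
      Real.inv_rpow (by norm_num), div_inv_eq_mul]
  rw [hval]
  refine tendsto_integral_filter_of_dominated_convergence
    (fun t => Real.exp (-(1 / 4 / t)) / t ^ (1 + β) * M) ?_ ?_ (hI.mul_const M) ?_
  · filter_upwards [self_mem_nhdsWithin] with y hy
    have hy' : (0 : ℝ) < y := hy
    refine AEStronglyMeasurable.mul (Measurable.aestronglyMeasurable (by fun_prop)) ?_
    refine ContinuousOn.aestronglyMeasurable ?_ measurableSet_Ioi
    refine hc.comp (by fun_prop) fun t ht => ?_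
    have ht' : (0 : ℝ) < t := ht
    simp only [mem_Ioi]; positivity
  · filter_upwards [self_mem_nhdsWithin] with y hy
    have hy' : (0 : ℝ) < y := hy
    filter_upwards [ae_restrict_mem measurableSet_Ioi] with t ht
    have ht' : (0 : ℝ) < t := ht
    have h0 : 0 ≤ Real.exp (-(1 / 4 / t)) / t ^ (1 + β) := by positivity
    rw [norm_mul, Real.norm_eq_abs, Real.norm_eq_abs, abs_of_nonneg h0]
    exact mul_le_mul_of_nonneg_left (hM _ (by positivity)) h0
  · filter_upwards [ae_restrict_mem measurableSet_Ioi] with t ht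
    have ht' : (0 : ℝ) < t := ht
    refine Tendsto.const_mul _ (hL.comp ?_)
    refine tendsto_nhdsWithin_iff.2 ⟨?_, ?_⟩
    · have : Continuous fun y : ℝ => y ^ 2 * t := by fun_prop
      have h0 := this.tendsto 0
      simp only [zero_pow two_ne_zero, zero_mul] at h0
      exact h0.mono_left nhdsWithin_le_nhds
    · filter_upwards [self_mem_nhdsWithin] with y hy
      have hy' : (0 : ℝ) < y := hy
      simp only [mem_Ioi]; positivity

/-- The derivative of the extension in the extension variable. -/
theorem hasDerivAt_extension (hn : 1 ≤ n) {s : ℝ} (hs0 : 0 < s) (hs1 : s < 1)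
    (u : 𝓢(EuclideanSpace ℝ (Fin n), ℝ)) (x : EuclideanSpace ℝ (Fin n)) {y : ℝ} (hy : 0 < y) :
    HasDerivAt (extension s u x) (1 / Real.Gamma s * (-(1 / 2) * y ^ (2 * s - 1) *
      ∫ t in Ioi (0 : ℝ), Real.exp (-(1 / 4 / t)) / t ^ (1 + (1 - s)) *
        (heatFlow (fracLaplacianSymbol s u) (y ^ 2 * t) x).re)) y := by
  have hg := integrable_fracLaplacianSymbol hs0 hs1 u
  have hE : ∀ y : ℝ, EqOn (fun t : ℝ => Real.exp (-(y ^ 2 / (4 * t))) *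
      heatSemigroup t (fracLaplacian s u) x / t ^ (1 - s))
      (fun t : ℝ => Real.exp (-(y ^ 2 / (4 * t))) *
        (heatFlow (fracLaplacianSymbol s u) t x).re / t ^ (1 - s)) (Ioi 0) := by
    intro y t ht
    simp only []
    rw [heatSemigroup_fracLaplacian hs0 hs1 u ht]
  have hrep : extension s u x = fun y => 1 / Real.Gamma s * ∫ t in Ioi (0 : ℝ),
      Real.exp (-(y ^ 2 / (4 * t))) *
        (heatFlow (fracLaplacianSymbol s u) t x).re / t ^ (1 - s) := by
    ext y
    rw [(extension_eq_integral_fracLaplacian hn hs0 hs1 u x y).2,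
      setIntegral_congr_fun measurableSet_Ioi (hE y)]
  have hint := IntegrableOn.congr_fun (extension_eq_integral_fracLaplacian hn hs0 hs1 u x y).1
    (hE y) measurableSet_Ioi
  have hcont : ContinuousOn (fun t => (heatFlow (fracLaplacianSymbol s u) t x).re) (Ioi 0) :=
    (continuousOn_heatFlow_re hg).comp (f := fun t : ℝ => (x, t)) (by fun_prop)
      fun t (ht : 0 < t) => ⟨mem_univ _, (show (0 : ℝ) ≤ t from ht.le)⟩
  have hd := hasDerivAt_integral_exp_neg_sq_div hs1
    (hcont.aestronglyMeasurable measurableSet_Ioi)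
    (fun t ht => abs_heatFlow_re_le hg ht.le x) hy hint
  rw [integral_deriv_exp_neg_sq_div_rescale _ hy] at hd
  rw [hrep]
  exact hd.const_mul _

/-- The weighted normal derivative of the extension is the fractional Laplacian. -/
theorem tendsto_weighted_deriv_extension (hn : 1 ≤ n) {s : ℝ} (hs0 : 0 < s) (hs1 : s < 1)
    (u : 𝓢(EuclideanSpace ℝ (Fin n), ℝ)) (x : EuclideanSpace ℝ (Fin n)) :
    Tendsto (fun y : ℝ => -(y ^ (1 - 2 * s) * deriv (extension s u x) y)) (𝓝[>] 0)
      (𝓝 (Real.Gamma (1 - s) / (4 ^ (s - 1 / 2) * Real.Gamma s) * fracLaplacian s u x)) := by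
  have hg := integrable_fracLaplacianSymbol hs0 hs1 u
  have hc : ContinuousOn (fun t => (heatFlow (fracLaplacianSymbol s u) t x).re) (Ici 0) :=
    (continuousOn_heatFlow_re hg).comp (f := fun t : ℝ => (x, t)) (by fun_prop)
      fun t ht => ⟨mem_univ _, ht⟩
  have hL : Tendsto (fun t => (heatFlow (fracLaplacianSymbol s u) t x).re) (𝓝[>] 0)
      (𝓝 (fracLaplacian s u x)) := by
    have h0 := (hc 0 self_mem_Ici).tendsto
    simp only [heatFlow_zero] at h0
    exact h0.mono_left (nhdsWithin_mono _ Ioi_subset_Ici_self)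
  have hT := tendsto_integral_inverseGamma_mul (show 0 < 1 - s by linarith)
    (hc.mono Ioi_subset_Ici_self) (fun t ht => abs_heatFlow_re_le hg ht.le x) hL
  have hG := Real.Gamma_pos_of_pos hs0
  have hval : Real.Gamma (1 - s) / (4 ^ (s - 1 / 2) * Real.Gamma s) * fracLaplacian s u x =
      1 / (2 * Real.Gamma s) * (Real.Gamma (1 - s) * 4 ^ (1 - s) * fracLaplacian s u x) := by
    -- This reconciles `4^{1-s}/2`, with the `1/2` from differentiating `y²/(4t)`, with the stated
    -- constant `4^{-(s-1/2)}`.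
    have h4 : (4 : ℝ) ^ (1 - s) * 4 ^ (s - 1 / 2) = 2 := by
      rw [← Real.rpow_add (by norm_num), show (4 : ℝ) = 2 ^ (2 : ℝ) by norm_num,
        ← Real.rpow_mul (by norm_num)]
      norm_num
    have : (0 : ℝ) < 4 ^ (s - 1 / 2) := by positivity
    rw [eq_div_of_mul_eq this.ne' h4]
    generalize (4 : ℝ) ^ (s - 1 / 2) = c at this
    field_simp
  rw [hval]
  refine (hT.const_mul _).congr' ?_
  filter_upwards [self_mem_nhdsWithin] with y hy
  have hy' : (0 : ℝ) < y := hy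
  rw [(hasDerivAt_extension hn hs0 hs1 u x hy').deriv]
  have : y ^ (1 - 2 * s) * y ^ (2 * s - 1) = 1 := by
    rw [← Real.rpow_add hy']; simp
  generalize (∫ t in Ioi (0 : ℝ), Real.exp (-(1 / 4 / t)) / t ^ (1 + (1 - s)) *
    (heatFlow (fracLaplacianSymbol s u) (y ^ 2 * t) x).re) = I
  calc 1 / (2 * Real.Gamma s) * I
      = 1 / (2 * Real.Gamma s) * I * (y ^ (1 - 2 * s) * y ^ (2 * s - 1)) := by rw [this, mul_one]
    _ = _ := by ring

/-- The fractional difference quotient of the extension at the boundary. -/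
theorem tendsto_quotient_extension (hn : 1 ≤ n) {s : ℝ} (hs0 : 0 < s) (hs1 : s < 1)
    (u : 𝓢(EuclideanSpace ℝ (Fin n), ℝ)) (x : EuclideanSpace ℝ (Fin n)) :
    Tendsto (fun y : ℝ => -((extension s u x y - extension s u x 0) / y ^ (2 * s))) (𝓝[>] 0)
      (𝓝 (Real.Gamma (1 - s) / (4 ^ s * Real.Gamma (1 + s)) * fracLaplacian s u x)) := by
  have hG := Real.Gamma_pos_of_pos hs0
  have h1 := (tendsto_weighted_deriv_extension hn hs0 hs1 u x).neg.const_mul (1 / (2 * s))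
  have hcont : Continuous (extension s u x) :=
    Continuous.comp (f := fun y => (x, y)) (continuous_extension hs0 u) (by fun_prop)
  have hlim : Tendsto (fun y : ℝ => (extension s u x y - extension s u x 0) / y ^ (2 * s)) (𝓝[>] 0)
      (𝓝 (1 / (2 * s) *
        -(Real.Gamma (1 - s) / (4 ^ (s - 1 / 2) * Real.Gamma s) * fracLaplacian s u x))) := by
    -- The quotient of derivatives `U_y/(2s y^{2s-1})` is the weighted derivative divided by `2s`;
    -- the factor `s` later joins `Γ(s)` to form `Γ(1 + s)`.
    refine HasDerivAt.lhopital_zero_nhdsGT (f' := deriv (extension s u x))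
      (g' := fun y => (2 * s) * y ^ (2 * s - 1)) ?_ ?_ ?_ ?_ ?_ ?_
    · filter_upwards [self_mem_nhdsWithin] with y hy
      exact ((hasDerivAt_extension hn hs0 hs1 u x hy).differentiableAt.hasDerivAt).sub_const _
    · filter_upwards [self_mem_nhdsWithin] with y hy
      exact Real.hasDerivAt_rpow_const (Or.inl (ne_of_gt hy))
    · filter_upwards [self_mem_nhdsWithin] with y hy
      have hy' : (0 : ℝ) < y := hy
      positivity
    · have := (hcont.tendsto 0).sub_const (extension s u x 0)
      rw [sub_self] at this
      exact this.mono_left nhdsWithin_le_nhds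
    · have : ContinuousAt (fun y : ℝ => y ^ (2 * s)) 0 :=
        Real.continuousAt_rpow_const _ _ (Or.inr (by linarith))
      have h0 := this.tendsto
      rw [Real.zero_rpow (by linarith)] at h0
      exact h0.mono_left nhdsWithin_le_nhds
    · refine h1.congr' ?_
      filter_upwards [self_mem_nhdsWithin] with y hy
      have hy' : (0 : ℝ) < y := hy
      rw [show 1 - 2 * s = -(2 * s - 1) by ring, Real.rpow_neg hy'.le]
      have := (Real.rpow_pos_of_pos hy' (2 * s - 1)).ne'
      field_simp
  convert! hlim.neg using 2
  rw [show 1 + s = s + 1 by ring, Real.Gamma_add_one hs0.ne']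
  have h4 : (4 : ℝ) ^ s = 4 ^ (s - 1 / 2) * 2 := by
    rw [Real.rpow_sub (by norm_num), show (4 : ℝ) ^ (1 / 2 : ℝ) = 2 by
      rw [show (4 : ℝ) = 2 ^ (2 : ℝ) by norm_num, ← Real.rpow_mul (by norm_num)]; norm_num]
    field_simp
  rw [h4]
  have : (0 : ℝ) < 4 ^ (s - 1 / 2) := by positivity
  field_simp

end FractionalExtension

/-! ### Smoothness of Poisson potentials -/

namespace FractionalExtension

variable {n : ℕ} {F : Type} [NormedAddCommGroup F]

/-- A measurable vector valued function all of whose moments are finite. -/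
structure HasFiniteMoments (v : EuclideanSpace ℝ (Fin n) → F) : Prop where
  aestronglyMeasurable : AEStronglyMeasurable v
  integrable_pow_mul : ∀ k : ℕ, Integrable (fun z => ‖z‖ ^ k * ‖v z‖)

theorem HasFiniteMoments.integrable {v : EuclideanSpace ℝ (Fin n) → F} (hv : HasFiniteMoments v) :
    Integrable v := by
  have := hv.integrable_pow_mul 0
  simp only [pow_zero, one_mul] at this
  exact (integrable_norm_iff hv.aestronglyMeasurable).1 this

theorem HasFiniteMoments.of_norm_le {G : Type*} [NormedAddCommGroup G]
    {v : EuclideanSpace ℝ (Fin n) → F} (hv : HasFiniteMoments v)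
    {w : EuclideanSpace ℝ (Fin n) → G} (hw : AEStronglyMeasurable w) {C : ℝ}
    (h : ∀ z, ‖w z‖ ≤ C * (‖z‖ * ‖v z‖)) (k : ℕ) : Integrable (fun z => ‖z‖ ^ k * ‖w z‖) := by
  refine ((hv.integrable_pow_mul (k + 1)).const_mul C).mono'
    (Continuous.aestronglyMeasurable (by fun_prop) |>.mul hw.norm)
    (Eventually.of_forall fun z => ?_)
  rw [Real.norm_eq_abs, abs_of_nonneg (by positivity)]
  calc ‖z‖ ^ k * ‖w z‖ ≤ ‖z‖ ^ k * (C * (‖z‖ * ‖v z‖)) := by gcongr; exact h z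
    _ = _ := by ring

variable [NormedSpace ℝ F]

/-- The linear form `(x, y) ↦ ⟪z, x⟫`. -/
noncomputable def innerFst (z : EuclideanSpace ℝ (Fin n)) :
    EuclideanSpace ℝ (Fin n) × ℝ →L[ℝ] ℝ :=
  (innerSL ℝ z).comp (ContinuousLinearMap.fst ℝ _ ℝ)

theorem innerFst_apply (z : EuclideanSpace ℝ (Fin n)) (p : EuclideanSpace ℝ (Fin n) × ℝ) :
    innerFst z p = ⟪z, p.1⟫_ℝ := rfl

theorem norm_innerFst_le (z : EuclideanSpace ℝ (Fin n)) : ‖innerFst z‖ ≤ ‖z‖ := by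
  refine ContinuousLinearMap.opNorm_le_bound _ (norm_nonneg _) fun p => ?_
  rw [innerFst_apply]
  exact (norm_inner_le_norm _ _).trans (by gcongr; exact norm_fst_le p)

theorem innerFst_sub (z w : EuclideanSpace ℝ (Fin n)) :
    innerFst (z - w) = innerFst z - innerFst w := by
  ext p <;> simp [innerFst]

theorem continuous_innerFst : Continuous (innerFst (n := n)) := by
  unfold innerFst; fun_prop

/-- The function `z ↦ ⟪z, ·⟫ ⊗ v z`. -/
noncomputable def moment (v : EuclideanSpace ℝ (Fin n) → F) (z : EuclideanSpace ℝ (Fin n)) :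
    EuclideanSpace ℝ (Fin n) × ℝ →L[ℝ] F :=
  (innerFst z).smulRight (v z)

theorem HasFiniteMoments.moment {v : EuclideanSpace ℝ (Fin n) → F} (hv : HasFiniteMoments v) :
    HasFiniteMoments (moment v) := by
  have hm : AEStronglyMeasurable (FractionalExtension.moment v) :=
    (ContinuousLinearMap.smulRightL ℝ (EuclideanSpace ℝ (Fin n) × ℝ) F).aestronglyMeasurable_comp₂
      continuous_innerFst.aestronglyMeasurable hv.aestronglyMeasurable
  refine ⟨hm, hv.of_norm_le hm (C := 1) fun z => ?_⟩
  rw [FractionalExtension.moment, ContinuousLinearMap.norm_smulRight_apply, one_mul]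
  gcongr
  exact norm_innerFst_le z

/-- The potential `∫ (y² + |x - z|²)^{-β} v(z) dz`. -/
noncomputable def poissonPotential (β : ℝ) (v : EuclideanSpace ℝ (Fin n) → F)
    (p : EuclideanSpace ℝ (Fin n) × ℝ) : F :=
  ∫ z, (p.2 ^ 2 + ‖p.1 - z‖ ^ 2) ^ (-β) • v z

theorem rpow_neg_le {β : ℝ} (hβ : 0 ≤ β) {c y : ℝ} (hc : 0 < c) (hcy : c ≤ y)
    (w : EuclideanSpace ℝ (Fin n)) :
    (y ^ 2 + ‖w‖ ^ 2) ^ (-β) ≤ (c ^ 2) ^ (-β) := by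
  refine Real.rpow_le_rpow_of_nonpos (by positivity) ?_ (by linarith)
  nlinarith [sq_nonneg ‖w‖]

theorem continuous_rpow_neg (β : ℝ) (x : EuclideanSpace ℝ (Fin n)) {y : ℝ} (hy : 0 < y) :
    Continuous (fun z : EuclideanSpace ℝ (Fin n) => (y ^ 2 + ‖x - z‖ ^ 2) ^ (-β)) :=
  Continuous.rpow_const (by fun_prop) fun z => Or.inl (by positivity)

theorem integrable_poissonPotential {β : ℝ} (hβ : 0 ≤ β) {v : EuclideanSpace ℝ (Fin n) → F}
    (hv : Integrable v) (x : EuclideanSpace ℝ (Fin n)) {y : ℝ} (hy : 0 < y) :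
    Integrable (fun z => (y ^ 2 + ‖x - z‖ ^ 2) ^ (-β) • v z) := by
  refine hv.bdd_smul (C := (y ^ 2) ^ (-β)) (continuous_rpow_neg β x hy).aestronglyMeasurable
    (Eventually.of_forall fun z => ?_)
  rw [Real.norm_eq_abs, abs_of_nonneg (by positivity)]
  exact rpow_neg_le hβ hy le_rfl _

/-- The differential of `(y² + |x - z|²)^{-β}` in `(x, y)`. -/
theorem hasFDerivAt_rpow_neg (β : ℝ) (z : EuclideanSpace ℝ (Fin n))
    {p : EuclideanSpace ℝ (Fin n) × ℝ} (hp : 0 < p.2) :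
    HasFDerivAt (fun p : EuclideanSpace ℝ (Fin n) × ℝ => (p.2 ^ 2 + ‖p.1 - z‖ ^ 2) ^ (-β))
      ((-(2 * β) * (p.2 ^ 2 + ‖p.1 - z‖ ^ 2) ^ (-(β + 1))) •
        (p.2 • ContinuousLinearMap.snd ℝ (EuclideanSpace ℝ (Fin n)) ℝ + innerFst (p.1 - z))) p := by
  have h1 : HasFDerivAt (fun p : EuclideanSpace ℝ (Fin n) × ℝ => p.2)
      (ContinuousLinearMap.snd ℝ (EuclideanSpace ℝ (Fin n)) ℝ) p := hasFDerivAt_snd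
  have h2 : HasFDerivAt (fun p : EuclideanSpace ℝ (Fin n) × ℝ => p.1 - z)
      (ContinuousLinearMap.fst ℝ (EuclideanSpace ℝ (Fin n)) ℝ) p := hasFDerivAt_fst.sub_const z
  have h3 := (HasFDerivAt.fun_add (h1.pow 2) h2.norm_sq).rpow_const (p := -β)
    (Or.inl (by positivity))
  convert! h3 using 1
  rw [show -(β + 1) = -β - 1 by ring]
  ext q
  · simp [innerFst]; ring
  · simp [innerFst]; ring

/-- The differential of the kernel involves `⟪x - z, ·⟫`. Splitting it into its `x` and `z` parts
yields potentials with exponent `β + 1` of `v` and of its first moment, so the class of potentials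
is closed under differentiation. -/
theorem hasFDerivAt_poissonPotential [CompleteSpace F] {β : ℝ} (hβ : 0 < β)
    {v : EuclideanSpace ℝ (Fin n) → F}
    (hv : HasFiniteMoments v) {p : EuclideanSpace ℝ (Fin n) × ℝ} (hp : 0 < p.2) :
    HasFDerivAt (poissonPotential β v)
      ((-(2 * β)) • ((p.2 • ContinuousLinearMap.snd ℝ (EuclideanSpace ℝ (Fin n)) ℝ +
        innerFst p.1).smulRight (poissonPotential (β + 1) v p) -
          poissonPotential (β + 1) (moment v) p)) p := by
  set K : EuclideanSpace ℝ (Fin n) × ℝ → EuclideanSpace ℝ (Fin n) → ℝ :=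
    fun p z => (p.2 ^ 2 + ‖p.1 - z‖ ^ 2) ^ (-(β + 1)) with hK
  set ℓ : EuclideanSpace ℝ (Fin n) × ℝ → EuclideanSpace ℝ (Fin n) × ℝ →L[ℝ] ℝ :=
    fun p => p.2 • ContinuousLinearMap.snd ℝ (EuclideanSpace ℝ (Fin n)) ℝ + innerFst p.1 with hℓ
  have hsplit : ∀ p z, (-(2 * β)) • ((ContinuousLinearMap.smulRightL ℝ
      (EuclideanSpace ℝ (Fin n) × ℝ) F (ℓ p)) (K p z • v z) - K p z • moment v z) =
      ((-(2 * β) * K p z) • (p.2 • ContinuousLinearMap.snd ℝ (EuclideanSpace ℝ (Fin n)) ℝ +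
        innerFst (p.1 - z))).smulRight (v z) := by
    intro p z
    rw [innerFst_sub, ← add_sub_assoc]
    change (-(2 * β)) • ((ℓ p).smulRight (K p z • v z) - K p z • (innerFst z).smulRight (v z)) =
      ((-(2 * β) * K p z) • (ℓ p - innerFst z)).smulRight (v z)
    refine ContinuousLinearMap.ext fun q => ?_
    simp only [smul_apply, sub_apply, ContinuousLinearMap.smulRight_apply]
    module
  have hi1 : Integrable (fun z => K p z • v z) :=
    integrable_poissonPotential (by linarith) hv.integrable p.1 hp
  have hi2 : Integrable (fun z => K p z • moment v z) :=
    integrable_poissonPotential (by linarith) hv.moment.integrable p.1 hp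
  have hi1' : Integrable (fun z => (ContinuousLinearMap.smulRightL ℝ
      (EuclideanSpace ℝ (Fin n) × ℝ) F (ℓ p)) (K p z • v z)) :=
    ContinuousLinearMap.integrable_comp _ hi1
  have hval : (-(2 * β)) • ((ℓ p).smulRight (poissonPotential (β + 1) v p) -
      poissonPotential (β + 1) (moment v) p) = ∫ z, ((-(2 * β) * K p z) • (p.2 •
        ContinuousLinearMap.snd ℝ (EuclideanSpace ℝ (Fin n)) ℝ +
        innerFst (p.1 - z))).smulRight (v z) := by
    simp_rw [← hsplit]
    rw [integral_smul, integral_sub hi1' hi2, ContinuousLinearMap.integral_comp_comm _ hi1]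
    rfl
  rw [hval]
  -- On this neighbourhood `y` stays above `p.2 / 2`, so the kernel is bounded uniformly in `z`, and
  -- the differential grows at most linearly in `z`.
  set s : Set (EuclideanSpace ℝ (Fin n) × ℝ) := Metric.ball p.1 1 ×ˢ Ioo (p.2 / 2) (2 * p.2)
  have hs : s ∈ 𝓝 p := prod_mem_nhds (Metric.ball_mem_nhds _ one_pos)
    (Ioo_mem_nhds (by linarith) (by linarith))
  have hs0 : ∀ q ∈ s, 0 < q.2 := fun q hq => by have := hq.2.1; linarith
  refine hasFDerivAt_integral_of_dominated_of_fderiv_le (s := s)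
    (F := fun p z => (p.2 ^ 2 + ‖p.1 - z‖ ^ 2) ^ (-β) • v z)
    (F' := fun p z => ((-(2 * β) * K p z) • (p.2 •
        ContinuousLinearMap.snd ℝ (EuclideanSpace ℝ (Fin n)) ℝ +
        innerFst (p.1 - z))).smulRight (v z))
    (bound := fun z => (2 * β * ((p.2 / 2) ^ 2) ^ (-(β + 1))) *
      ((2 * p.2 + (‖p.1‖ + 1)) * ‖v z‖ + ‖z‖ ^ 1 * ‖v z‖)) hs ?_
    (integrable_poissonPotential hβ.le hv.integrable p.1 hp) ?_ ?_ ?_ ?_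
  · filter_upwards [hs] with q hq
    exact (continuous_rpow_neg β q.1 (hs0 q hq)).aestronglyMeasurable.smul hv.aestronglyMeasurable
  · simp_rw [← hsplit]
    exact ((hi1'.sub hi2).smul (-(2 * β))).aestronglyMeasurable
  · refine Eventually.of_forall fun z q hq => ?_
    have hq2 := hq.2
    have hqx : ‖q.1‖ ≤ ‖p.1‖ + 1 := by
      have h1 : ‖q.1 - p.1‖ < 1 := by simpa [dist_eq_norm] using hq.1
      have := norm_le_insert' q.1 p.1
      linarith
    have hK0 : 0 ≤ K q z := by simp only [hK]; have := hs0 q hq; positivity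
    have hK1 : K q z ≤ ((p.2 / 2) ^ 2) ^ (-(β + 1)) :=
      rpow_neg_le (by linarith) (by linarith) hq2.1.le _
    have hl : ‖q.2 • ContinuousLinearMap.snd ℝ (EuclideanSpace ℝ (Fin n)) ℝ + innerFst (q.1 - z)‖ ≤
        2 * p.2 + (‖p.1‖ + 1) + ‖z‖ := by
      refine (norm_add_le _ _).trans ?_
      have h1 : ‖q.2 • ContinuousLinearMap.snd ℝ (EuclideanSpace ℝ (Fin n)) ℝ‖ ≤ 2 * p.2 := by
        rw [norm_smul, Real.norm_eq_abs, abs_of_pos (hs0 q hq)]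
        have h2 := ContinuousLinearMap.norm_snd_le ℝ (EuclideanSpace ℝ (Fin n)) ℝ
        have h3 := hs0 q hq
        have h4 := hq2.2
        nlinarith
      have h2 := (norm_innerFst_le (q.1 - z)).trans (norm_sub_le _ _)
      linarith
    rw [ContinuousLinearMap.norm_smulRight_apply, norm_smul, Real.norm_eq_abs, abs_mul, abs_neg,
      abs_of_pos (by linarith : 0 < 2 * β), abs_of_nonneg hK0]
    calc 2 * β * K q z * ‖q.2 • ContinuousLinearMap.snd ℝ (EuclideanSpace ℝ (Fin n)) ℝ +
          innerFst (q.1 - z)‖ * ‖v z‖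
        ≤ 2 * β * ((p.2 / 2) ^ 2) ^ (-(β + 1)) * (2 * p.2 + (‖p.1‖ + 1) + ‖z‖) * ‖v z‖ := by gcongr
      _ = _ := by ring
  · exact ((hv.integrable.norm.const_mul _).add (hv.integrable_pow_mul 1)).const_mul _
  · exact Eventually.of_forall fun z q hq => (hasFDerivAt_rpow_neg β z (hs0 q hq)).smul_const (v z)

/-- The induction quantifies over the target space, since the derivative takes values in continuous
linear maps into `F`. Fixing `F : Type` keeps those maps in the same universe. -/
theorem contDiffOn_poissonPotential_nat (k : ℕ) :
    ∀ {F : Type} [NormedAddCommGroup F] [NormedSpace ℝ F] [CompleteSpace F] {β : ℝ}, 0 < β →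
      ∀ {v : EuclideanSpace ℝ (Fin n) → F}, HasFiniteMoments v →
        ContDiffOn ℝ k (poissonPotential β v) (univ ×ˢ Ioi 0) := by
  induction k with
  | zero =>
    intro F _ _ _ β hβ v hv
    rw [Nat.cast_zero, contDiffOn_zero]
    exact fun p hp => (hasFDerivAt_poissonPotential hβ hv hp.2).continuousAt.continuousWithinAt
  | succ k ih =>
    intro F _ _ _ β hβ v hv
    have ho : IsOpen ((univ : Set (EuclideanSpace ℝ (Fin n))) ×ˢ Ioi (0 : ℝ)) :=
      isOpen_univ.prod isOpen_Ioi
    rw [Nat.cast_add, Nat.cast_one, contDiffOn_succ_iff_fderiv_of_isOpen ho]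
    refine ⟨fun p hp => (hasFDerivAt_poissonPotential hβ hv
      hp.2).differentiableAt.differentiableWithinAt, by simp, ?_⟩
    refine ContDiffOn.congr ?_ fun p hp => (hasFDerivAt_poissonPotential hβ hv hp.2).fderiv
    refine ContDiffOn.const_smul _ (ContDiffOn.sub ?_ (ih (by linarith) hv.moment))
    have h1 : ContDiff ℝ k (fun p : EuclideanSpace ℝ (Fin n) × ℝ =>
        p.2 • ContinuousLinearMap.snd ℝ (EuclideanSpace ℝ (Fin n)) ℝ + innerFst p.1) := by
      refine (contDiff_snd.smul contDiff_const).add ?_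
      exact (((innerSL ℝ).contDiff.comp contDiff_fst).clm_comp contDiff_const)
    exact h1.contDiffOn.smulRight (ih (by linarith) hv)

theorem contDiffOn_poissonPotential [CompleteSpace F] {β : ℝ} (hβ : 0 < β)
    {v : EuclideanSpace ℝ (Fin n) → F} (hv : HasFiniteMoments v) :
    ContDiffOn ℝ ∞ (poissonPotential β v) (univ ×ˢ Ioi 0) :=
  contDiffOn_infty.2 fun k => contDiffOn_poissonPotential_nat k hβ hv

theorem hasFiniteMoments_schwartz (u : 𝓢(EuclideanSpace ℝ (Fin n), ℝ)) :
    HasFiniteMoments (u : EuclideanSpace ℝ (Fin n) → ℝ) :=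
  ⟨u.continuous.aestronglyMeasurable, fun k => u.integrable_pow_mul volume k⟩

end FractionalExtension

/-! ### The extension equation -/

namespace FractionalExtension

variable {n : ℕ}

theorem HasFiniteMoments.inner_mul {v : EuclideanSpace ℝ (Fin n) → ℝ} (hv : HasFiniteMoments v)
    (e : EuclideanSpace ℝ (Fin n)) : HasFiniteMoments (fun z => ⟪z, e⟫_ℝ * v z) := by
  have hm : AEStronglyMeasurable (fun z : EuclideanSpace ℝ (Fin n) => ⟪z, e⟫_ℝ * v z) :=
    (Continuous.aestronglyMeasurable (by fun_prop)).mul hv.aestronglyMeasurable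
  refine ⟨hm, hv.of_norm_le hm (C := ‖e‖) fun z => ?_⟩
  rw [norm_mul]
  calc ‖⟪z, e⟫_ℝ‖ * ‖v z‖ ≤ (‖z‖ * ‖e‖) * ‖v z‖ := by gcongr; exact norm_inner_le_norm _ _
    _ = _ := by ring

theorem fderiv_poissonPotential_apply {β : ℝ} (hβ : 0 < β) {v : EuclideanSpace ℝ (Fin n) → ℝ}
    (hv : HasFiniteMoments v) {p : EuclideanSpace ℝ (Fin n) × ℝ} (hp : 0 < p.2)
    (q : EuclideanSpace ℝ (Fin n) × ℝ) :
    fderiv ℝ (poissonPotential β v) p q = -(2 * β) *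
      ((p.2 * q.2 + ⟪p.1, q.1⟫_ℝ) * poissonPotential (β + 1) v p -
        poissonPotential (β + 1) (fun z => ⟪z, q.1⟫_ℝ * v z) p) := by
  rw [(hasFDerivAt_poissonPotential hβ hv hp).fderiv]
  have h : poissonPotential (β + 1) (moment v) p q =
      poissonPotential (β + 1) (fun z => ⟪z, q.1⟫_ℝ * v z) p := by
    rw [poissonPotential, ContinuousLinearMap.integral_apply
      (integrable_poissonPotential (by linarith) hv.moment.integrable p.1 hp)]
    rfl
  simp only [smul_apply, sub_apply, ContinuousLinearMap.smulRight_apply, h]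
  rfl

theorem hasFDerivAt_poissonPotential_space {β : ℝ} (hβ : 0 < β)
    {v : EuclideanSpace ℝ (Fin n) → ℝ} (hv : HasFiniteMoments v) (x : EuclideanSpace ℝ (Fin n))
    {y : ℝ} (hy : 0 < y) :
    ∃ L : EuclideanSpace ℝ (Fin n) →L[ℝ] ℝ,
      HasFDerivAt (fun x => poissonPotential β v (x, y)) L x ∧
      ∀ e, L e = -(2 * β) * (⟪x, e⟫_ℝ * poissonPotential (β + 1) v (x, y) -
        poissonPotential (β + 1) (fun z => ⟪z, e⟫_ℝ * v z) (x, y)) := by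
  have h := (hasFDerivAt_poissonPotential hβ hv (p := (x, y)) hy).differentiableAt.hasFDerivAt
  have h2 : HasFDerivAt (fun x : EuclideanSpace ℝ (Fin n) => (x, y))
      (ContinuousLinearMap.inl ℝ (EuclideanSpace ℝ (Fin n)) ℝ) x := hasFDerivAt_prodMk_left x y
  refine ⟨_, HasFDerivAt.comp (g := poissonPotential β v) x h h2, fun e => ?_⟩
  rw [ContinuousLinearMap.comp_apply, fderiv_poissonPotential_apply hβ hv hy]
  simp

theorem hasDerivAt_poissonPotential {β : ℝ} (hβ : 0 < β)
    {v : EuclideanSpace ℝ (Fin n) → ℝ} (hv : HasFiniteMoments v) (x : EuclideanSpace ℝ (Fin n))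
    {y : ℝ} (hy : 0 < y) :
    HasDerivAt (fun y => poissonPotential β v (x, y))
      (-(2 * β) * y * poissonPotential (β + 1) v (x, y)) y := by
  have h := (hasFDerivAt_poissonPotential hβ hv (p := (x, y)) hy).differentiableAt.hasFDerivAt
  have h2 : HasDerivAt (fun y : ℝ => (x, y)) ((0 : EuclideanSpace ℝ (Fin n)), (1 : ℝ)) y :=
    (hasDerivAt_const y x).prodMk (hasDerivAt_id y)
  have h3 := h.comp_hasDerivAt y h2
  rw [fderiv_poissonPotential_apply hβ hv hy] at h3
  convert! h3 using 1
  have : poissonPotential (β + 1)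
      (fun z : EuclideanSpace ℝ (Fin n) => ⟪z, 0⟫_ℝ * v z) (x, y) = 0 := by
    simp [poissonPotential]
  rw [this]; simp only [inner_zero_right]; ring

/-- Differentiating twice along `e` produces the expanded square of `⟪x - z, e⟫`; recombined, it can
be summed over a basis. -/
theorem poissonPotential_inner_sq {β : ℝ} (hβ : 0 < β)
    {v : EuclideanSpace ℝ (Fin n) → ℝ} (hv : HasFiniteMoments v) (x e : EuclideanSpace ℝ (Fin n))
    {y : ℝ} (hy : 0 < y) :
    Integrable (fun z => (y ^ 2 + ‖x - z‖ ^ 2) ^ (-β) * (⟪x - z, e⟫_ℝ ^ 2 * v z)) ∧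
    ⟪x, e⟫_ℝ * (⟪x, e⟫_ℝ * poissonPotential β v (x, y) -
        poissonPotential β (fun z => ⟪z, e⟫_ℝ * v z) (x, y)) -
      (⟪x, e⟫_ℝ * poissonPotential β (fun z => ⟪z, e⟫_ℝ * v z) (x, y) -
        poissonPotential β (fun z => ⟪z, e⟫_ℝ * (⟪z, e⟫_ℝ * v z)) (x, y)) =
    ∫ z, (y ^ 2 + ‖x - z‖ ^ 2) ^ (-β) * (⟪x - z, e⟫_ℝ ^ 2 * v z) := by
  have i0 := integrable_poissonPotential hβ.le hv.integrable x hy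
  have i1 := integrable_poissonPotential hβ.le (hv.inner_mul e).integrable x hy
  have i2 := integrable_poissonPotential hβ.le ((hv.inner_mul e).inner_mul e).integrable x hy
  have hE : ∀ z, (y ^ 2 + ‖x - z‖ ^ 2) ^ (-β) * (⟪x - z, e⟫_ℝ ^ 2 * v z) =
      (⟪x, e⟫_ℝ ^ 2 * ((y ^ 2 + ‖x - z‖ ^ 2) ^ (-β) • v z) -
        2 * ⟪x, e⟫_ℝ * ((y ^ 2 + ‖x - z‖ ^ 2) ^ (-β) • (⟪z, e⟫_ℝ * v z))) +
        (y ^ 2 + ‖x - z‖ ^ 2) ^ (-β) • (⟪z, e⟫_ℝ * (⟪z, e⟫_ℝ * v z)) := fun z => by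
    rw [inner_sub_left]; simp only [smul_eq_mul]; ring
  simp_rw [hE]
  refine ⟨((i0.const_mul _).sub (i1.const_mul _)).add i2, ?_⟩
  have i01 : Integrable (fun z => ⟪x, e⟫_ℝ ^ 2 * ((y ^ 2 + ‖x - z‖ ^ 2) ^ (-β) • v z) -
      2 * ⟪x, e⟫_ℝ * ((y ^ 2 + ‖x - z‖ ^ 2) ^ (-β) • (⟪z, e⟫_ℝ * v z))) :=
    (i0.const_mul _).sub (i1.const_mul _)
  rw [integral_add i01 i2, integral_sub (i0.const_mul _) (i1.const_mul _), integral_const_mul, integral_const_mul]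
  simp only [poissonPotential]
  ring

theorem contDiffAt_poissonPotential_space {β : ℝ} (hβ : 0 < β)
    {v : EuclideanSpace ℝ (Fin n) → ℝ} (hv : HasFiniteMoments v) (x : EuclideanSpace ℝ (Fin n))
    {y : ℝ} (hy : 0 < y) : ContDiffAt ℝ 2 (fun x => poissonPotential β v (x, y)) x := by
  have h0 : (univ : Set (EuclideanSpace ℝ (Fin n))) ×ˢ Ioi (0 : ℝ) ∈ 𝓝 (x, y) :=
    (isOpen_univ.prod isOpen_Ioi).mem_nhds ⟨mem_univ _, hy⟩
  have h1 : ContDiffAt ℝ 2 (poissonPotential β v) (x, y) :=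
    contDiffOn_infty.1 (contDiffOn_poissonPotential hβ hv) 2 |>.contDiffAt h0
  exact ContDiffAt.comp x (f := fun x : EuclideanSpace ℝ (Fin n) => (x, y)) h1 (by fun_prop)

/-- Over an orthonormal basis the squared inner products sum to `|x - z|² = q - y²`, where `q = y² +
|x - z|²`. Multiplied by `q^{-(β+2)}` this leaves potentials with exponents `β + 1` and `β + 2` of
the same `v`. -/
theorem laplacian_poissonPotential {β : ℝ} (hβ : 0 < β)
    {v : EuclideanSpace ℝ (Fin n) → ℝ} (hv : HasFiniteMoments v) (x : EuclideanSpace ℝ (Fin n))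
    {y : ℝ} (hy : 0 < y) :
    Laplacian.laplacian (fun x => poissonPotential β v (x, y)) x =
      -(2 * β) * (n - 2 * (β + 1)) * poissonPotential (β + 1) v (x, y) -
        4 * β * (β + 1) * y ^ 2 * poissonPotential (β + 2) v (x, y) := by
  have hC := contDiffAt_poissonPotential_space hβ hv x hy
  set b := EuclideanSpace.basisFun (Fin n) ℝ
  rw [laplacian_eq_sum_fderiv b hC]
  have hterm : ∀ i, fderiv ℝ (fun z => fderiv ℝ (fun x => poissonPotential β v (x, y)) z (b i)) x
      (b i) = -(2 * β) * (poissonPotential (β + 1) v (x, y) - 2 * (β + 1) *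
        ∫ z, (y ^ 2 + ‖x - z‖ ^ 2) ^ (-(β + 2)) * (⟪x - z, b i⟫_ℝ ^ 2 * v z)) := by
    intro i
    have h1 : (fun z => fderiv ℝ (fun x => poissonPotential β v (x, y)) z (b i)) = fun z =>
        -(2 * β) * (⟪z, b i⟫_ℝ * poissonPotential (β + 1) v (z, y) -
          poissonPotential (β + 1) (fun w => ⟪w, b i⟫_ℝ * v w) (z, y)) := by
      ext z
      obtain ⟨L, hL, hLe⟩ := hasFDerivAt_poissonPotential_space hβ hv z hy
      rw [hL.fderiv, hLe]
    obtain ⟨L, hL, hLe⟩ :=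
      hasFDerivAt_poissonPotential_space (β := β + 1) (by linarith) hv x hy
    obtain ⟨M, hM, hMe⟩ :=
      hasFDerivAt_poissonPotential_space (β := β + 1) (by linarith) (hv.inner_mul (b i)) x hy
    have hin : HasFDerivAt (fun z : EuclideanSpace ℝ (Fin n) => ⟪z, b i⟫_ℝ) (innerSL ℝ (b i)) x := by
      have := (innerSL ℝ (b i)).hasFDerivAt (x := x)
      refine this.congr_of_eventuallyEq (Eventually.of_forall fun z => ?_)
      simp [real_inner_comm]
    rw [h1, (((hin.fun_mul hL).fun_sub hM).const_mul (-(2 * β))).fderiv,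
      ← (poissonPotential_inner_sq (by linarith) hv x (b i) hy).2]
    simp only [smul_apply, sub_apply, add_apply, smul_eq_mul, hLe, hMe, innerSL_apply_apply,
      real_inner_self_eq_norm_sq, b.norm_eq_one]
    rw [show β + 1 + 1 = β + 2 by ring]
    ring
  have hsum : ∑ i, ∫ z, (y ^ 2 + ‖x - z‖ ^ 2) ^ (-(β + 2)) * (⟪x - z, b i⟫_ℝ ^ 2 * v z) =
      poissonPotential (β + 1) v (x, y) - y ^ 2 * poissonPotential (β + 2) v (x, y) := by
    rw [← integral_finsetSum _ fun i _ =>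
      (poissonPotential_inner_sq (by linarith) hv x (b i) hy).1]
    simp only [poissonPotential]
    rw [← integral_const_mul, ← integral_sub
      (integrable_poissonPotential (by linarith) hv.integrable x hy)
      ((integrable_poissonPotential (by linarith) hv.integrable x hy).const_mul _)]
    congr 1; ext z
    rw [← Finset.mul_sum, ← Finset.sum_mul]
    have h2 : ∑ i, ⟪x - z, b i⟫_ℝ ^ 2 = ‖x - z‖ ^ 2 := b.sum_sq_inner_left (x - z)
    have hq : 0 < y ^ 2 + ‖x - z‖ ^ 2 := by positivity
    rw [h2, show -(β + 1) = -(β + 2) + 1 by ring, Real.rpow_add hq, Real.rpow_one]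
    simp only [smul_eq_mul]
    ring
  simp_rw [hterm]
  rw [← Finset.mul_sum, Finset.sum_sub_distrib, ← Finset.mul_sum, hsum]
  simp only [Finset.sum_const, Finset.card_univ, Fintype.card_fin, nsmul_eq_mul]
  ring

theorem extension_eq_poissonPotential {s : ℝ} (hs0 : 0 < s)
    (u : 𝓢(EuclideanSpace ℝ (Fin n), ℝ)) (x : EuclideanSpace ℝ (Fin n)) {y : ℝ} (hy : 0 < y) :
    extension s u x y = Real.Gamma ((n : ℝ) / 2 + s) / (Real.Gamma s * Real.pi ^ ((n : ℝ) / 2)) *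
      (y ^ (2 * s) * poissonPotential ((n : ℝ) / 2 + s) u (x, y)) := by
  rw [(extension_eq_poisson hs0 u x hy).2, poissonPotential,
    ← integral_const_mul (y ^ (2 * s))]
  congr 2; ext z
  rw [show ((n : ℝ) + 2 * s) / 2 = n / 2 + s by ring, Real.rpow_neg (by positivity)]
  simp only [smul_eq_mul]
  ring

theorem contDiffOn_extension {s : ℝ} (hs0 : 0 < s) (u : 𝓢(EuclideanSpace ℝ (Fin n), ℝ)) :
    ContDiffOn ℝ ∞ (Function.uncurry (extension s u)) (univ ×ˢ Ioi 0) := by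
  have h1 := contDiffOn_poissonPotential (show 0 < (n : ℝ) / 2 + s by positivity)
    (hasFiniteMoments_schwartz u)
  have h2 : ContDiffOn ℝ ∞ (fun p : EuclideanSpace ℝ (Fin n) × ℝ => p.2 ^ (2 * s))
      (univ ×ˢ Ioi 0) :=
    contDiffOn_snd.rpow_const_of_ne fun p hp => ne_of_gt hp.2
  exact (contDiffOn_const.mul (h2.mul h1)).congr
    fun p hp => extension_eq_poissonPotential hs0 u p.1 hp.2

/-- Three potentials appear. The one of exponent `β` drops out because `y^{2s}` solves the Bessel
equation; those of exponent `β + 2` cancel between the Laplacian and the second `y`-derivative; the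
coefficient at `β + 1` is a multiple of `n - 2β + 2s`, zero for `β = n/2 + s`. -/
theorem extension_equation {s : ℝ} (hs0 : 0 < s) (u : 𝓢(EuclideanSpace ℝ (Fin n), ℝ))
    (x : EuclideanSpace ℝ (Fin n)) {y : ℝ} (hy : 0 < y) :
    Laplacian.laplacian (fun x' => extension s u x' y) x +
      (1 - 2 * s) / y * deriv (extension s u x) y + deriv (deriv (extension s u x)) y = 0 := by
  have hβ : 0 < (n : ℝ) / 2 + s := by positivity
  have hu := hasFiniteMoments_schwartz u
  set c := Real.Gamma ((n : ℝ) / 2 + s) / (Real.Gamma s * Real.pi ^ ((n : ℝ) / 2))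
  set β := (n : ℝ) / 2 + s with hβdef
  have hx : (fun x' => extension s u x' y) =
      (c * y ^ (2 * s)) • fun x' => poissonPotential β u (x', y) := by
    ext x'
    rw [extension_eq_poissonPotential hs0 u x' hy, Pi.smul_apply, smul_eq_mul, mul_assoc]
  have hC := contDiffAt_poissonPotential_space hβ hu x hy
  have hd1 : ∀ w : ℝ, 0 < w → HasDerivAt (extension s u x)
      (c * (2 * s * w ^ (2 * s - 1) * poissonPotential β u (x, w) +
        w ^ (2 * s) * (-(2 * β) * w * poissonPotential (β + 1) u (x, w)))) w := by
    intro w hw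
    have h1 := ((Real.hasDerivAt_rpow_const (p := 2 * s) (Or.inl hw.ne')).fun_mul
      (hasDerivAt_poissonPotential hβ hu x hw)).const_mul c
    refine h1.congr_of_eventuallyEq ?_
    filter_upwards [lt_mem_nhds hw] with w' hw'
    exact extension_eq_poissonPotential hs0 u x hw'
  have hd2 : HasDerivAt (deriv (extension s u x))
      (c * ((2 * s * ((2 * s - 1) * y ^ (2 * s - 1 - 1)) * poissonPotential β u (x, y) +
        2 * s * y ^ (2 * s - 1) * (-(2 * β) * y * poissonPotential (β + 1) u (x, y))) +
        (2 * s * y ^ (2 * s - 1) * (-(2 * β) * y * poissonPotential (β + 1) u (x, y)) +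
        y ^ (2 * s) * (-(2 * β) * 1 * poissonPotential (β + 1) u (x, y) + -(2 * β) * y *
          (-(2 * (β + 1)) * y * poissonPotential (β + 1 + 1) u (x, y)))))) y := by
    have h1 := (Real.hasDerivAt_rpow_const (x := y) (p := 2 * s - 1) (Or.inl hy.ne')).const_mul (2 * s)
    have h2 := h1.fun_mul (hasDerivAt_poissonPotential hβ hu x hy)
    have h3 := ((hasDerivAt_id' y).const_mul (-(2 * β))).fun_mul
      (hasDerivAt_poissonPotential (β := β + 1) (by linarith) hu x hy)
    have h4 := (Real.hasDerivAt_rpow_const (x := y) (p := 2 * s) (Or.inl hy.ne')).fun_mul h3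
    refine ((h2.fun_add h4).const_mul c).congr_of_eventuallyEq ?_
    filter_upwards [lt_mem_nhds hy] with w hw
    exact (hd1 w hw).deriv
  rw [hx, InnerProductSpace.laplacian_smul _ hC, laplacian_poissonPotential hβ hu x hy, hd2.deriv, (hd1 y hy).deriv,
    smul_eq_mul, show β + 1 + 1 = β + 2 by ring]
  have e1 : y ^ (2 * s - 1) = y ^ (2 * s) / y := by rw [Real.rpow_sub hy, Real.rpow_one]
  have e2 : y ^ (2 * s - 1 - 1) = y ^ (2 * s) / y ^ 2 := by
    rw [show 2 * s - 1 - 1 = 2 * s - 2 by ring, Real.rpow_sub hy, Real.rpow_two]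
  have hn : (n : ℝ) = 2 * β - 2 * s := by rw [hβdef]; ring
  rw [e1, e2, hn]
  field_simp
  ring

theorem isExtensionSolution_extension {s : ℝ} (hs0 : 0 < s)
    (u : 𝓢(EuclideanSpace ℝ (Fin n), ℝ)) : IsExtensionSolution s u (extension s u) where
  contDiffOn := contDiffOn_infty.1 (contDiffOn_extension hs0 u) 2
  continuousOn := (continuous_extension hs0 u).continuousOn
  equation := fun x _ hy => extension_equation hs0 u x hy
  boundary := extension_zero hs0 u

end FractionalExtension

theorem mainTheorem1 (n : ℕ) (hn : 1 ≤ n) (s : ℝ) (hs0 : 0 < s) (hs1 : s < 1)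
    (u : 𝓢(EuclideanSpace ℝ (Fin n), ℝ)) :
    ∃ U : EuclideanSpace ℝ (Fin n) → ℝ → ℝ,
      -- existence
      FractionalExtension.IsExtensionSolution s u U ∧ FractionalExtension.WeaklyVanishes U ∧
      -- uniqueness
      (∀ V : EuclideanSpace ℝ (Fin n) → ℝ → ℝ,
        FractionalExtension.IsExtensionSolution s u V → FractionalExtension.WeaklyVanishes V →
        ∀ x, ∀ y : ℝ, 0 ≤ y → V x y = U x y) ∧
      -- first formula
      (∀ x, ∀ y : ℝ, 0 < y →
        IntegrableOn (fun t : ℝ => Real.exp (-(y ^ 2 / (4 * t))) *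
          FractionalExtension.heatSemigroup t u x / t ^ (1 + s)) (Ioi 0) ∧
        U x y = y ^ (2 * s) / (4 ^ s * Real.Gamma s) *
          ∫ t in Ioi (0 : ℝ), Real.exp (-(y ^ 2 / (4 * t))) *
            FractionalExtension.heatSemigroup t u x / t ^ (1 + s)) ∧
      -- second formula
      (∀ x, ∀ y : ℝ, 0 < y →
        IntegrableOn (fun t : ℝ => Real.exp (-t) *
          FractionalExtension.heatSemigroup (y ^ 2 / (4 * t)) u x / t ^ (1 - s)) (Ioi 0) ∧
        U x y = 1 / Real.Gamma s *
          ∫ t in Ioi (0 : ℝ), Real.exp (-t) *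
            FractionalExtension.heatSemigroup (y ^ 2 / (4 * t)) u x / t ^ (1 - s)) ∧
      -- third formula
      (∀ x, ∀ y : ℝ, 0 < y →
        IntegrableOn (fun t : ℝ => Real.exp (-(y ^ 2 / (4 * t))) *
          FractionalExtension.heatSemigroup t (FractionalExtension.fracLaplacian s u) x
            / t ^ (1 - s)) (Ioi 0) ∧
        U x y = 1 / Real.Gamma s *
          ∫ t in Ioi (0 : ℝ), Real.exp (-(y ^ 2 / (4 * t))) *
            FractionalExtension.heatSemigroup t (FractionalExtension.fracLaplacian s u) x
              / t ^ (1 - s)) ∧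
      -- fourth formula
      (∀ x, ∀ y : ℝ, 0 < y →
        Integrable (fun z => y ^ (2 * s) /
          (y ^ 2 + ‖x - z‖ ^ 2) ^ (((n : ℝ) + 2 * s) / 2) * u z) ∧
        U x y = Real.Gamma ((n : ℝ) / 2 + s) / (Real.Gamma s * Real.pi ^ ((n : ℝ) / 2)) *
          ∫ z, y ^ (2 * s) / (y ^ 2 + ‖x - z‖ ^ 2) ^ (((n : ℝ) + 2 * s) / 2) * u z) ∧
      -- regularity
      ContDiffOn ℝ ∞ (Function.uncurry U) (univ ×ˢ Ioi 0) ∧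
      ContinuousOn (Function.uncurry U) (univ ×ˢ Ici 0) ∧
      -- limits
      (∀ x, Tendsto (fun y : ℝ => -(y ^ (1 - 2 * s) * deriv (U x) y)) (𝓝[>] 0)
        (𝓝 (Real.Gamma (1 - s) / (4 ^ (s - 1 / 2) * Real.Gamma s) *
          FractionalExtension.fracLaplacian s u x))) ∧
      (∀ x, Tendsto (fun y : ℝ => -((U x y - U x 0) / y ^ (2 * s))) (𝓝[>] 0)
        (𝓝 (Real.Gamma (1 - s) / (4 ^ s * Real.Gamma (1 + s)) *
          FractionalExtension.fracLaplacian s u x))) := by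
  have hU := FractionalExtension.isExtensionSolution_extension hs0 u
  have hW := FractionalExtension.weaklyVanishes_extension hn hs0 u
  exact ⟨FractionalExtension.extension s u, hU, hW,
    fun V hV hVv x y hy => hU.unique hs0 hs1 hW hV hVv x hy,
    fun x y hy => FractionalExtension.extension_eq_integral_heatSemigroup hs0 u x hy,
    fun x y hy => FractionalExtension.extension_eq_integral_exp hs0 u x hy,
    fun x y _ => FractionalExtension.extension_eq_integral_fracLaplacian hn hs0 hs1 u x y,
    fun x y hy => FractionalExtension.extension_eq_poisson hs0 u x hy,
    FractionalExtension.contDiffOn_extension hs0 u, hU.continuousOn,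
    FractionalExtension.tendsto_weighted_deriv_extension hn hs0 hs1 u,
    FractionalExtension.tendsto_quotient_extension hn hs0 hs1 u⟩
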